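/- Let $\ell_0\in\mathbb{R}^2$, $r_0\in\mathbb{R}$, and let $\omega_0\in L^\infty(\mathbb{R}^2)$ have compact (essential) support contained in $\mathbb{R}^2\setminus\{0\}$ and satisfy $\int_{\mathbb{R}^2}\omega_0\,dx=0$. For $\varepsilon>0$ put $\mathcal{F}^\varepsilon_0=\mathbb{R}^2\setminus\overline{B(0,\varepsilon)}$, let $n$ be the unit normal on $\partial B(0,\varepsilon)$ exterior to $\mathcal{F}^\varepsilon_0$ and $\tau$ the unit tangent, and write $x^\perp=(-x_2,x_1)$, $\operatorname{curl}u=\partial_1u_2-\partial_2u_1$. Then: 1. For every $\varepsilon>0$ with $\operatorname{supp}\omega_0\cap B(0,\varepsilon)=\emptyset$ there is a unique $u_0^\varepsilon\in L^2(\mathcal{F}^\varepsilon_0;\mathbb{R}^2)$ (up to equality almost everywhere) such that $$\operatorname{div}u_0^\varepsilon=0\ \text{ in }\mathcal{F}^\varepsilon_0,\quad \operatorname{curl}u_0^\varepsilon=\omega_0\ \text{ in }\mathcal{F}^\varepsilon_0,\quad \lim_{|x|\to\infty}u_0^\varepsilon(x)=0,\quad u_0^\varepsilon\cdot n=\ell_0\cdot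 n\ \text{ on }\partial B(0,\varepsilon),\quad \oint_{\partial B(0,\varepsilon)}u_0^\varepsilon\cdot\tau\,ds=0 .$$ Here the equations hold in the sense of distributions, the limit at infinity is an essential limit, and the normal trace and the circulation are the weak ones, defined through Green's formula: for all $\varphi\in C_c^\infty(\mathbb{R}^2)$, $\int_{\mathcal{F}^\varepsilon_0}u_0^\varepsilon\cdot\nabla\varphi\,dx=\oint_{\partial B(0,\varepsilon)}(\ell_0\cdot n)\,\varphi\,ds$, and, if moreover $\varphi=1$ in a neighbourhood of $\overline{B(0,\varepsilon)}$, $\int_{\mathcal{F}^\varepsilon_0}\big(u_0^\varepsilon\cdot(\nabla\varphi)^\perp+\omega_0\varphi\big)dx=0$. 2. Extend $u_0^\varepsilon$ to $\mathbb{R}^2$ by $\ell_0+r_0x^\perp$ in $\overline{B(0,\varepsilon)}$. Then, as $\varepsilon\to0^+$, $u_0^\varepsilon\rightharpoonup u_0$ weakly in $L^2(\mathbb{R}^2)$, where $$u_0(x)=K_{\mathbb{R}^2}[\omega_0](x)=\frac1{2\pi}\int_{\mathbb{R}^2}\frac{(x-y)^\perp}{|x-y|^2}\,\omega_0(y)\,dy,$$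 the integral being absolutely convergent for every $x$. 3. $u_0$ is the unique vector field in $L^2(\mathbb{R}^2;\mathbb{R}^2)$ (up to equality almost everywhere) such that $\operatorname{div}u_0=0$ and $\operatorname{curl}u_0=\omega_0$ in $\mathbb{R}^2$ in the sense of distributions and $\lim_{|x|\to\infty}u_0(x)=0$ (as an essential limit). -/

import Mathlib

open MeasureTheory Filter Topology

noncomputable section

namespace ExteriorDisk

/-- The Euclidean plane. -/
abbrev Plane : Type := EuclideanSpace ℝ (Fin 2)

/-- `x^⊥ = (-x₂, x₁)`. -/
def perp (x : Plane) : Plane := !₂[-(x 1), x 0]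

/-- The fluid domain `ℝ² \ closed ball (0, ε)`. -/
def fluid (ε : ℝ) : Set Plane := (Metric.closedBall (0 : Plane) ε)ᶜ

/-- The support of (the a.e. class of) `ω`: the points having no neighbourhood on which `ω`
vanishes almost everywhere. -/
def essSupport (ω : Plane → ℝ) : Set Plane :=
  {x | ∀ U ∈ 𝓝 x, ¬ ∀ᵐ y ∂(volume.restrict U), ω y = 0}

/-- `ω ∈ L^∞_c(O)`: `ω` is essentially bounded and its support is a compact subset of `O`. -/
structure IsLinftyC (O : Set Plane) (ω : Plane → ℝ) : Prop where
  memLp : MemLp ω ⊤ volume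
  isCompact_support : IsCompact (essSupport ω)
  support_subset : essSupport ω ⊆ O

/-- Smooth functions with compact support contained in the open set `O`. -/
structure IsTest (O : Set Plane) (φ : Plane → ℝ) : Prop where
  smooth : ContDiff ℝ ((⊤ : ℕ∞) : WithTop ℕ∞) φ
  compact : HasCompactSupport φ
  support_subset : tsupport φ ⊆ O

/-- `div u = 0` in `O`, in the sense of distributions. -/
def DivFree (O : Set Plane) (u : Plane → Plane) : Prop :=
  ∀ φ : Plane → ℝ, IsTest O φ → ∫ x in O, inner ℝ (u x) (gradient φ x) = 0

/-- `curl u = ∂₁ u₂ - ∂₂ u₁ = ω` in `O`, in the sense of distributions: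
`∫_O u · ∇^⊥ φ = - ∫_O ω φ`. -/
def HasCurl (O : Set Plane) (u : Plane → Plane) (ω : Plane → ℝ) : Prop :=
  ∀ φ : Plane → ℝ, IsTest O φ →
    ∫ x in O, inner ℝ (u x) (perp (gradient φ x)) = - ∫ x in O, ω x * φ x

/-- The arc-length integral `∮_{∂B(0,ε)} f ds`. -/
def circleInt (ε : ℝ) (f : Plane → ℝ) : ℝ :=
  ∫ θ in (0 : ℝ)..(2 * Real.pi), f !₂[ε * Real.cos θ, ε * Real.sin θ] * ε

/-- The unit normal on `∂B(0,ε)` that is exterior to the fluid domain. -/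
def normal (ε : ℝ) (x : Plane) : Plane := -(ε⁻¹ • x)

/-- For a divergence-free `u ∈ L²(fluid ε)`: the (weak) normal trace `u · n` on `∂B(0,ε)` is `g`.
This is Green's formula `∫_F u · ∇φ + ∫_F (div u) φ = ∮ (u · n) φ ds`, with test functions `φ`
that need not vanish on the circle. -/
def HasNormalTrace (ε : ℝ) (u : Plane → Plane) (g : Plane → ℝ) : Prop :=
  ∀ φ : Plane → ℝ, IsTest Set.univ φ →
    ∫ x in fluid ε, inner ℝ (u x) (gradient φ x) = circleInt ε (fun x => g x * φ x)

/-- For `u ∈ L²(fluid ε)` with `curl u = ω`: the (weak) circulation `∮_{∂B(0,ε)} u · τ ds`,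
counterclockwise, is `γ`. This is Green's formula
`∮ φ (u · τ) ds = - ∫_F (u · ∇^⊥ φ + ω φ)` applied to cutoff functions `φ` which are equal to `1`
around the disk. -/
def HasCirculation (ε : ℝ) (u : Plane → Plane) (ω : Plane → ℝ) (γ : ℝ) : Prop :=
  ∀ φ : Plane → ℝ, IsTest Set.univ φ →
    (∀ᶠ x in 𝓝ˢ (Metric.closedBall (0 : Plane) ε), φ x = 1) →
    -(∫ x in fluid ε, (inner ℝ (u x) (perp (gradient φ x)) + ω x * φ x)) = γ

/-- `u(x) → 0` as `|x| → ∞`, for a vector field defined up to null sets. -/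
def VanishesAtInfinity (u : Plane → Plane) : Prop :=
  Tendsto u (Bornology.cobounded Plane ⊓ ae volume) (𝓝 0)

/-- `u ∈ L²(fluid ε)` solves the div-curl problem in the exterior of the disk, with vorticity `ω`,
normal trace `ℓ · n`, zero circulation around the disk, and vanishing at infinity. -/
structure IsExteriorSolution (ε : ℝ) (ℓ : Plane) (ω : Plane → ℝ) (u : Plane → Plane) :
    Prop where
  memLp : MemLp u 2 (volume.restrict (fluid ε))
  divFree : DivFree (fluid ε) u
  hasCurl : HasCurl (fluid ε) u ω
  vanishes : VanishesAtInfinity u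
  normalTrace : HasNormalTrace ε u (fun x => inner ℝ ℓ (normal ε x))
  circulation : HasCirculation ε u ω 0

/-- `u ∈ L²(ℝ²)` solves the div-curl problem in the whole plane with vorticity `ω`. -/
structure IsPlaneSolution (ω : Plane → ℝ) (u : Plane → Plane) : Prop where
  memLp : MemLp u 2 volume
  divFree : DivFree Set.univ u
  hasCurl : HasCurl Set.univ u ω
  vanishes : VanishesAtInfinity u

/-- The Biot–Savart kernel `x^⊥ / (2π|x|²)`. -/
def bsKernel (x : Plane) : Plane := (2 * Real.pi * ‖x‖ ^ 2)⁻¹ • perp x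

/-- The Biot–Savart field `K[ω] = (x^⊥ / (2π|x|²)) * ω`,
i.e. `K[ω](x) = ∫ ω(y) (x-y)^⊥ / (2π|x-y|²) dy`. -/
def biotSavart (ω : Plane → ℝ) : Plane → Plane :=
  convolution ω bsKernel (ContinuousLinearMap.lsmul ℝ ℝ) volume

/-- The extension of `u` by the rigid velocity `ℓ + r x^⊥` inside the disk of radius `ε`. -/
def rigidExtension (ε : ℝ) (ℓ : Plane) (r : ℝ) (u : Plane → Plane) (x : Plane) : Plane :=
  if ‖x‖ ≤ ε then ℓ + r • perp x else u x

/-- `v ε ⇀ v₀` weakly in `L²(ℝ²)` as `ε → 0⁺`. -/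
structure WeakTendstoL2 (v : ℝ → Plane → Plane) (v₀ : Plane → Plane) : Prop where
  memLp : ∀ᶠ ε in 𝓝[>] (0 : ℝ), MemLp (v ε) 2 volume
  memLp_limit : MemLp v₀ 2 volume
  tendsto : ∀ φ : Plane → Plane, MemLp φ 2 volume →
    Tendsto (fun ε => ∫ x, inner ℝ (v ε x) (φ x)) (𝓝[>] (0 : ℝ))
      (𝓝 (∫ x, inner ℝ (v₀ x) (φ x)))

end ExteriorDisk

end

noncomputable section

namespace ExteriorDisk

/-! A planar field `u` is encoded by its complex velocity `f = u₁ - i u₂`. For a real test function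
`φ`, `f · dbar φ = u·∇φ - i u·∇^⊥φ`, so divergence and curl are the real and imaginary parts of one
weak `dbar` equation.

Uniqueness. The difference of two solutions has `f` in L² and weakly holomorphic outside the disk.
Weyl's lemma (`WeaklyHolomorphic.ae_eq_regularize`) makes it holomorphic there, so it has a Laurent
expansion. Square integrability at infinity kills every power `z^n` with `n ≥ -1`
(`moment_eq_zero_of_memLp`). The remaining powers are killed by the zero normal trace, tested with
`Re (c z^m)` times a radial cutoff (`moment_eq_zero_of_normalTrace`). Everything works for radius
`0`, which gives uniqueness in the plane even when the curl is only tested away from the origin.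

Existence. The Biot–Savart field `K` is a Cauchy transform. Zero mean of the vorticity improves its
decay to `|z|⁻²`, hence `K ∈ L²`. To correct the normal trace, choose a compactly supported stream
function `η` with `∇^⊥η = ℓ` on the disk, and let `p` be the projection of `∇^⊥η - K` onto the
closure of the gradients in L² of the exterior domain. Then `K + p` has the right normal trace
because `∇^⊥η` is orthogonal to gradients over the whole plane; `p`, a limit of gradients, changes
neither curl nor circulation. The projection is a contraction, so the bound is uniform in `ε`.

Weak limit. By that bound it suffices to test on a total set: gradients, and rotated gradients of
functions supported away from `0`, which are total by uniqueness in the punctured plane. Against the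
former only a rigid rotation on a shrinking disk remains; against the latter the pairings agree
exactly for small `ε`. -/

open Complex in
/-- `dbar φ = ∂ₓφ + i ∂_yφ`, twice the Wirtinger derivative `∂φ/∂z̄`. -/
def dbar (φ : ℂ → ℂ) (z : ℂ) : ℂ := fderiv ℝ φ z 1 + I * fderiv ℝ φ z I

/-! ### Polar coordinates: the fundamental solution of `dbar` and the divergence theorem on a disk
-/

section Polar

open Complex

lemma polarCoord_symm_eq_circleMap (p : ℝ × ℝ) :
    Complex.polarCoord.symm p = circleMap 0 p.1 p.2 := by
  simp [circleMap, Complex.exp_mul_I]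

lemma integral_eq_polar_prod {E : Type*} [NormedAddCommGroup E] [NormedSpace ℝ E] (h : ℂ → E) :
    ∫ z, h z = ∫ p in Set.Ioi (0 : ℝ) ×ˢ Set.Ioo (-Real.pi) Real.pi,
      p.1 • h (circleMap 0 p.1 p.2) := by
  rw [← Complex.integral_comp_polarCoord_symm]
  simp_rw [polarCoord_symm_eq_circleMap]
  rfl

lemma integrableOn_polar {E : Type*} [NormedAddCommGroup E] [NormedSpace ℝ E] {h : ℂ → E}
    (hh : Integrable h) :
    IntegrableOn (fun p : ℝ × ℝ => p.1 • h (circleMap 0 p.1 p.2))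
      (Set.Ioi (0 : ℝ) ×ˢ Set.Ioo (-Real.pi) Real.pi) := by
  have h1 : Integrable (fun p : ℝ × ℝ => h (measurableEquivRealProd.symm p)) :=
    (Complex.volume_preserving_equiv_real_prod.symm).integrable_comp_emb
      measurableEquivRealProd.symm.measurableEmbedding |>.2 hh
  have h2 := (integrableOn_image_iff_integrableOn_abs_det_fderiv_smul volume
    _root_.polarCoord.open_target.measurableSet
    (fun p _ => (hasFDerivAt_polarCoord_symm p).hasFDerivWithinAt)
    _root_.polarCoord.symm.injOn (fun p : ℝ × ℝ => h (measurableEquivRealProd.symm p))).1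
      h1.integrableOn
  refine (integrableOn_congr_fun ?_ _root_.polarCoord.open_target.measurableSet).1 h2
  intro p hp
  have hp1 : 0 < p.1 := hp.1
  simp only [det_fderivPolarCoordSymm, abs_of_pos hp1]
  rw [Complex.measurableEquivRealProd_symm_polarCoord_symm_apply, polarCoord_symm_eq_circleMap]

lemma integral_polar {E : Type*} [NormedAddCommGroup E] [NormedSpace ℝ E] {h : ℂ → E}
    (hh : Integrable h) :
    ∫ z, h z = ∫ r in Set.Ioi (0 : ℝ), r • ∫ θ in (-Real.pi)..Real.pi, h (circleMap 0 r θ) := by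
  have h1 := integrableOn_polar hh
  rw [integral_eq_polar_prod]
  rw [Measure.volume_eq_prod] at h1 ⊢
  rw [setIntegral_prod _ h1]
  refine integral_congr_ae (Eventually.of_forall fun r => ?_)
  dsimp only
  rw [integral_smul, intervalIntegral.integral_of_le (by linarith [Real.pi_pos]),
    integral_Ioc_eq_integral_Ioo]

/-- Rotating the orthonormal frame `(1, i)` by `θ` multiplies `∂₁ + i∂₂` by `e^{-iθ}`. With the
radial and angular directions as frame this is `dbar = e^{iθ}(∂_r + (i/r)∂_θ)`. -/
lemma exp_mul_dbar (φ : ℂ → ℂ) (z : ℂ) (θ : ℝ) :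
    dbar φ z =
      cexp (θ * I) * (fderiv ℝ φ z (cexp (θ * I)) + I * fderiv ℝ φ z (I * cexp (θ * I))) := by
  have h1 : cexp (θ * I) = (Real.cos θ) • (1 : ℂ) + (Real.sin θ) • I := by
    rw [Complex.exp_mul_I]; simp
  have h2 : I * cexp (θ * I) = (-Real.sin θ) • (1 : ℂ) + (Real.cos θ) • I := by
    rw [Complex.exp_mul_I]; simp [mul_add]; ring_nf; simp; ring
  rw [h2]
  nth_rw 2 [h1]
  rw [Complex.exp_mul_I]
  simp only [map_add, map_smul, dbar]
  simp only [real_smul]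
  have := Complex.sin_sq_add_cos_sq (θ : ℂ)
  push_cast
  linear_combination (-(fderiv ℝ φ z 1) - I * fderiv ℝ φ z I) * this
    + (- sin θ * cos θ * fderiv ℝ φ z I + fderiv ℝ φ z 1 * sin θ ^ 2) * I_sq

lemma hasDerivAt_circleMap_radius (r θ : ℝ) :
    HasDerivAt (fun r : ℝ => circleMap 0 r θ) (cexp (θ * I)) r := by
  simp only [circleMap_zero]
  simpa using (Complex.ofRealCLM.hasDerivAt (x := r)).mul_const (cexp (θ * I))

lemma hasDerivAt_comp_radius {φ : ℂ → ℂ} (hφ : ContDiff ℝ 1 φ) (r θ : ℝ) :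
    HasDerivAt (fun r : ℝ => φ (circleMap 0 r θ))
      (fderiv ℝ φ (circleMap 0 r θ) (cexp (θ * I))) r :=
  ((hφ.differentiable (by norm_num)) _).hasFDerivAt.comp_hasDerivAt r
    (hasDerivAt_circleMap_radius r θ)

lemma hasDerivAt_comp_angle {φ : ℂ → ℂ} (hφ : ContDiff ℝ 1 φ) (r θ : ℝ) :
    HasDerivAt (fun θ : ℝ => φ (circleMap 0 r θ))
      (r * fderiv ℝ φ (circleMap 0 r θ) (I * cexp (θ * I))) θ := by
  have h := ((hφ.differentiable (by norm_num)) (circleMap 0 r θ)).hasFDerivAt.comp_hasDerivAt θ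
    (hasDerivAt_circleMap 0 r θ)
  have h2 : circleMap 0 r θ * I = r • (I * cexp (θ * I)) := by
    simp [circleMap_zero]; ring
  rw [h2, map_smul, real_smul] at h
  exact h

lemma continuous_fderiv_circleMap {φ : ℂ → ℂ} (hφ : ContDiff ℝ 1 φ) {v : ℝ → ℂ}
    (hv : Continuous v) :
    Continuous (fun p : ℝ × ℝ => fderiv ℝ φ (circleMap 0 p.1 p.2) (v p.2)) := by
  have h1 := hφ.continuous_fderiv (by norm_num)
  have h2 : Continuous (fun p : ℝ × ℝ => circleMap 0 p.1 p.2) := by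
    unfold circleMap; fun_prop
  exact (h1.comp h2).clm_apply (hv.comp continuous_snd)

lemma circleMap_pi_eq (r : ℝ) : circleMap 0 r Real.pi = circleMap 0 r (-Real.pi) := by
  have := periodic_circleMap 0 r (-Real.pi)
  rw [← this]; congr 1; ring

/-- The fundamental solution of `dbar`: `∫ z⁻¹ dbar φ = -2π φ(0)`. -/
theorem integral_inv_mul_dbar {φ : ℂ → ℂ} (hφ : ContDiff ℝ 1 φ) (hc : HasCompactSupport φ)
    (hint : Integrable (fun z => z⁻¹ * dbar φ z)) :
    ∫ z, z⁻¹ * dbar φ z = -(2 * Real.pi * φ 0) := by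
  obtain ⟨R, hR0, hR⟩ : ∃ R : ℝ, 0 < R ∧ ∀ z : ℂ, R ≤ ‖z‖ → z ∉ tsupport φ := by
    obtain ⟨R, hR⟩ := hc.isBounded.subset_ball (0 : ℂ)
    refine ⟨max R 1, by positivity, fun z hz hz' => ?_⟩
    have := hR hz'
    simp at this
    linarith [le_max_left R 1]
  have hcont : Continuous (fun θ : ℝ => cexp (θ * I)) := by fun_prop
  have hA := continuous_fderiv_circleMap hφ hcont
  have hB := continuous_fderiv_circleMap hφ (v := fun θ => I * cexp (θ * I)) (by fun_prop)
  have hpi : -Real.pi ≤ Real.pi := by linarith [Real.pi_pos]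
  rw [integral_polar hint]
  have step : ∀ r ∈ Set.Ioi (0 : ℝ),
      r • ∫ θ in (-Real.pi)..Real.pi, (circleMap 0 r θ)⁻¹ * dbar φ (circleMap 0 r θ) =
        ∫ θ in (-Real.pi)..Real.pi, fderiv ℝ φ (circleMap 0 r θ) (cexp (θ * I)) := by
    intro r hr
    have hr : (0 : ℝ) < r := hr
    have hr' : (r : ℂ) ≠ 0 := by exact_mod_cast hr.ne'
    -- The Jacobian `r` and the phase of `dbar` cancel `z⁻¹`, leaving `∂_r φ + (i/r)∂_θ φ`; the
    -- angular derivative integrates to zero over a period.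
    have e1 : ∀ θ : ℝ, r • ((circleMap 0 r θ)⁻¹ * dbar φ (circleMap 0 r θ)) =
        fderiv ℝ φ (circleMap 0 r θ) (cexp (θ * I)) +
          (I / r) * (r * fderiv ℝ φ (circleMap 0 r θ) (I * cexp (θ * I))) := by
      intro θ
      have := Complex.exp_ne_zero (θ * I)
      rw [exp_mul_dbar φ _ θ]
      nth_rw 1 [circleMap_zero]
      rw [real_smul]
      field_simp
    rw [← intervalIntegral.integral_smul]
    simp_rw [e1]
    have hBr : Continuous fun θ : ℝ => fderiv ℝ φ (circleMap 0 r θ) (I * cexp (θ * I)) :=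
      hB.comp (by fun_prop : Continuous fun θ : ℝ => (r, θ))
    have hAr : Continuous fun θ : ℝ => fderiv ℝ φ (circleMap 0 r θ) (cexp (θ * I)) :=
      hA.comp (by fun_prop : Continuous fun θ : ℝ => (r, θ))
    rw [intervalIntegral.integral_add (hAr.intervalIntegrable _ _)
      ((by fun_prop : Continuous fun θ : ℝ => (I / r) * (r *
        fderiv ℝ φ (circleMap 0 r θ) (I * cexp (θ * I)))).intervalIntegrable _ _),
      intervalIntegral.integral_const_mul,
      intervalIntegral.integral_eq_sub_of_hasDerivAt (fun θ _ => hasDerivAt_comp_angle hφ r θ)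
        ((by fun_prop : Continuous fun θ : ℝ => (r *
        fderiv ℝ φ (circleMap 0 r θ) (I * cexp (θ * I)))).intervalIntegrable _ _),
      circleMap_pi_eq]
    simp
  rw [setIntegral_congr_fun measurableSet_Ioi step]
  have hzero : ∀ r, R ≤ r → ∀ θ : ℝ, circleMap 0 r θ ∉ tsupport φ := by
    intro r hr θ
    apply hR
    rw [norm_circleMap_zero]
    exact hr.trans (le_abs_self r)
  have hres : ∫ r in Set.Ioi (0 : ℝ), ∫ θ in (-Real.pi)..Real.pi,
        fderiv ℝ φ (circleMap 0 r θ) (cexp (θ * I)) =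
      ∫ r in (0 : ℝ)..R, ∫ θ in (-Real.pi)..Real.pi,
        fderiv ℝ φ (circleMap 0 r θ) (cexp (θ * I)) := by
    rw [intervalIntegral.integral_of_le hR0.le]
    refine setIntegral_eq_of_subset_of_forall_sdiff_eq_zero measurableSet_Ioi
      Set.Ioc_subset_Ioi_self ?_
    intro r hr
    have hr' : R ≤ r := by
      by_contra h
      exact hr.2 ⟨hr.1, (not_le.1 h).le⟩
    have : ∀ θ : ℝ, fderiv ℝ φ (circleMap 0 r θ) (cexp (θ * I)) = 0 := by
      intro θ
      rw [fderiv_of_notMem_tsupport ℝ (hzero r hr' θ)]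
      rfl
    simp [this]
  rw [hres, intervalIntegral_intervalIntegral_swap]
  -- After the swap, each ray contributes `φ(R e^{iθ}) - φ(0) = -φ(0)`.
  · have : ∀ θ : ℝ, ∫ r in (0 : ℝ)..R, fderiv ℝ φ (circleMap 0 r θ) (cexp (θ * I)) = - φ 0 := by
      intro θ
      have hAθ : Continuous fun r : ℝ => fderiv ℝ φ (circleMap 0 r θ) (cexp (θ * I)) :=
        hA.comp (by fun_prop : Continuous fun r : ℝ => (r, θ))
      rw [intervalIntegral.integral_eq_sub_of_hasDerivAt (fun r _ => hasDerivAt_comp_radius hφ r θ)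
        (hAθ.intervalIntegrable _ _), image_eq_zero_of_notMem_tsupport (hzero R le_rfl θ)]
      simp
    simp_rw [this]
    rw [intervalIntegral.integral_const, real_smul]
    push_cast
    ring
  · exact (hA.integrableOn_Icc (a := ((0 : ℝ), -Real.pi)) (b := (R, Real.pi))).mono_set (by
      rw [Set.uIoc_of_le hR0.le, Set.uIoc_of_le hpi]
      intro p hp
      exact ⟨⟨hp.1.1.le, hp.2.1.le⟩, ⟨hp.1.2, hp.2.2⟩⟩)

/-- The divergence theorem on a disk, for `dbar`. -/
theorem integral_closedBall_dbar {φ : ℂ → ℂ} (hφ : ContDiff ℝ 1 φ) {ε : ℝ} (hε : 0 < ε) :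
    ∫ z in Metric.closedBall (0 : ℂ) ε, dbar φ z =
      ∫ θ in (0 : ℝ)..(2 * Real.pi), circleMap 0 ε θ * φ (circleMap 0 ε θ) := by
  have hpi : -Real.pi ≤ Real.pi := by linarith [Real.pi_pos]
  have hcont : Continuous (fun θ : ℝ => cexp (θ * I)) := by fun_prop
  have hA := continuous_fderiv_circleMap hφ hcont
  have hB := continuous_fderiv_circleMap hφ (v := fun θ => I * cexp (θ * I)) (by fun_prop)
  have hcm : Continuous (fun p : ℝ × ℝ => circleMap 0 p.1 p.2) := by
    unfold circleMap; fun_prop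
  have hφm : Continuous (fun p : ℝ × ℝ => φ (circleMap 0 p.1 p.2)) := hφ.continuous.comp hcm
  have hdc : Continuous (dbar φ) := by
    have := hφ.continuous_fderiv (by norm_num)
    unfold dbar
    fun_prop
  rw [← integral_indicator measurableSet_closedBall, integral_polar
    ((hdc.continuousOn.integrableOn_compact (isCompact_closedBall 0 ε)).integrable_indicator
      measurableSet_closedBall)]
  -- Conservative form: `r dbar φ = ∂_r(r e^{iθ} φ) + ∂_θ(i e^{iθ} φ)`. `G` is the first term; the
  -- second integrates to zero in `θ`.
  let G : ℝ → ℝ → ℂ := fun r θ => cexp (θ * I) * φ (circleMap 0 r θ) +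
      r * cexp (θ * I) * fderiv ℝ φ (circleMap 0 r θ) (cexp (θ * I))
  have hG : Continuous (Function.uncurry G) := by
    have e : Continuous fun p : ℝ × ℝ => cexp (p.2 * I) := by fun_prop
    exact (e.mul hφm).add (((by fun_prop : Continuous fun p : ℝ × ℝ => (p.1 : ℂ)).mul e).mul hA)
  have step : ∀ r ∈ Set.Ioc (0 : ℝ) ε,
      r • ∫ θ in (-Real.pi)..Real.pi, dbar φ (circleMap 0 r θ) =
        ∫ θ in (-Real.pi)..Real.pi, G r θ := by
    intro r hr
    have hBr : Continuous fun θ : ℝ => fderiv ℝ φ (circleMap 0 r θ) (I * cexp (θ * I)) :=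
      hB.comp (by fun_prop : Continuous fun θ : ℝ => (r, θ))
    have hφr : Continuous fun θ : ℝ => φ (circleMap 0 r θ) :=
      hφm.comp (by fun_prop : Continuous fun θ : ℝ => (r, θ))
    have hGr : Continuous fun θ : ℝ => G r θ :=
      hG.comp (by fun_prop : Continuous fun θ : ℝ => (r, θ))
    have e1 : ∀ θ : ℝ, r • dbar φ (circleMap 0 r θ) = G r θ +
        ((I * (cexp (θ * I) * I)) * φ (circleMap 0 r θ) + I * cexp (θ * I) *
          (r * fderiv ℝ φ (circleMap 0 r θ) (I * cexp (θ * I)))) := by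
      intro θ
      rw [exp_mul_dbar φ _ θ, real_smul]
      simp only [G]
      linear_combination (-cexp (θ * I) * φ (circleMap 0 r θ)) * I_sq
    have d : ∀ θ : ℝ, HasDerivAt (fun θ : ℝ => I * cexp (θ * I) * φ (circleMap 0 r θ))
        ((I * (cexp (θ * I) * I)) * φ (circleMap 0 r θ) + I * cexp (θ * I) *
          (r * fderiv ℝ φ (circleMap 0 r θ) (I * cexp (θ * I)))) θ := by
      intro θ
      have : HasDerivAt (fun θ : ℝ => cexp (θ * I)) (cexp (θ * I) * I) θ := by
        simpa using ((Complex.ofRealCLM.hasDerivAt (x := θ)).mul_const I).cexp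
      exact (this.const_mul I).mul (hasDerivAt_comp_angle hφ r θ)
    have dc : Continuous fun θ : ℝ => ((I * (cexp (θ * I) * I)) * φ (circleMap 0 r θ) +
        I * cexp (θ * I) * (r * fderiv ℝ φ (circleMap 0 r θ) (I * cexp (θ * I)))) := by
      fun_prop
    rw [← intervalIntegral.integral_smul]
    simp_rw [e1]
    rw [intervalIntegral.integral_add (hGr.intervalIntegrable _ _) (dc.intervalIntegrable _ _),
      intervalIntegral.integral_eq_sub_of_hasDerivAt (fun θ _ => d θ) (dc.intervalIntegrable _ _),
      circleMap_pi_eq]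
    have : cexp ((Real.pi : ℝ) * I) = cexp (((-Real.pi : ℝ) : ℂ) * I) := by
      push_cast
      rw [neg_mul, Complex.exp_neg, Complex.exp_pi_mul_I]; norm_num
    rw [this, sub_self, add_zero]
  have hind : ∀ r ∈ Set.Ioi (0 : ℝ), (r • ∫ θ in (-Real.pi)..Real.pi,
      (Metric.closedBall (0 : ℂ) ε).indicator (fun z => dbar φ z) (circleMap 0 r θ)) =
      (Set.Ioc 0 ε).indicator (fun r => ∫ θ in (-Real.pi)..Real.pi, G r θ) r := by
    intro r hr
    have hr : 0 < r := hr
    by_cases h : r ≤ ε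
    · rw [Set.indicator_of_mem (show r ∈ Set.Ioc 0 ε from ⟨hr, h⟩), ← step r ⟨hr, h⟩]
      congr 2
      ext θ
      rw [Set.indicator_of_mem]
      simp [abs_of_pos hr, h]
    · rw [Set.indicator_of_notMem (fun h' => h h'.2)]
      have : ∀ θ : ℝ, (Metric.closedBall (0 : ℂ) ε).indicator (fun z => dbar φ z)
          (circleMap 0 r θ) = 0 := by
        intro θ
        rw [Set.indicator_of_notMem]
        simpa [abs_of_pos hr] using h
      simp [this]
  rw [setIntegral_congr_fun measurableSet_Ioi hind, setIntegral_indicator measurableSet_Ioc,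
    Set.inter_eq_right.2 Set.Ioc_subset_Ioi_self, ← intervalIntegral.integral_of_le hε.le,
    intervalIntegral_intervalIntegral_swap]
  · have : ∀ θ : ℝ, ∫ r in (0 : ℝ)..ε, G r θ = circleMap 0 ε θ * φ (circleMap 0 ε θ) := by
      intro θ
      have hGθ : Continuous fun r : ℝ => G r θ :=
        hG.comp (by fun_prop : Continuous fun r : ℝ => (r, θ))
      have d : ∀ r : ℝ, HasDerivAt (fun r : ℝ => circleMap 0 r θ * φ (circleMap 0 r θ))
          (G r θ) r := by
        intro r
        have := (hasDerivAt_circleMap_radius r θ).mul (hasDerivAt_comp_radius hφ r θ)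
        convert! this using 1
        simp only [G]
        simp only [circleMap_zero]
      rw [intervalIntegral.integral_eq_sub_of_hasDerivAt (fun r _ => d r)
        (hGθ.intervalIntegrable _ _)]
      simp
    simp_rw [this]
    have hp : Function.Periodic (fun θ : ℝ => circleMap 0 ε θ * φ (circleMap 0 ε θ))
        (2 * Real.pi) := fun θ => by simp only [periodic_circleMap 0 ε θ]
    have := hp.intervalIntegral_add_eq (-Real.pi) 0
    rw [zero_add] at this
    rw [← this]
    congr 1
    ring
  · exact (hG.integrableOn_Icc (a := ((0 : ℝ), -Real.pi)) (b := (ε, Real.pi))).mono_set (by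
      rw [Set.uIoc_of_le hε.le, Set.uIoc_of_le hpi]
      intro p hp
      exact ⟨⟨hp.1.1.le, hp.2.1.le⟩, ⟨hp.1.2, hp.2.2⟩⟩)

end Polar

/-! ### Calculus rules for `dbar` -/

section Dbar

open Complex

lemma dbar_mul {φ ψ : ℂ → ℂ} {z : ℂ} (hφ : DifferentiableAt ℝ φ z) (hψ : DifferentiableAt ℝ ψ z) :
    dbar (fun z => φ z * ψ z) z = φ z * dbar ψ z + dbar φ z * ψ z := by
  simp only [dbar]
  rw [fderiv_fun_mul hφ hψ]
  simp
  ring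

lemma dbar_add {φ ψ : ℂ → ℂ} {z : ℂ} (hφ : DifferentiableAt ℝ φ z) (hψ : DifferentiableAt ℝ ψ z) :
    dbar (fun z => φ z + ψ z) z = dbar φ z + dbar ψ z := by
  simp only [dbar]
  rw [fderiv_fun_add hφ hψ]
  simp
  ring

lemma dbar_const_mul {φ : ℂ → ℂ} {z : ℂ} (hφ : DifferentiableAt ℝ φ z) (c : ℂ) :
    dbar (fun z => c * φ z) z = c * dbar φ z := by
  simp only [dbar]
  rw [fderiv_const_mul hφ]
  simp
  ring

lemma dbar_comp_sub_left {ψ : ℂ → ℂ} (hψ : Differentiable ℝ ψ) (x y : ℂ) :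
    dbar (fun y => ψ (x - y)) y = -dbar ψ (x - y) := by
  have h : HasFDerivAt (fun y => ψ (x - y)) _ y :=
    (hψ (x - y)).hasFDerivAt.comp y ((hasFDerivAt_id y).const_sub x)
  simp only [dbar, h.fderiv]
  simp
  ring

lemma dbar_of_notMem_tsupport {φ : ℂ → ℂ} {z : ℂ} (h : z ∉ tsupport φ) : dbar φ z = 0 := by
  simp [dbar, fderiv_of_notMem_tsupport ℝ h]

lemma continuous_dbar {φ : ℂ → ℂ} (hφ : ContDiff ℝ 1 φ) : Continuous (dbar φ) := by
  have := hφ.continuous_fderiv (by norm_num)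
  unfold dbar
  fun_prop

lemma hasCompactSupport_dbar {φ : ℂ → ℂ} (hφ : HasCompactSupport φ) :
    HasCompactSupport (dbar φ) :=
  HasCompactSupport.of_support_subset_isCompact hφ fun z hz => by
    by_contra h
    exact hz (dbar_of_notMem_tsupport h)

/-- Chain rule through `|z|²`, for which `dbar |z|² = 2z`. This factor `z` later cancels the pole of
`1/z`. -/
lemma dbar_radial {s : ℝ → ℝ} (hs : Differentiable ℝ s) (z : ℂ) :
    dbar (fun z => ((s (‖z‖ ^ 2) : ℝ) : ℂ)) z = 2 * z * (deriv s (‖z‖ ^ 2) : ℝ) := by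
  have h1 : HasFDerivAt (fun z : ℂ => ‖z‖ ^ 2) (2 • innerSL ℝ z) z :=
    (hasStrictFDerivAt_norm_sq z).hasFDerivAt
  have h2 := ((hs _).hasDerivAt (x := ‖z‖ ^ 2)).comp_hasFDerivAt z h1
  have h3 := (Complex.ofRealCLM.hasFDerivAt).comp z h2
  have h4 : HasFDerivAt (fun z => ((s (‖z‖ ^ 2) : ℝ) : ℂ)) _ z := h3
  rw [dbar, h4.fderiv]
  simp [Complex.inner]
  apply Complex.ext <;> simp <;> ring

lemma dbar_convolution {N ψ : ℂ → ℂ} (hN : LocallyIntegrable N) (hψ : ContDiff ℝ 1 ψ)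
    (hc : HasCompactSupport ψ) (x : ℂ) :
    dbar (convolution N ψ (ContinuousLinearMap.mul ℝ ℂ) volume) x =
      convolution N (dbar ψ) (ContinuousLinearMap.mul ℝ ℂ) volume x := by
  have h := hc.hasFDerivAt_convolution_right (ContinuousLinearMap.mul ℝ ℂ) hN hψ x
  have hf := hψ.continuous_fderiv (by norm_num)
  have hfc := hc.fderiv (𝕜 := ℝ)
  rw [dbar, h.fderiv, convolution_precompR_apply _ hN hfc hf,
    convolution_precompR_apply _ hN hfc hf]
  have hint : ∀ v : ℂ, Integrable (fun t => N t * fderiv ℝ ψ (x - t) v) := fun v => by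
    have : HasCompactSupport fun a => fderiv ℝ ψ a v :=
      hfc.comp_left (g := fun L : ℂ →L[ℝ] ℂ => L v) rfl
    exact (this.convolutionExists_right (ContinuousLinearMap.mul ℝ ℂ) hN
      (by fun_prop)) x
  simp only [convolution_def, ContinuousLinearMap.mul_apply', dbar]
  rw [← integral_const_mul, ← integral_add (hint 1) ((hint I).const_mul I)]
  congr 1
  ext t
  ring

end Dbar

/-! ### A compactly supported parametrix for `dbar` -/

section Mollifier

open Complex

/-- A smooth function which is `1` at `0` and vanishes on `[ρ², ∞)`. -/
def profile (ρ t : ℝ) : ℝ := Real.smoothTransition (1 - t / ρ ^ 2)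

lemma contDiff_profile (ρ : ℝ) {n : ℕ∞} : ContDiff ℝ n (profile ρ) := by
  unfold profile
  exact Real.smoothTransition.contDiff.comp (by fun_prop)

lemma profile_eq_zero {ρ : ℝ} (hρ : 0 < ρ) {t : ℝ} (ht : ρ ^ 2 ≤ t) : profile ρ t = 0 := by
  apply Real.smoothTransition.zero_of_nonpos
  rw [sub_nonpos, le_div_iff₀ (by positivity)]
  linarith

lemma profile_zero (ρ : ℝ) : profile ρ 0 = 1 := by
  simp [profile]

lemma contDiff_deriv_profile (ρ : ℝ) : ContDiff ℝ ((⊤ : ℕ∞) : WithTop ℕ∞) (deriv (profile ρ)) :=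
  (contDiff_infty_iff_deriv.1 (contDiff_profile ρ)).2

lemma deriv_profile_eq_zero {ρ : ℝ} (hρ : 0 < ρ) {t : ℝ} (ht : ρ ^ 2 < t) :
    deriv (profile ρ) t = 0 := by
  have : profile ρ =ᶠ[𝓝 t] fun _ => 0 := by
    filter_upwards [lt_mem_nhds ht] with s hs using profile_eq_zero hρ hs.le
  rw [this.deriv_eq]
  simp

/-- The radial cutoff. -/
def cutoff (ρ : ℝ) (z : ℂ) : ℂ := (profile ρ (‖z‖ ^ 2) : ℝ)

/-- The radial mollifier `η` for which `dbar ((2πz)⁻¹ cutoff) = δ - η`. -/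
def mollifier (ρ : ℝ) (z : ℂ) : ℂ := ((-(deriv (profile ρ) (‖z‖ ^ 2) / Real.pi) : ℝ) : ℂ)

/-- The truncated fundamental solution of `dbar`. -/
def parametrix (ρ : ℝ) (z : ℂ) : ℂ := cutoff ρ z * (2 * Real.pi * z)⁻¹

lemma contDiff_cutoff (ρ : ℝ) {n : ℕ∞} : ContDiff ℝ n (cutoff ρ) := by
  unfold cutoff
  exact Complex.ofRealCLM.contDiff.comp ((contDiff_profile ρ).comp (contDiff_norm_sq ℝ))

lemma contDiff_mollifier (ρ : ℝ) : ContDiff ℝ ((⊤ : ℕ∞) : WithTop ℕ∞) (mollifier ρ) := by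
  unfold mollifier
  exact Complex.ofRealCLM.contDiff.comp
    (((contDiff_deriv_profile ρ).comp (contDiff_norm_sq ℝ)).div_const _).neg

lemma support_cutoff {ρ : ℝ} (hρ : 0 < ρ) :
    Function.support (cutoff ρ) ⊆ Metric.closedBall 0 ρ := by
  intro z hz
  by_contra h
  apply hz
  simp at h
  simp [cutoff, profile_eq_zero hρ (t := ‖z‖ ^ 2) (by gcongr)]

lemma support_mollifier {ρ : ℝ} (hρ : 0 < ρ) :
    Function.support (mollifier ρ) ⊆ Metric.closedBall 0 ρ := by
  intro z hz
  by_contra h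
  apply hz
  simp at h
  simp [mollifier, deriv_profile_eq_zero hρ (t := ‖z‖ ^ 2) (by gcongr)]

lemma hasCompactSupport_cutoff {ρ : ℝ} (hρ : 0 < ρ) : HasCompactSupport (cutoff ρ) :=
  HasCompactSupport.of_support_subset_isCompact (isCompact_closedBall 0 ρ) (support_cutoff hρ)

lemma hasCompactSupport_mollifier {ρ : ℝ} (hρ : 0 < ρ) : HasCompactSupport (mollifier ρ) :=
  HasCompactSupport.of_support_subset_isCompact (isCompact_closedBall 0 ρ) (support_mollifier hρ)

lemma mollifier_neg (ρ : ℝ) (z : ℂ) : mollifier ρ (-z) = mollifier ρ z := by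
  simp [mollifier]

lemma dbar_cutoff (ρ : ℝ) (z : ℂ) : dbar (cutoff ρ) z = -(2 * Real.pi * z) * mollifier ρ z := by
  have := dbar_radial ((contDiff_profile ρ (n := 1)).differentiable (by norm_num)) z
  unfold cutoff
  rw [this, mollifier]
  have : (Real.pi : ℂ) ≠ 0 := by exact_mod_cast Real.pi_ne_zero
  push_cast
  field_simp

/-- In polar coordinates the area factor `r` compensates `|z|⁻¹ = r⁻¹`. -/
lemma locallyIntegrable_inv : LocallyIntegrable (fun z : ℂ => z⁻¹) := by
  have key : ∀ R : ℝ, IntegrableOn (fun z : ℂ => z⁻¹) (Metric.ball 0 R) := by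
    intro R
    have h1 : IntegrableOn (fun z : ℂ => (fun y : ℝ => y⁻¹) ‖z‖) (Metric.ball 0 R) := by
      rw [integrableOn_fun_norm_addHaar]
      have : IntegrableOn (fun _ : ℝ => (1 : ℝ)) (Set.Ioo 0 R) := by simp
      refine this.congr_fun (fun y hy => ?_) measurableSet_Ioo
      have : y ≠ 0 := hy.1.ne'
      simp [Complex.finrank_real_complex, this]
    refine h1.mono' (by fun_prop) (Eventually.of_forall fun z => by simp)
  rw [locallyIntegrable_iff]
  intro K hK
  obtain ⟨R, hR⟩ := hK.isBounded.subset_ball (0 : ℂ)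
  exact (key R).mono_set hR

lemma locallyIntegrable_parametrix (ρ : ℝ) : LocallyIntegrable (parametrix ρ) := by
  have h1 : LocallyIntegrable (fun z : ℂ => (cutoff ρ z * (2 * Real.pi : ℂ)⁻¹) • z⁻¹) :=
    locallyIntegrable_inv.continuous_smul
    ((contDiff_cutoff ρ (n := 0)).continuous.mul continuous_const)
  refine h1.congr (Eventually.of_forall fun z => ?_)
  simp only [parametrix, mul_inv, smul_eq_mul]
  ring

lemma integrable_inv_mul {g : ℂ → ℂ} (hg : Continuous g) (hc : HasCompactSupport g) :
    Integrable (fun z => z⁻¹ * g z) := by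
  have := locallyIntegrable_inv.integrable_smul_right_of_hasCompactSupport hg hc
  exact this

/-- `dbar` of the truncated fundamental solution is `δ - η`. -/
theorem convolution_parametrix_dbar {ρ : ℝ} (hρ : 0 < ρ) {ψ : ℂ → ℂ} (hψ : ContDiff ℝ 1 ψ)
    (hc : HasCompactSupport ψ) (x : ℂ) :
    convolution (parametrix ρ) (dbar ψ) (ContinuousLinearMap.mul ℝ ℂ) volume x =
      ψ x - convolution (mollifier ρ) ψ (ContinuousLinearMap.mul ℝ ℂ) volume x := by
  have hd := continuous_dbar hψ
  have hdc := hasCompactSupport_dbar hc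
  have hφ : ContDiff ℝ 1 (fun y => cutoff ρ y * ψ (x - y)) :=
    (contDiff_cutoff ρ (n := 1)).mul (hψ.comp (by fun_prop))
  have hφc : HasCompactSupport (fun y => cutoff ρ y * ψ (x - y)) :=
    (hasCompactSupport_cutoff hρ).mul_right
  have h := integral_inv_mul_dbar hφ hφc
    (integrable_inv_mul (continuous_dbar hφ) (hasCompactSupport_dbar hφc))
  have hη : Integrable (fun t => mollifier ρ t * ψ (x - t)) :=
    (hc.convolutionExists_right (ContinuousLinearMap.mul ℝ ℂ)
      (contDiff_mollifier ρ).continuous.locallyIntegrable hψ.continuous) x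
  have hN : Integrable (fun t => parametrix ρ t * dbar ψ (x - t)) :=
    (hdc.convolutionExists_right (ContinuousLinearMap.mul ℝ ℂ)
      (locallyIntegrable_parametrix ρ) hd) x
  have hpi : (Real.pi : ℂ) ≠ 0 := by exact_mod_cast Real.pi_ne_zero
  have e : ∫ y, y⁻¹ * dbar (fun y => cutoff ρ y * ψ (x - y)) y =
      ∫ y, (-(2 * Real.pi : ℂ)) * (mollifier ρ y * ψ (x - y) +
        parametrix ρ y * dbar ψ (x - y)) := by
    refine integral_congr_ae ?_
    have : ∀ᵐ y : ℂ, y ≠ 0 := by simp [ae_iff]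
    filter_upwards [this] with y hy
    rw [dbar_mul (ψ := fun y => ψ (x - y))
      ((contDiff_cutoff ρ (n := 1)).differentiable (by norm_num) y)
      (((hψ.differentiable (by norm_num)).comp (by fun_prop : Differentiable ℝ fun y => x - y)) y :
        DifferentiableAt ℝ (fun y => ψ (x - y)) y),
      dbar_comp_sub_left (hψ.differentiable (by norm_num)), dbar_cutoff, parametrix]
    field_simp
    ring
  rw [e, integral_const_mul, integral_add hη hN] at h
  simp only [convolution_def, ContinuousLinearMap.mul_apply']
  have h0 : cutoff ρ 0 = 1 := by simp [cutoff, profile_zero]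
  rw [h0] at h
  have h2 : (2 * Real.pi : ℂ) ≠ 0 := by simp [hpi]
  apply mul_left_cancel₀ h2
  simp only [sub_zero, one_mul] at h
  linear_combination -h

end Mollifier

/-! ### Weyl's lemma and decay of the regularization -/

section Weyl

open Complex
open scoped Pointwise

/-- `f` is holomorphic in `O` in the sense of distributions. -/
def WeaklyHolomorphic (O : Set ℂ) (f : ℂ → ℂ) : Prop :=
  ∀ φ : ℂ → ℂ, ContDiff ℝ ((⊤ : ℕ∞) : WithTop ℕ∞) φ → HasCompactSupport φ → tsupport φ ⊆ O →
    ∫ z, f z * dbar φ z = 0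

/-- The regularization `f ⋆ η`. -/
def regularize (ρ : ℝ) (f : ℂ → ℂ) : ℂ → ℂ :=
  convolution f (mollifier ρ) (ContinuousLinearMap.mul ℝ ℂ) volume

/-- Fubini, together with the evenness of the mollifier. -/
lemma integral_mul_convolution_mollifier {ρ : ℝ} (hρ : 0 < ρ) {f ψ : ℂ → ℂ}
    (hf : LocallyIntegrable f) (hψ : Continuous ψ) (hc : HasCompactSupport ψ) :
    ∫ x, f x * convolution (mollifier ρ) ψ (ContinuousLinearMap.mul ℝ ℂ) volume x =
      ∫ y, ψ y * regularize ρ f y := by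
  have hη := (contDiff_mollifier ρ).continuous
  -- The double integrand vanishes for `x` outside `K`, so `f` may be truncated to `K`, where it is
  -- integrable.
  set K : Set ℂ := Metric.closedBall 0 ρ + tsupport ψ with hK
  have hKc : IsCompact K := (isCompact_closedBall 0 ρ).add hc
  have hfK : Integrable (K.indicator f) :=
    (hf.integrableOn_isCompact hKc).integrable_indicator hKc.measurableSet
  have hψi : Integrable ψ := hψ.integrable_of_hasCompactSupport hc
  obtain ⟨C, hC⟩ := (hasCompactSupport_mollifier hρ).exists_bound_of_continuous hη
  have hprod : Integrable (fun p : ℂ × ℂ => mollifier ρ (p.1 - p.2) * (K.indicator f p.1 * ψ p.2))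
      (volume.prod volume) := by
    refine (hfK.mul_prod hψi).bdd_mul (c := C) ?_ (Eventually.of_forall fun p => hC _)
    exact (hη.comp (by fun_prop)).aestronglyMeasurable
  have key : ∀ x y : ℂ, f x * (mollifier ρ (x - y) * ψ y) =
      mollifier ρ (x - y) * (K.indicator f x * ψ y) := by
    intro x y
    by_cases h1 : mollifier ρ (x - y) = 0
    · simp [h1]
    by_cases h2 : ψ y = 0
    · simp [h2]
    have : x ∈ K := ⟨x - y, support_mollifier hρ h1, y, subset_tsupport _ h2, by simp⟩
    rw [Set.indicator_of_mem this]
    ring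
  have e1 : ∀ x, f x * convolution (mollifier ρ) ψ (ContinuousLinearMap.mul ℝ ℂ) volume x =
      ∫ y, mollifier ρ (x - y) * (K.indicator f x * ψ y) := by
    intro x
    rw [convolution_eq_swap, ← integral_const_mul]
    congr 1
    ext y
    rw [ContinuousLinearMap.mul_apply', key]
  simp_rw [e1]
  rw [integral_integral_swap hprod]
  congr 1
  ext y
  rw [regularize, convolution_def, ← integral_const_mul]
  congr 1
  ext x
  rw [← key, ContinuousLinearMap.mul_apply', ← mollifier_neg, neg_sub]
  ring

lemma continuous_regularize {ρ : ℝ} (hρ : 0 < ρ) {f : ℂ → ℂ} (hf : LocallyIntegrable f) :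
    Continuous (regularize ρ f) :=
  (hasCompactSupport_mollifier hρ).continuous_convolution_right _ hf
    (contDiff_mollifier ρ).continuous

lemma integrable_mul_convolution_mollifier {ρ : ℝ} (hρ : 0 < ρ) {f ψ : ℂ → ℂ}
    (hf : LocallyIntegrable f) (hψ : Continuous ψ) (hc : HasCompactSupport ψ) :
    Integrable fun x => f x *
      convolution (mollifier ρ) ψ (ContinuousLinearMap.mul ℝ ℂ) volume x := by
  have h1 : Continuous (convolution (mollifier ρ) ψ (ContinuousLinearMap.mul ℝ ℂ) volume) :=
    hc.continuous_convolution_right _ (contDiff_mollifier ρ).continuous.locallyIntegrable hψ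
  have h2 : HasCompactSupport (convolution (mollifier ρ) ψ (ContinuousLinearMap.mul ℝ ℂ) volume) :=
    (hasCompactSupport_mollifier hρ).convolution _ hc
  exact hf.integrable_smul_right_of_hasCompactSupport h1 h2

/-- The weak equation is tested with `Φ = parametrix ⋆ ψ`, for which `dbar Φ = ψ - mollifier ⋆ ψ`.
The parametrix lives in the ball of radius `ρ`, which keeps the support of `Φ` inside `O`. -/
lemma WeaklyHolomorphic.integral_eq_convolution {O : Set ℂ} {f ψ : ℂ → ℂ} {ρ : ℝ}
    (h : WeaklyHolomorphic O f) (hf : LocallyIntegrable f) (hρ : 0 < ρ)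
    (hψ : ContDiff ℝ ((⊤ : ℕ∞) : WithTop ℕ∞) ψ) (hψc : HasCompactSupport ψ)
    (hO : ∀ x ∈ tsupport ψ, Metric.closedBall x ρ ⊆ O) :
    ∫ x, f x * ψ x =
      ∫ x, f x * convolution (mollifier ρ) ψ (ContinuousLinearMap.mul ℝ ℂ) volume x := by
  have hψ1 : ContDiff ℝ 1 ψ := hψ.of_le (by exact_mod_cast le_top)
  obtain ⟨Φ, hΦ⟩ : ∃ Φ, Φ = convolution (parametrix ρ) ψ (ContinuousLinearMap.mul ℝ ℂ) volume :=
    ⟨_, rfl⟩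
  have hΦs : ContDiff ℝ ((⊤ : ℕ∞) : WithTop ℕ∞) Φ := by
    rw [hΦ]
    exact hψc.contDiff_convolution_right _ (locallyIntegrable_parametrix ρ) hψ
  have hKc : IsCompact (Metric.closedBall 0 ρ + tsupport ψ) := (isCompact_closedBall 0 ρ).add hψc
  have hsup : Function.support Φ ⊆ Metric.closedBall 0 ρ + tsupport ψ := by
    rw [hΦ]
    refine (support_convolution_subset _).trans (Set.add_subset_add ?_ (subset_tsupport _))
    intro z hz
    apply support_cutoff hρ
    intro h
    apply hz
    simp [parametrix, h]
  have hΦc : HasCompactSupport Φ := HasCompactSupport.of_support_subset_isCompact hKc hsup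
  have hΦO : tsupport Φ ⊆ O := by
    refine (closure_minimal hsup hKc.isClosed).trans ?_
    rintro _ ⟨a, ha, b, hb, rfl⟩
    apply hO b hb
    simpa using ha
  have h0 := h Φ hΦs hΦc hΦO
  have e : ∀ x, dbar Φ x =
      ψ x - convolution (mollifier ρ) ψ (ContinuousLinearMap.mul ℝ ℂ) volume x := by
    intro x
    rw [hΦ, dbar_convolution (locallyIntegrable_parametrix ρ) hψ1 hψc,
      convolution_parametrix_dbar hρ hψ1 hψc]
  have i1 : Integrable fun x => f x * ψ x :=
    hf.integrable_smul_right_of_hasCompactSupport hψ.continuous hψc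
  simp_rw [e, mul_sub] at h0
  rw [integral_sub i1 (integrable_mul_convolution_mollifier hρ hf hψ.continuous hψc)] at h0
  exact sub_eq_zero.1 h0

/-- Weyl's lemma: a weakly holomorphic function coincides with its regularization. -/
theorem WeaklyHolomorphic.ae_eq_regularize {O U : Set ℂ} {f : ℂ → ℂ} {ρ : ℝ}
    (h : WeaklyHolomorphic O f) (hf : LocallyIntegrable f) (hρ : 0 < ρ) (hU : IsOpen U)
    (hUO : ∀ x ∈ U, Metric.closedBall x ρ ⊆ O) :
    ∀ᵐ x, x ∈ U → f x = regularize ρ f x := by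
  have hr := continuous_regularize hρ hf
  have := hU.ae_eq_zero_of_integral_contDiff_smul_eq_zero (f := fun x => f x - regularize ρ f x)
    (μ := volume) ((hf.sub hr.locallyIntegrable).locallyIntegrableOn U) ?_
  · filter_upwards [this] with x hx hxU using sub_eq_zero.1 (hx hxU)
  intro g hg hgc hgU
  have hψ : ContDiff ℝ ((⊤ : ℕ∞) : WithTop ℕ∞) (fun x => (g x : ℂ)) :=
    Complex.ofRealCLM.contDiff.comp hg
  have hψc : HasCompactSupport (fun x => (g x : ℂ)) :=
    hgc.comp_left (g := fun x : ℝ => (x : ℂ)) rfl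
  have hψs : tsupport (fun x => (g x : ℂ)) ⊆ tsupport g :=
    closure_mono (Function.support_comp_subset (g := fun x : ℝ => (x : ℂ)) rfl g)
  have h0 := h.integral_eq_convolution hf hρ hψ hψc fun x hx => hUO x (hgU (hψs hx))
  have i1 : Integrable fun x => f x * (g x : ℂ) :=
    hf.integrable_smul_right_of_hasCompactSupport hψ.continuous hψc
  have i3 : Integrable fun x => (g x : ℂ) * regularize ρ f x :=
    (hψ.continuous.mul hr).integrable_of_hasCompactSupport hψc.mul_right
  rw [integral_mul_convolution_mollifier hρ hf hψ.continuous hψc, ← sub_eq_zero,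
    ← integral_sub i1 i3] at h0
  rw [← h0]
  congr 1
  ext x
  rw [real_smul]
  ring

/-- `dbar` of the regularization at `x` is, up to sign, `f` paired with `dbar` of the admissible
test function `y ↦ mollifier (x - y)`, hence zero; these are the Cauchy–Riemann equations. -/
theorem WeaklyHolomorphic.differentiableAt_regularize {O : Set ℂ} {f : ℂ → ℂ} {ρ : ℝ}
    (h : WeaklyHolomorphic O f) (hf : LocallyIntegrable f) (hρ : 0 < ρ) {x : ℂ}
    (hx : Metric.closedBall x ρ ⊆ O) : DifferentiableAt ℂ (regularize ρ f) x := by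
  have hη := contDiff_mollifier ρ
  have hη1 : ContDiff ℝ 1 (mollifier ρ) := hη.of_le (by exact_mod_cast le_top)
  have hηc := hasCompactSupport_mollifier hρ
  have hd : DifferentiableAt ℝ (regularize ρ f) x :=
    (hηc.hasFDerivAt_convolution_right (ContinuousLinearMap.mul ℝ ℂ) hf hη1 x).differentiableAt
  have h0 : dbar (regularize ρ f) x = 0 := by
    rw [regularize, dbar_convolution hf hη1 hηc, convolution_def]
    have hs : Function.support (fun y => mollifier ρ (x - y)) ⊆ Metric.closedBall x ρ := by
      intro y hy
      have := support_mollifier hρ hy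
      simpa [dist_eq_norm, norm_sub_rev] using this
    have := h (fun y => mollifier ρ (x - y)) (hη.comp (by fun_prop))
      (HasCompactSupport.of_support_subset_isCompact (isCompact_closedBall x ρ) hs)
      ((closure_minimal hs Metric.isClosed_closedBall).trans hx)
    simp_rw [dbar_comp_sub_left (hη1.differentiable (by norm_num)), mul_neg] at this
    rw [integral_neg, neg_eq_zero] at this
    simpa using this
  rw [differentiableAt_complex_iff_differentiableAt_real]
  refine ⟨hd, ?_⟩
  rw [dbar] at h0
  rw [smul_eq_mul]
  linear_combination (-I) * h0 + fderiv ℝ (regularize ρ f) x I * I_sq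

lemma tendsto_setIntegral_norm_gt {g : ℂ → ℝ} (hg : Integrable g) :
    Tendsto (fun R : ℝ => ∫ z in {z | R < ‖z‖}, g z) atTop (𝓝 0) := by
  have := tendsto_setIntegral_of_antitone (μ := volume) (f := g)
    (s := fun R : ℝ => {z : ℂ | R < ‖z‖})
    (fun R => measurableSet_lt measurable_const measurable_norm)
    (fun R R' h z hz => lt_of_le_of_lt h hz) ⟨0, hg.integrableOn⟩
  have he : (⋂ R : ℝ, {z : ℂ | R < ‖z‖}) = ∅ := by
    ext z
    simp only [Set.mem_iInter, Set.mem_ofPred_eq, Set.mem_empty_iff_false, iff_false, not_forall,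
      not_lt]
    exact ⟨‖z‖, le_rfl⟩
  rw [he] at this
  simpa using this

/-- Young's inequality `|f| ≤ δ + δ⁻¹|f|²`, integrated. The free parameter `δ` does the work of
Cauchy–Schwarz in the limits below. -/
lemma setIntegral_norm_le {f : ℂ → ℂ} (hf : MemLp f 2) {s : Set ℂ}
    (hs : volume s ≠ ⊤) {δ : ℝ} (hδ : 0 < δ) :
    ∫ z in s, ‖f z‖ ≤ δ * volume.real s + δ⁻¹ * ∫ z in s, ‖f z‖ ^ 2 := by
  have h2 : Integrable (fun z => ‖f z‖ ^ 2) := hf.integrable_norm_pow (by norm_num)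
  have h1 : IntegrableOn (fun z => δ + δ⁻¹ * ‖f z‖ ^ 2) s :=
    (integrableOn_const hs).add (h2.integrableOn.const_mul _)
  have e : ∫ z in s, (δ + δ⁻¹ * ‖f z‖ ^ 2) = δ * volume.real s + δ⁻¹ * ∫ z in s, ‖f z‖ ^ 2 := by
    rw [integral_add (f := fun _ => δ) (integrableOn_const hs) (h2.integrableOn.const_mul _),
      integral_const_mul]
    simp [mul_comm]
  rw [← e]
  refine integral_mono_of_nonneg (Eventually.of_forall fun z => norm_nonneg _) h1
    (Eventually.of_forall fun z => ?_)
  dsimp only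
  have : ‖f z‖ * δ ≤ δ ^ 2 + ‖f z‖ ^ 2 := by nlinarith [sq_nonneg (‖f z‖ - δ), sq_nonneg (‖f z‖)]
  have e2 : δ + δ⁻¹ * ‖f z‖ ^ 2 = (δ ^ 2 + ‖f z‖ ^ 2) / δ := by field_simp
  rw [e2, le_div_iff₀ hδ]
  exact this

/-- The value at `x` only sees `f` on the ball of radius `ρ` around `x`, and the L² mass of that
ball is dominated by the tail of a convergent integral. -/
lemma tendsto_regularize_cobounded {ρ : ℝ} (hρ : 0 < ρ) {f : ℂ → ℂ} (hf : MemLp f 2) :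
    Tendsto (regularize ρ f) (Bornology.cobounded ℂ) (𝓝 0) := by
  have hη := (contDiff_mollifier ρ).continuous
  obtain ⟨C, hC⟩ := (hasCompactSupport_mollifier hρ).exists_bound_of_continuous hη
  have hC0 : 0 ≤ C := (norm_nonneg _).trans (hC 0)
  have hloc : LocallyIntegrable f := hf.locallyIntegrable (by norm_num)
  have h2 : Integrable (fun z => ‖f z‖ ^ 2) := hf.integrable_norm_pow (by norm_num)
  set V := volume.real (Metric.closedBall (0 : ℂ) ρ) with hV
  have bound : ∀ x, ‖regularize ρ f x‖ ≤ C * ∫ z in Metric.closedBall x ρ, ‖f z‖ := by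
    intro x
    rw [regularize, convolution_def, ← integral_const_mul,
      ← integral_indicator Metric.isClosed_closedBall.measurableSet]
    have hi : IntegrableOn (fun y => C * ‖f y‖) (Metric.closedBall x ρ) :=
      (hloc.integrableOn_isCompact (isCompact_closedBall x ρ)).norm.const_mul C
    refine norm_integral_le_of_norm_le (hi.integrable_indicator
        Metric.isClosed_closedBall.measurableSet) (Eventually.of_forall fun y => ?_)
    by_cases hy : y ∈ Metric.closedBall x ρ
    · rw [Set.indicator_of_mem hy, ContinuousLinearMap.mul_apply', norm_mul, mul_comm]
      gcongr
      exact hC _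
    · rw [Set.indicator_of_notMem hy, ContinuousLinearMap.mul_apply']
      have : mollifier ρ (x - y) = 0 := by
        by_contra h
        apply hy
        have := support_mollifier hρ h
        simpa [dist_eq_norm, norm_sub_rev] using this
      simp [this]
  have htail : Tendsto (fun x : ℂ => ∫ z in {z | ‖x‖ - ρ - 1 < ‖z‖}, ‖f z‖ ^ 2)
      (Bornology.cobounded ℂ) (𝓝 0) := by
    refine (tendsto_setIntegral_norm_gt h2).comp ?_
    have := tendsto_norm_cobounded_atTop (E := ℂ)
    exact tendsto_atTop_add_const_right _ _ (tendsto_atTop_add_const_right _ _ this)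
  rw [Metric.tendsto_nhds]
  intro κ hκ
  -- Chosen so that the volume term `C δ V` is at most `κ/2`; the `+ 1` keeps the denominator
  -- positive.
  set δ := κ / (2 * (C * V + 1)) with hδ
  have hV0 : 0 ≤ V := measureReal_nonneg
  have hδ0 : 0 < δ := by positivity
  have hlim : Tendsto (fun x : ℂ => C * (δ⁻¹ * ∫ z in {z | ‖x‖ - ρ - 1 < ‖z‖}, ‖f z‖ ^ 2))
      (Bornology.cobounded ℂ) (𝓝 0) := by
    simpa using (htail.const_mul δ⁻¹).const_mul C
  filter_upwards [hlim.eventually_lt_const (half_pos hκ)] with x hx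
  rw [dist_zero_right]
  have hle := setIntegral_norm_le hf (s := Metric.closedBall x ρ)
    measure_closedBall_lt_top.ne hδ0
  have hVx : volume.real (Metric.closedBall x ρ) = V := by
    rw [hV, measureReal_def, measureReal_def, Measure.addHaar_closedBall_center]
  have hsub : ∫ z in Metric.closedBall x ρ, ‖f z‖ ^ 2 ≤
      ∫ z in {z | ‖x‖ - ρ - 1 < ‖z‖}, ‖f z‖ ^ 2 := by
    refine setIntegral_mono_set h2.integrableOn (Eventually.of_forall fun z => by positivity)
      (Eventually.of_forall fun z hz => ?_)
    have hz : dist z x ≤ ρ := hz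
    have : ‖x‖ - ρ - 1 < ‖z‖ := by
      have := norm_sub_norm_le x z
      rw [dist_eq_norm, norm_sub_rev] at hz
      linarith
    exact this
  have h3 : C * (δ * V) ≤ κ / 2 := by
    rw [hδ]
    rw [show C * (κ / (2 * (C * V + 1)) * V) = κ / 2 * ((C * V) / (C * V + 1)) by field_simp]
    have : (C * V) / (C * V + 1) ≤ 1 := by
      rw [div_le_one (by positivity)]; linarith
    nlinarith
  calc ‖regularize ρ f x‖ ≤ C * ∫ z in Metric.closedBall x ρ, ‖f z‖ := bound x
    _ ≤ C * (δ * V + δ⁻¹ * ∫ z in {z | ‖x‖ - ρ - 1 < ‖z‖}, ‖f z‖ ^ 2) := by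
      rw [hVx] at hle
      gcongr
      exact hle.trans (by gcongr)
    _ < κ := by rw [mul_add]; linarith

end Weyl

/-! ### Laurent moments on circles -/

section Moments

open Complex

/-- The `j`-th Laurent moment of `F` on the circle of radius `r`. -/
def moment (F : ℂ → ℂ) (j : ℤ) (r : ℝ) : ℂ :=
  ∫ θ in (0 : ℝ)..(2 * Real.pi), F (circleMap 0 r θ) * circleMap 0 r θ ^ j

lemma integral_polar_two_pi {E : Type*} [NormedAddCommGroup E] [NormedSpace ℝ E] {h : ℂ → E}
    (hh : Integrable h) :
    ∫ z, h z = ∫ r in Set.Ioi (0 : ℝ), r • ∫ θ in (0 : ℝ)..(2 * Real.pi), h (circleMap 0 r θ) := by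
  rw [integral_polar hh]
  congr 1
  ext r
  congr 1
  have hp : Function.Periodic (fun θ : ℝ => h (circleMap 0 r θ)) (2 * Real.pi) :=
    fun θ => by simp only [periodic_circleMap 0 r θ]
  have := hp.intervalIntegral_add_eq (-Real.pi) 0
  rw [zero_add] at this
  rw [← this]
  congr 1
  ring

/-- Cauchy's theorem on the annulus: the moment is, up to the factor `i`, the contour integral of
`F(z) z^j / z`. If `F = Σ aₙ zⁿ`, it equals `2π a₋ⱼ`. -/
lemma moment_eq_of_differentiableAt {F : ℂ → ℂ} {a : ℝ} (ha : 0 ≤ a)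
    (hF : ∀ z : ℂ, a < ‖z‖ → DifferentiableAt ℂ F z) (j : ℤ) {r R : ℝ} (hr : a < r) (hR : a < R) :
    moment F j r = moment F j R := by
  wlog hle : r ≤ R generalizing r R
  · exact (this hR hr (not_le.1 hle).le).symm
  have hr0 : 0 < r := ha.trans_lt hr
  have hd : ∀ z : ℂ, a < ‖z‖ → DifferentiableAt ℂ (fun z => F z * z ^ j) z := by
    intro z hz
    have hz0 : z ≠ 0 := norm_pos_iff.1 (ha.trans_lt hz)
    exact (hF z hz).mul (differentiableAt_zpow.2 (Or.inl hz0))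
  have h := Complex.circleIntegral_sub_center_inv_smul_eq_of_differentiable_on_annulus_off_countable
    hr0 hle Set.countable_empty (c := 0) (f := fun z => F z * z ^ j)
    (fun z hz => (hd z (by simp at hz; linarith [hz.2])).continuousAt.continuousWithinAt)
    (fun z hz => hd z (by simp at hz; linarith [hz.2]))
  have e : ∀ s : ℝ, 0 < s → (∮ z in C(0, s), (z - 0)⁻¹ • (F z * z ^ j)) = I * moment F j s := by
    intro s hs
    rw [circleIntegral, moment, ← intervalIntegral.integral_const_mul]
    congr 1
    ext θ
    have : circleMap 0 s θ ≠ 0 := circleMap_ne_center hs.ne'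
    simp only [deriv_circleMap, sub_zero, smul_eq_mul]
    field_simp
  rw [e r hr0, e R (hr0.trans_le hle)] at h
  exact (mul_left_cancel₀ I_ne_zero h).symm

lemma measurableSet_norm_gt (a : ℝ) : MeasurableSet {z : ℂ | a < ‖z‖} :=
  measurableSet_lt measurable_const measurable_norm

lemma setIntegral_mul_radial {F : ℂ → ℂ} {a : ℝ} (ha : 0 ≤ a) {j : ℤ} {c : ℂ} {g : ℝ → ℂ}
    (hF : ∀ r, a < r → moment F j r = c)
    (hint : IntegrableOn (fun z => F z * z ^ j * g ‖z‖) {z : ℂ | a < ‖z‖}) :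
    ∫ z in {z : ℂ | a < ‖z‖}, F z * z ^ j * g ‖z‖ = c * ∫ r in Set.Ioi a, r * g r := by
  have hm := measurableSet_norm_gt a
  rw [← integral_indicator hm, integral_polar_two_pi (hint.integrable_indicator hm),
    ← integral_const_mul]
  have : ∀ r ∈ Set.Ioi (0 : ℝ), (r • ∫ θ in (0 : ℝ)..(2 * Real.pi),
      {z : ℂ | a < ‖z‖}.indicator (fun z => F z * z ^ j * g ‖z‖) (circleMap 0 r θ)) =
      (Set.Ioi a).indicator (fun r : ℝ => c * (r * g r)) r := by
    intro r hr
    have hr : 0 < r := hr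
    by_cases h : a < r
    · rw [Set.indicator_of_mem (show r ∈ Set.Ioi a from h)]
      have e : ∀ θ : ℝ, {z : ℂ | a < ‖z‖}.indicator (fun z => F z * z ^ j * g ‖z‖)
          (circleMap 0 r θ) = F (circleMap 0 r θ) * circleMap 0 r θ ^ j * g r := by
        intro θ
        rw [Set.indicator_of_mem (by simpa [abs_of_pos hr] using h)]
        simp [abs_of_pos hr]
      simp_rw [e]
      rw [intervalIntegral.integral_mul_const, ← moment, hF r h, real_smul]
      ring
    · rw [Set.indicator_of_notMem (show r ∉ Set.Ioi a from h)]
      have e : ∀ θ : ℝ, {z : ℂ | a < ‖z‖}.indicator (fun z => F z * z ^ j * g ‖z‖)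
          (circleMap 0 r θ) = 0 := by
        intro θ
        rw [Set.indicator_of_notMem (by simpa [abs_of_pos hr] using h)]
      simp [e]
  rw [setIntegral_congr_fun measurableSet_Ioi this, setIntegral_indicator measurableSet_Ioi,
    Set.inter_eq_right.2 (Set.Ioi_subset_Ioi ha)]

/-- On a fixed circle the moments are, up to nonzero factors, the Fourier coefficients of `F`; a
continuous function whose Fourier coefficients all vanish is zero. -/
lemma eq_zero_of_forall_moment_eq_zero {F : ℂ → ℂ} (hF : Continuous F) {r : ℝ} (hr : 0 < r)
    (h : ∀ j, moment F j r = 0) (θ : ℝ) : F (circleMap 0 r θ) = 0 := by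
  have : Fact (0 < 2 * Real.pi) := ⟨by positivity⟩
  let g : C(AddCircle (2 * Real.pi), ℂ) :=
    ⟨fun x => F (r * (AddCircle.toCircle x : ℂ)), by
      have := AddCircle.continuous_toCircle (T := 2 * Real.pi)
      fun_prop⟩
  have hg : ∀ x : ℝ, g (x : AddCircle (2 * Real.pi)) = F (circleMap 0 r x) := by
    intro x
    change F _ = F _
    rw [AddCircle.toCircle_apply_mk, circleMap_zero]
    simp
  have hrc : (r : ℂ) ≠ 0 := by exact_mod_cast hr.ne'
  have hc : ∀ n, fourierCoeff g n = 0 := by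
    intro n
    rw [fourierCoeff_eq_intervalIntegral _ n 0, zero_add]
    have e : ∀ x : ℝ, fourier (-n) (x : AddCircle (2 * Real.pi)) • g (x : AddCircle (2 * Real.pi)) =
        (r : ℂ) ^ n * (F (circleMap 0 r x) * circleMap 0 r x ^ (-n)) := by
      intro x
      rw [hg, fourier_coe_apply, circleMap_zero, mul_zpow, ← Complex.exp_int_mul, smul_eq_mul]
      have : 2 * Real.pi * I * ((-n : ℤ) : ℂ) * x / ((2 * Real.pi : ℝ) : ℂ) =
          ((-n : ℤ) : ℂ) * (x * I) := by
        have : (Real.pi : ℂ) ≠ 0 := by exact_mod_cast Real.pi_ne_zero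
        push_cast
        field_simp
      rw [this, zpow_neg]
      field_simp
    simp_rw [e]
    rw [intervalIntegral.integral_const_mul, ← moment, h]
    simp
  have hs : Summable (fourierCoeff g) := by
    have : fourierCoeff g = fun _ => 0 := funext hc
    rw [this]
    exact summable_zero
  have := has_pointwise_sum_fourier_series_of_summable hs (θ : AddCircle (2 * Real.pi))
  simp_rw [hc, zero_smul] at this
  rw [← hg θ]
  exact this.unique hasSum_zero

/-- The moments of order at most one of a square integrable function vanish. -/
lemma moment_eq_zero_of_memLp {f F : ℂ → ℂ} {a : ℝ} (hf : MemLp f 2)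
    (hfF : ∀ᵐ z, a < ‖z‖ → f z = F z) {j : ℤ} (hj : j ≤ 1) {c : ℂ}
    (hF : ∀ r, a < r → moment F j r = c) : c = 0 := by
  have h2 : Integrable (fun z => ‖f z‖ ^ 2) := hf.integrable_norm_pow (by norm_num)
  have hloc : LocallyIntegrable f := hf.locallyIntegrable (by norm_num)
  -- Integrate `f z^j` over the annulus `R < |z| ≤ 2R`. The result is `c ∫ r dr = (3/2)R² c`, while
  -- `|z^j| ≤ 2R` since `j ≤ 1` and `R > 1`; the factor `4/3` is `2 / (3/2)`.
  have key : ∀ R : ℝ, max a 1 < R → ∀ δ > 0, ‖c‖ ≤ 4 / 3 * (4 * Real.pi * δ +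
      δ⁻¹ * ∫ z in {z : ℂ | R < ‖z‖}, ‖f z‖ ^ 2) := by
    intro R hR δ hδ
    have hRa : a < R := (le_max_left a 1).trans_lt hR
    have hR1 : 1 < R := (le_max_right a 1).trans_lt hR
    have hR0 : 0 < R := by linarith
    set g : ℝ → ℂ := (Set.Iic (2 * R)).indicator fun _ => 1 with hg
    set S : Set ℂ := {z | R < ‖z‖ ∧ ‖z‖ ≤ 2 * R} with hS
    have hSsub : S ⊆ Metric.closedBall 0 (2 * R) := fun z hz => by simpa using hz.2
    have hSm : MeasurableSet S := (measurableSet_norm_gt R).inter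
      (measurableSet_le measurable_norm measurable_const)
    have hSfin : volume S ≠ ⊤ :=
      ((measure_mono hSsub).trans_lt measure_closedBall_lt_top).ne
    have hfS : IntegrableOn f S := (hloc.integrableOn_isCompact
      (isCompact_closedBall 0 (2 * R))).mono_set hSsub
    have hbound : ∀ z ∈ S, ‖z ^ j‖ ≤ 2 * R := by
      intro z hz
      rw [norm_zpow]
      have : ‖z‖ ^ j ≤ ‖z‖ ^ (1 : ℤ) := zpow_le_zpow_right₀ (by linarith [hz.1]) hj
      rw [zpow_one] at this
      exact this.trans hz.2
    have hind : ∀ z, {z : ℂ | R < ‖z‖}.indicator (fun z => f z * z ^ j * g ‖z‖) z =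
        S.indicator (fun z => f z * z ^ j) z := by
      intro z
      by_cases h1 : R < ‖z‖ <;> by_cases h2 : ‖z‖ ≤ 2 * R <;>
        simp [hg, hS, Set.indicator, h1, h2]
    have hzm : AEStronglyMeasurable (fun z : ℂ => z ^ j) (volume.restrict S) :=
      (by fun_prop : Measurable fun z : ℂ => z ^ j).aestronglyMeasurable
    have hfz : IntegrableOn (fun z => f z * z ^ j) S :=
      hfS.mul_bdd (c := 2 * R) hzm (ae_restrict_of_forall_mem hSm hbound)
    have hintf : IntegrableOn (fun z => f z * z ^ j * g ‖z‖) {z : ℂ | R < ‖z‖} := by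
      rw [← integrable_indicator_iff (measurableSet_norm_gt R), funext hind,
        integrable_indicator_iff hSm]
      exact hfz
    have hae : (fun z => f z * z ^ j * g ‖z‖) =ᵐ[volume.restrict {z : ℂ | R < ‖z‖}]
        fun z => F z * z ^ j * g ‖z‖ := by
      rw [EventuallyEq, ae_restrict_iff' (measurableSet_norm_gt R)]
      filter_upwards [hfF] with z hz hzR
      rw [hz (hRa.trans hzR)]
    have h1 := setIntegral_mul_radial hR0.le (fun r hr => hF r (hRa.trans hr))
      (hintf.congr hae)
    rw [← integral_congr_ae hae, ← integral_indicator (measurableSet_norm_gt R), funext hind,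
      integral_indicator hSm] at h1
    have h3 : ∫ r in Set.Ioi R, (r : ℂ) * g r = ((3 / 2 * R ^ 2 : ℝ) : ℂ) := by
      have e : ∀ r : ℝ, (r : ℂ) * g r = (Set.Iic (2 * R)).indicator (fun r : ℝ => (r : ℂ)) r := by
        intro r
        by_cases h : r ≤ 2 * R <;> simp [hg, Set.indicator, h]
      simp_rw [e]
      rw [setIntegral_indicator measurableSet_Iic, Set.Ioi_inter_Iic,
        ← intervalIntegral.integral_of_le (by linarith), intervalIntegral.integral_ofReal,
        integral_id]
      congr 1
      ring
    rw [h3] at h1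
    have h4 : ‖c‖ * (3 / 2 * R ^ 2) ≤ 2 * R * ∫ z in S, ‖f z‖ := by
      calc ‖c‖ * (3 / 2 * R ^ 2) = ‖c * ((3 / 2 * R ^ 2 : ℝ) : ℂ)‖ := by
            rw [norm_mul, Complex.norm_of_nonneg (by positivity)]
        _ = ‖∫ z in S, f z * z ^ j‖ := by rw [h1]
        _ ≤ ∫ z in S, 2 * R * ‖f z‖ := by
            refine norm_integral_le_of_norm_le (hfS.norm.const_mul _)
              (ae_restrict_of_forall_mem hSm fun z hz => ?_)
            rw [norm_mul, mul_comm]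
            gcongr
            exact hbound z hz
        _ = _ := by rw [integral_const_mul]
    -- The annulus has area of order `R²`; scaling Young's parameter by `1/R` makes both terms of
    -- order `R`.
    have h5 := setIntegral_norm_le hf hSfin (δ := δ / R) (by positivity)
    have h6 : volume.real S ≤ 4 * Real.pi * R ^ 2 := by
      calc volume.real S ≤ volume.real (Metric.closedBall (0 : ℂ) (2 * R)) :=
            measureReal_mono hSsub measure_closedBall_lt_top.ne
        _ = _ := by
          rw [measureReal_def, Complex.volume_closedBall]
          simp only [ENNReal.toReal_mul, ENNReal.toReal_pow, ENNReal.coe_toReal, NNReal.coe_real_pi]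
          rw [ENNReal.toReal_ofReal (by linarith)]
          ring
    have h7 : ∫ z in S, ‖f z‖ ^ 2 ≤ ∫ z in {z : ℂ | R < ‖z‖}, ‖f z‖ ^ 2 :=
      setIntegral_mono_set h2.integrableOn (Eventually.of_forall fun z => by positivity)
        (Eventually.of_forall fun z hz => hz.1)
    set T := ∫ z in {z : ℂ | R < ‖z‖}, ‖f z‖ ^ 2
    have h8 : ∫ z in S, ‖f z‖ ≤ R * (4 * Real.pi * δ + δ⁻¹ * T) := by
      calc ∫ z in S, ‖f z‖ ≤ δ / R * (4 * Real.pi * R ^ 2) + (δ / R)⁻¹ * T := by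
            refine h5.trans ?_
            gcongr
        _ = _ := by field_simp
    have h9 : ‖c‖ * (3 / 2 * R ^ 2) ≤ 2 * R * (R * (4 * Real.pi * δ + δ⁻¹ * T)) :=
      h4.trans (by gcongr)
    have hR2 : 0 < R ^ 2 := by positivity
    nlinarith
  -- First `R → ∞` removes the L² tail, and then `δ → 0`.
  have key2 : ∀ δ > 0, ‖c‖ ≤ 4 / 3 * (4 * Real.pi * δ) := by
    intro δ hδ
    have hlim : Tendsto (fun R : ℝ => 4 / 3 * (4 * Real.pi * δ +
        δ⁻¹ * ∫ z in {z : ℂ | R < ‖z‖}, ‖f z‖ ^ 2)) atTop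
      (𝓝 (4 / 3 * (4 * Real.pi * δ + δ⁻¹ * 0))) :=
      (((tendsto_setIntegral_norm_gt h2).const_mul _).const_add _).const_mul _
    rw [mul_zero, add_zero] at hlim
    refine ge_of_tendsto hlim ?_
    filter_upwards [eventually_gt_atTop (max a 1)] with R hR using key R hR δ hδ
  have h0 : ‖c‖ ≤ 0 := by
    refine le_of_forall_pos_le_add fun κ hκ => ?_
    have := key2 (κ / (16 * Real.pi)) (by positivity)
    have e : 4 / 3 * (4 * Real.pi * (κ / (16 * Real.pi))) = κ / 3 := by
      field_simp; ring
    linarith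
  exact norm_le_zero_iff.1 h0

end Moments

/-! ### Uniqueness for weakly holomorphic L² functions with zero normal trace -/

section Uniqueness

open Complex

open scoped ComplexConjugate

/-- The test function `Re (c z^m) s(|z|²)`. -/
def radialHarmonic (c : ℂ) (m : ℕ) (s : ℝ → ℝ) (z : ℂ) : ℝ := (c * z ^ m).re * s (‖z‖ ^ 2)

lemma dbar_of_differentiableAt {F : ℂ → ℂ} {z : ℂ} (h : DifferentiableAt ℂ F z) : dbar F z = 0 := by
  have := (differentiableAt_complex_iff_differentiableAt_real.1 h).2
  rw [dbar, this, smul_eq_mul]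
  linear_combination (fderiv ℝ F z 1) * I_sq

lemma dbar_conj {F : ℂ → ℂ} {z : ℂ} (h : DifferentiableAt ℂ F z) :
    dbar (fun z => conj (F z)) z = 2 * conj (deriv F z) := by
  have h1 : HasFDerivAt (fun z => conj (F z)) _ z :=
    (Complex.conjCLE.toContinuousLinearMap.hasFDerivAt).comp z (h.hasFDerivAt.restrictScalars ℝ)
  rw [dbar, h1.fderiv]
  simp
  linear_combination (-conj (deriv F z)) * I_sq

lemma dbar_radialHarmonic (c : ℂ) (m : ℕ) {s : ℝ → ℝ} (hs : Differentiable ℝ s) (z : ℂ) :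
    dbar (fun z => ((radialHarmonic c m s z : ℝ) : ℂ)) z =
      conj (c * (m * z ^ (m - 1))) * s (‖z‖ ^ 2) +
        (c * z ^ m + conj (c * z ^ m)) * (z * (deriv s (‖z‖ ^ 2) : ℝ)) := by
  have e : (fun z => ((radialHarmonic c m s z : ℝ) : ℂ)) =
      fun z => ((1 / 2 : ℂ) * (c * z ^ m + conj (c * z ^ m))) * ((s (‖z‖ ^ 2) : ℝ) : ℂ) := by
    ext z
    rw [radialHarmonic, ofReal_mul, re_eq_add_conj]
    ring
  have hF : DifferentiableAt ℂ (fun z : ℂ => c * z ^ m) z := by fun_prop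
  have hFr : DifferentiableAt ℝ (fun z : ℂ => c * z ^ m) z := hF.restrictScalars ℝ
  have hFc : DifferentiableAt ℝ (fun z : ℂ => conj (c * z ^ m)) z :=
    Complex.conjCLE.toContinuousLinearMap.differentiableAt.comp z hFr
  have hS : DifferentiableAt ℝ (fun z : ℂ => ((s (‖z‖ ^ 2) : ℝ) : ℂ)) z :=
    Complex.ofRealCLM.differentiableAt.comp z ((hs _).comp z
      ((contDiff_norm_sq ℝ (n := 1)).differentiable (by norm_num) z))
  have hd : deriv (fun z : ℂ => c * z ^ m) z = c * (m * z ^ (m - 1)) := by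
    rw [deriv_const_mul _ (by fun_prop)]
    simp
  rw [e, dbar_mul (φ := fun z => (1 / 2 : ℂ) * (c * z ^ m + conj (c * z ^ m)))
      ((hFr.add hFc).const_mul _) hS, dbar_radial hs,
    dbar_const_mul (φ := fun z => c * z ^ m + conj (c * z ^ m)) (hFr.add hFc),
    dbar_add hFr hFc, dbar_of_differentiableAt hF, dbar_conj hF, hd]
  ring

lemma contDiff_radialHarmonic (c : ℂ) (m : ℕ) {s : ℝ → ℝ}
    (hs : ContDiff ℝ ((⊤ : ℕ∞) : WithTop ℕ∞) s) :
    ContDiff ℝ ((⊤ : ℕ∞) : WithTop ℕ∞) (radialHarmonic c m s) := by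
  unfold radialHarmonic
  have : ContDiff ℝ ((⊤ : ℕ∞) : WithTop ℕ∞) fun z : ℂ => c * z ^ m := by fun_prop
  exact ContDiff.mul (Complex.reCLM.contDiff.comp this) (hs.comp (contDiff_norm_sq ℝ))

/-- From `conj z = |z|²/z`: antiholomorphic powers become negative Laurent powers with a radial
weight, and so pair with low moments. -/
lemma conj_pow_eq {z : ℂ} (hz : z ≠ 0) (k : ℕ) :
    conj z ^ k = z ^ (-(k : ℤ)) * ((‖z‖ ^ (2 * k) : ℝ) : ℂ) := by
  have h : conj z = z⁻¹ * ((‖z‖ ^ 2 : ℝ) : ℂ) := by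
    have := Complex.mul_conj z
    rw [normSq_eq_norm_sq] at this
    rw [← this]
    field_simp
  rw [h, mul_pow, pow_mul, zpow_neg, zpow_natCast]
  push_cast
  rw [inv_pow]

lemma setIntegral_mul_radial_of_ae {f F : ℂ → ℂ} {a : ℝ} (ha : 0 ≤ a)
    (hfF : ∀ᵐ z : ℂ, a < ‖z‖ → f z = F z) {j : ℤ} {c : ℂ} (hF : ∀ r, a < r → moment F j r = c)
    (g : ℝ → ℂ) (hint : Integrable fun z => f z * z ^ j * g ‖z‖) :
    ∫ z in {z : ℂ | a < ‖z‖}, f z * z ^ j * g ‖z‖ = c * ∫ r in Set.Ioi a, r * g r := by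
  have hae : (fun z => f z * z ^ j * g ‖z‖) =ᵐ[volume.restrict {z : ℂ | a < ‖z‖}]
      fun z => F z * z ^ j * g ‖z‖ := by
    rw [EventuallyEq, ae_restrict_iff' (measurableSet_norm_gt _)]
    filter_upwards [hfF] with z hz hzR
    rw [hz hzR]
  rw [integral_congr_ae hae]
  exact setIntegral_mul_radial ha hF (hint.integrableOn.congr hae)

lemma integral_eq_setIntegral_norm_gt {a : ℝ} {h : ℂ → ℂ} (hh : ∀ z, ‖z‖ ≤ a → h z = 0) :
    ∫ z, h z = ∫ z in {z : ℂ | a < ‖z‖}, h z := by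
  rw [← integral_indicator (measurableSet_norm_gt a)]
  congr 1
  ext z
  by_cases hz : a < ‖z‖
  · simp [Set.indicator, hz]
  · simp [Set.indicator, hz, hh z (not_lt.1 hz)]

/-- Exhaustion by `|z| > ε + 1/(n+1)`. It is needed because `f` is identified with a holomorphic
function only at a positive distance from the circle `|z| = ε`. -/
lemma integral_eq_zero_of_forall_norm_gt {ε : ℝ} {h : ℂ → ℂ} (hi : Integrable h)
    (h0 : ∀ z, ‖z‖ ≤ ε → h z = 0)
    (hz : ∀ ρ : ℝ, 0 < ρ → ∫ z in {z : ℂ | ε + ρ < ‖z‖}, h z = 0) : ∫ z, h z = 0 := by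
  have hmono : Monotone fun n : ℕ => {z : ℂ | ε + 1 / ((n : ℝ) + 1) < ‖z‖} := by
    intro n k hnk z hz
    have hz : ε + 1 / ((n : ℝ) + 1) < ‖z‖ := hz
    have : 1 / ((k : ℝ) + 1) ≤ 1 / ((n : ℝ) + 1) := by gcongr
    change ε + 1 / ((k : ℝ) + 1) < ‖z‖
    linarith
  have hlim := tendsto_setIntegral_of_monotone (μ := volume) (f := h)
    (fun n : ℕ => measurableSet_norm_gt (ε + 1 / ((n : ℝ) + 1))) hmono hi.integrableOn
  have hzero : ∀ n : ℕ, ∫ z in {z : ℂ | ε + 1 / ((n : ℝ) + 1) < ‖z‖}, h z = 0 :=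
    fun n => hz _ (by positivity)
  simp_rw [hzero] at hlim
  have hU := tendsto_nhds_unique hlim tendsto_const_nhds
  rw [← hU, ← integral_indicator (MeasurableSet.iUnion fun n => measurableSet_norm_gt _)]
  congr 1
  ext z
  by_cases hz : ‖z‖ ≤ ε
  · simp [Set.indicator, h0 z hz]
  · rw [Set.indicator_of_mem]
    obtain ⟨n, hn⟩ := exists_nat_one_div_lt (sub_pos.2 (not_le.1 hz))
    exact Set.mem_iUnion.2 ⟨n, by change ε + 1 / ((n : ℝ) + 1) < ‖z‖; linarith⟩

/-- `s` is a smooth function which is `1` on `(-∞, b]` and `0` on `[b + 1, ∞)`. -/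
structure IsPlateau (b : ℝ) (s : ℝ → ℝ) : Prop where
  smooth : ContDiff ℝ ((⊤ : ℕ∞) : WithTop ℕ∞) s
  eq_one : ∀ t, t ≤ b → s t = 1
  eq_zero : ∀ t, b + 1 ≤ t → s t = 0
  deriv_left : ∀ t, t ≤ b → deriv s t = 0
  deriv_right : ∀ t, b + 1 ≤ t → deriv s t = 0

lemma exists_isPlateau (b : ℝ) : ∃ s, IsPlateau b s := by
  have h1 : ∀ t, t ≤ b → Real.smoothTransition (b + 1 - t) = 1 := fun t ht =>
    Real.smoothTransition.one_of_one_le (by linarith)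
  have h0 : ∀ t, b + 1 ≤ t → Real.smoothTransition (b + 1 - t) = 0 := fun t ht =>
    Real.smoothTransition.zero_of_nonpos (by linarith)
  refine ⟨fun t => Real.smoothTransition (b + 1 - t),
    Real.smoothTransition.contDiff.comp (by fun_prop), h1, h0, fun t ht => ?_, fun t ht => ?_⟩
  -- The values lie in `[0, 1]`, so every point of the plateau, endpoint included, is an extremum
  -- and the derivative vanishes there.
  · have : IsLocalMax (fun t => Real.smoothTransition (b + 1 - t)) t :=
      Eventually.of_forall fun x => by
        dsimp only
        rw [h1 t ht]
        exact Real.smoothTransition.le_one _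
    exact this.deriv_eq_zero
  · have : IsLocalMin (fun t => Real.smoothTransition (b + 1 - t)) t :=
      Eventually.of_forall fun x => by
        dsimp only
        rw [h0 t ht]
        exact Real.smoothTransition.nonneg _
    exact this.deriv_eq_zero

/-- The integrand is the derivative of `s(r²)/2`, which falls from `1/2` at `a` to `0`. -/
lemma IsPlateau.integral_deriv_sq {a : ℝ} {s : ℝ → ℝ} (hs : IsPlateau (a ^ 2) s) :
    ∫ r in Set.Ioi a, (r : ℂ) * ((deriv s (r ^ 2) : ℝ) : ℂ) = -1 / 2 := by
  have hsd : Differentiable ℝ s := hs.smooth.differentiable (by simp)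
  have hsd' : Continuous (deriv s) := hs.smooth.continuous_deriv (by simp)
  have hg : Continuous fun r : ℝ => r * deriv s (r ^ 2) :=
    continuous_id.mul (hsd'.comp (by fun_prop))
  have hgc : HasCompactSupport fun r : ℝ => r * deriv s (r ^ 2) := by
    refine HasCompactSupport.of_support_subset_isCompact
      (isCompact_closedBall (0 : ℝ) (a ^ 2 + 1)) fun r hr => ?_
    by_contra h
    apply hr
    have : a ^ 2 + 1 < |r| := by simpa using h
    have h2 : a ^ 2 + 1 ≤ r ^ 2 := by
      rw [← sq_abs r]
      nlinarith [sq_nonneg a]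
    simp [hs.deriv_right _ h2]
  have hder : ∀ r ∈ Set.Ici a, HasDerivAt (fun r : ℝ => s (r ^ 2) / 2) (r * deriv s (r ^ 2)) r := by
    intro r _
    have := ((hsd (r ^ 2)).hasDerivAt.comp r (hasDerivAt_pow 2 r)).div_const 2
    convert! this using 1
    simp
    ring
  have hl : Tendsto (fun r : ℝ => s (r ^ 2) / 2) atTop (𝓝 0) := by
    refine tendsto_const_nhds.congr' ?_
    filter_upwards [eventually_ge_atTop (a ^ 2 + 1)] with r hr
    rw [hs.eq_zero _ (by nlinarith [sq_nonneg a]), zero_div]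
  have := integral_Ioi_of_hasDerivAt_of_tendsto' hder
    (hg.integrable_of_hasCompactSupport hgc).integrableOn hl
  rw [hs.eq_one _ le_rfl] at this
  have e3 : ∫ r in Set.Ioi a, (r : ℂ) * ((deriv s (r ^ 2) : ℝ) : ℂ) =
      ((∫ r in Set.Ioi a, r * deriv s (r ^ 2) : ℝ) : ℂ) := by
    rw [← integral_complex_ofReal]
    simp only [ofReal_mul]
  rw [e3, this]
  push_cast
  ring

lemma hasCompactSupport_of_norm_sq {E : Type*} [Zero E] {g : ℂ → E} {b : ℝ}
    (hb : 0 ≤ b) (hg : ∀ z, b + 1 ≤ ‖z‖ ^ 2 → g z = 0) : HasCompactSupport g := by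
  refine HasCompactSupport.of_support_subset_isCompact
    (isCompact_closedBall (0 : ℂ) (b + 1)) fun z hz => ?_
  by_contra h
  apply hz
  apply hg
  have : b + 1 < ‖z‖ := by simpa using h
  nlinarith

/-- The boundary condition, tested with `Re (c z^m) s(|z|²)`, kills the moments of order
at least two. -/
lemma moment_eq_zero_of_normalTrace {f F : ℂ → ℂ} {a : ℝ} (ha : 0 ≤ a) (hf : LocallyIntegrable f)
    (hfF : ∀ᵐ z : ℂ, a < ‖z‖ → f z = F z)
    (hr : ∀ φ : ℂ → ℝ, ContDiff ℝ ((⊤ : ℕ∞) : WithTop ℕ∞) φ → HasCompactSupport φ →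
      (∫ z, f z * dbar (fun z => (φ z : ℂ)) z).re = 0) {m : ℕ} {C : ℂ}
    (hC : ∀ r, a < r → moment F (m + 1) r = C) (hlow : ∀ r, a < r → moment F (1 - m) r = 0)
    (hvanish : ∀ g : ℝ → ℂ, Integrable (fun z => f z * z ^ (-((m - 1 : ℕ) : ℤ)) * g ‖z‖) →
      ∫ z, f z * z ^ (-((m - 1 : ℕ) : ℤ)) * g ‖z‖ = 0) : C = 0 := by
  obtain ⟨s, hs⟩ := exists_isPlateau (a ^ 2)
  have hsd : Differentiable ℝ s := hs.smooth.differentiable (by simp)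
  have hsd' : Continuous (deriv s) := hs.smooth.continuous_deriv (by simp)
  have hfi : ∀ g : ℂ → ℂ, Continuous g → (∀ z, a ^ 2 + 1 ≤ ‖z‖ ^ 2 → g z = 0) →
      Integrable fun z => f z * g z := fun g hg h =>
    hf.integrable_smul_right_of_hasCompactSupport hg (hasCompactSupport_of_norm_sq (sq_nonneg a) h)
  have hz0 : ∀ᵐ z : ℂ, z ≠ 0 := by simp [ae_iff]
  have hsc : Continuous fun z : ℂ => ((s (‖z‖ ^ 2) : ℝ) : ℂ) :=
    continuous_ofReal.comp (hsd.continuous.comp (by fun_prop))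
  have hsc' : Continuous fun z : ℂ => ((deriv s (‖z‖ ^ 2) : ℝ) : ℂ) :=
    continuous_ofReal.comp (hsd'.comp (by fun_prop))
  have hsq : ∀ z : ℂ, ‖z‖ ≤ a → deriv s (‖z‖ ^ 2) = 0 := fun z hz => hs.deriv_left _ (by gcongr)
  have i1 : Integrable fun z => f z * (conj z ^ (m - 1) * (s (‖z‖ ^ 2) : ℝ)) :=
    hfi _ ((by fun_prop : Continuous fun z : ℂ => conj z ^ (m - 1)).mul hsc)
      fun z hz => by simp [hs.eq_zero _ hz]
  -- This weight does not vanish near the inner circle, hence the appeal to `hvanish` instead of an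
  -- integral over `|z| > a`.
  have t1 : ∫ z, f z * (conj z ^ (m - 1) * (s (‖z‖ ^ 2) : ℝ)) = 0 := by
    have e : (fun z => f z * (conj z ^ (m - 1) * (s (‖z‖ ^ 2) : ℝ))) =ᵐ[volume]
        fun z => f z * z ^ (-((m - 1 : ℕ) : ℤ)) *
          ((‖z‖ ^ (2 * (m - 1)) * s (‖z‖ ^ 2) : ℝ) : ℂ) := by
      filter_upwards [hz0] with z hz
      rw [conj_pow_eq hz]
      push_cast
      ring
    rw [integral_congr_ae e]
    exact hvanish (fun r => ((r ^ (2 * (m - 1)) * s (r ^ 2) : ℝ) : ℂ)) (i1.congr e)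
  have i2 : Integrable fun z => f z * (z ^ (m + 1) * (deriv s (‖z‖ ^ 2) : ℝ)) :=
    hfi _ ((by fun_prop : Continuous fun z : ℂ => z ^ (m + 1)).mul hsc')
      fun z hz => by simp [hs.deriv_right _ hz]
  -- The only surviving term: `s'` vanishes for `|z| ≤ a`, and the moment of order `m + 1` comes out
  -- with the factor `∫ r s'(r²) dr = -1/2`.
  have t2 : ∫ z, f z * (z ^ (m + 1) * (deriv s (‖z‖ ^ 2) : ℝ)) = C * (-1 / 2) := by
    have e : (fun z => f z * (z ^ (m + 1) * (deriv s (‖z‖ ^ 2) : ℝ))) =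
        fun z => f z * z ^ ((m : ℤ) + 1) * ((deriv s (‖z‖ ^ 2) : ℝ) : ℂ) := by
      ext z
      have : z ^ ((m : ℤ) + 1) = z ^ (m + 1) := by exact_mod_cast zpow_natCast z (m + 1)
      rw [this]
      ring
    rw [integral_eq_setIntegral_norm_gt (a := a) fun z hz => by simp [hsq z hz]]
    rw [e] at i2 ⊢
    rw [setIntegral_mul_radial_of_ae ha hfF hC (fun r => ((deriv s (r ^ 2) : ℝ) : ℂ)) i2,
      hs.integral_deriv_sq]
  have i3 : Integrable fun z => f z * (conj z ^ m * z * (deriv s (‖z‖ ^ 2) : ℝ)) :=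
    hfi _ ((by fun_prop : Continuous fun z : ℂ => conj z ^ m * z).mul hsc')
      fun z hz => by simp [hs.deriv_right _ hz]
  have t3 : ∫ z, f z * (conj z ^ m * z * (deriv s (‖z‖ ^ 2) : ℝ)) = 0 := by
    have e : (fun z => f z * (conj z ^ m * z * (deriv s (‖z‖ ^ 2) : ℝ))) =ᵐ[volume]
        fun z => f z * z ^ (1 - (m : ℤ)) *
          ((‖z‖ ^ (2 * m) * deriv s (‖z‖ ^ 2) : ℝ) : ℂ) := by
      filter_upwards [hz0] with z hz
      rw [conj_pow_eq hz, sub_eq_neg_add, zpow_add₀ hz, zpow_one]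
      push_cast
      ring
    rw [integral_congr_ae e, integral_eq_setIntegral_norm_gt (a := a) fun z hz => by
      simp [hsq z hz], setIntegral_mul_radial_of_ae ha hfF hlow
      (fun r => ((r ^ (2 * m) * deriv s (r ^ 2) : ℝ) : ℂ)) (i3.congr e), zero_mul]
  -- The trace condition controls a real part only; letting `c` be `1` and `i` recovers both
  -- components of `C`.
  have htest : ∀ c : ℂ, (c * C).re = 0 := by
    intro c
    have hφ := hr (radialHarmonic c m s) (contDiff_radialHarmonic c m hs.smooth)
      (hasCompactSupport_of_norm_sq (sq_nonneg a)
        fun z hz => by simp [radialHarmonic, hs.eq_zero _ hz])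
    have e : ∫ z, f z * dbar (fun z => ((radialHarmonic c m s z : ℝ) : ℂ)) z =
        c * (C * (-1 / 2)) := by
      have e1 : ∀ z, f z * dbar (fun z => ((radialHarmonic c m s z : ℝ) : ℂ)) z =
          conj c * m * (f z * (conj z ^ (m - 1) * (s (‖z‖ ^ 2) : ℝ))) +
          (c * (f z * (z ^ (m + 1) * (deriv s (‖z‖ ^ 2) : ℝ))) +
          conj c * (f z * (conj z ^ m * z * (deriv s (‖z‖ ^ 2) : ℝ)))) := by
        intro z
        rw [dbar_radialHarmonic c m hsd]
        simp only [map_mul, map_pow, map_natCast]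
        ring
      simp_rw [e1]
      have i23 : Integrable fun z => c * (f z * (z ^ (m + 1) * (deriv s (‖z‖ ^ 2) : ℝ))) +
          conj c * (f z * (conj z ^ m * z * (deriv s (‖z‖ ^ 2) : ℝ))) :=
        (i2.const_mul _).add (i3.const_mul _)
      rw [integral_add (i1.const_mul _) i23, integral_add (i2.const_mul _) (i3.const_mul _),
        integral_const_mul, integral_const_mul,
        integral_const_mul, t1, t2, t3]
      ring
    rw [e] at hφ
    have : c * (C * (-1 / 2)) = ((-1 / 2 : ℝ) : ℂ) * (c * C) := by push_cast; ring
    rw [this, re_ofReal_mul] at hφ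
    linarith
  apply Complex.ext
  · simpa using htest 1
  · simpa using htest I

/-- A square integrable function vanishing in a disk, holomorphic outside of it in the sense of
distributions and with vanishing weak normal trace, is zero. -/
theorem ae_eq_zero_of_weaklyHolomorphic {ε : ℝ} (hε : 0 ≤ ε) {f : ℂ → ℂ} (hf : MemLp f 2)
    (h0 : ∀ z, ‖z‖ ≤ ε → f z = 0) (hw : WeaklyHolomorphic {z | ε < ‖z‖} f)
    (hr : ∀ φ : ℂ → ℝ, ContDiff ℝ ((⊤ : ℕ∞) : WithTop ℕ∞) φ → HasCompactSupport φ →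
      (∫ z, f z * dbar (fun z => (φ z : ℂ)) z).re = 0) :
    f =ᵐ[volume] 0 := by
  have hloc : LocallyIntegrable f := hf.locallyIntegrable (by norm_num)
  have hball : ∀ ρ : ℝ, ∀ z : ℂ, ε + ρ < ‖z‖ → Metric.closedBall z ρ ⊆ {z | ε < ‖z‖} := by
    intro ρ z hz w hw
    have : dist w z ≤ ρ := hw
    rw [dist_eq_norm, norm_sub_rev] at this
    have h2 := norm_sub_norm_le z w
    change ε < ‖w‖
    linarith
  have hdiff : ∀ ρ : ℝ, 0 < ρ → ∀ z : ℂ, ε + ρ < ‖z‖ → DifferentiableAt ℂ (regularize ρ f) z :=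
    fun ρ hρ z hz => hw.differentiableAt_regularize hloc hρ (hball ρ z hz)
  have hae : ∀ ρ : ℝ, 0 < ρ → ∀ᵐ z : ℂ, ε + ρ < ‖z‖ → f z = regularize ρ f z := fun ρ hρ =>
    hw.ae_eq_regularize hloc hρ (U := {z | ε + ρ < ‖z‖})
      (isOpen_lt continuous_const continuous_norm) (hball ρ)
  have hconst : ∀ ρ : ℝ, 0 < ρ → ∀ j : ℤ, ∃ c, ∀ r, ε + ρ < r →
      moment (regularize ρ f) j r = c := fun ρ hρ j =>
    ⟨moment (regularize ρ f) j (ε + ρ + 1), fun r hr => moment_eq_of_differentiableAt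
      (by positivity)
      (hdiff ρ hρ) j hr (by linarith)⟩
  have hlow : ∀ ρ : ℝ, 0 < ρ → ∀ j : ℤ, j ≤ 1 → ∀ r, ε + ρ < r →
      moment (regularize ρ f) j r = 0 := by
    intro ρ hρ j hj r hr
    obtain ⟨c, hc⟩ := hconst ρ hρ j
    rw [hc r hr]
    exact moment_eq_zero_of_memLp hf (hae ρ hρ) hj hc
  have hvanish : ∀ j : ℤ, j ≤ 1 → ∀ g : ℝ → ℂ, Integrable (fun z => f z * z ^ j * g ‖z‖) →
      ∫ z, f z * z ^ j * g ‖z‖ = 0 := by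
    intro j hj g hg
    refine integral_eq_zero_of_forall_norm_gt (ε := ε) hg (fun z hz => by simp [h0 z hz])
      fun ρ hρ => ?_
    rw [setIntegral_mul_radial_of_ae (by positivity) (hae ρ hρ) (hlow ρ hρ j hj) g hg, zero_mul]
  have hall : ∀ ρ : ℝ, 0 < ρ → ∀ z : ℂ, ε + ρ < ‖z‖ → regularize ρ f z = 0 := by
    intro ρ hρ z hz
    have hm : ∀ j : ℤ, moment (regularize ρ f) j ‖z‖ = 0 := by
      intro j
      by_cases hj : j ≤ 1
      · exact hlow ρ hρ j hj _ hz
      -- Here `m ≥ 1`, so the auxiliary orders `1 - m` and `-(m - 1)` are at most `1` and their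
      -- moments already vanish.
      · obtain ⟨m, rfl⟩ : ∃ m : ℕ, j = m + 1 := ⟨(j - 1).toNat, by omega⟩
        obtain ⟨C, hC⟩ := hconst ρ hρ (m + 1)
        rw [hC _ hz]
        exact moment_eq_zero_of_normalTrace (by positivity) hloc (hae ρ hρ) hr hC
          (hlow ρ hρ _ (by omega)) (hvanish _ (by omega))
    have := eq_zero_of_forall_moment_eq_zero (continuous_regularize hρ hloc)
      (show 0 < ‖z‖ by linarith) hm (arg z)
    rwa [circleMap_zero, norm_mul_exp_arg_mul_I] at this
  have hn : ∀ n : ℕ, ∀ᵐ z : ℂ, ε + 1 / ((n : ℝ) + 1) < ‖z‖ → f z = 0 := by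
    intro n
    have hn : (0 : ℝ) < 1 / ((n : ℝ) + 1) := by positivity
    filter_upwards [hae _ hn] with z hz hzn
    rw [hz hzn, hall _ hn z hzn]
  filter_upwards [ae_all_iff.2 hn] with z hz
  by_cases h : ‖z‖ ≤ ε
  · exact h0 z h
  · obtain ⟨n, hn⟩ := exists_nat_one_div_lt (sub_pos.2 (not_le.1 h))
    exact hz n (by linarith)

end Uniqueness

/-! ### Dictionary between plane fields and complex velocities -/

section Bridge

open Complex
open scoped ComplexConjugate

/-- The identification of `ℂ` with the plane. -/
def planeEquiv : ℂ ≃ₗᵢ[ℝ] Plane := Complex.orthonormalBasisOneI.repr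

@[simp] lemma planeEquiv_apply_zero (z : ℂ) : planeEquiv z 0 = z.re := rfl

@[simp] lemma planeEquiv_apply_one (z : ℂ) : planeEquiv z 1 = z.im := rfl

lemma planeEquiv_symm_apply (x : Plane) : planeEquiv.symm x = x 0 + x 1 * I := rfl

lemma measurePreserving_planeEquiv : MeasurePreserving planeEquiv := planeEquiv.measurePreserving

lemma integral_comp_planeEquiv {E : Type*} [NormedAddCommGroup E] [NormedSpace ℝ E]
    (f : Plane → E) : ∫ z, f (planeEquiv z) = ∫ x, f x :=
  measurePreserving_planeEquiv.integral_comp planeEquiv.toHomeomorph.measurableEmbedding f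

/-- The identification of a vector `v` with the complex number `v₁ - i v₂`. -/
def conjEquiv : Plane ≃ₗᵢ[ℝ] ℂ := planeEquiv.symm.trans Complex.conjLIE

lemma conjEquiv_apply (x : Plane) : conjEquiv x = x 0 - x 1 * I := by
  simp [conjEquiv, planeEquiv_symm_apply, sub_eq_add_neg]

/-- The complex velocity `u₁ - i u₂` of a vector field. -/
def complexVelocity (u : Plane → Plane) (z : ℂ) : ℂ := conjEquiv (u (planeEquiv z))

lemma norm_complexVelocity (u : Plane → Plane) (z : ℂ) :
    ‖complexVelocity u z‖ = ‖u (planeEquiv z)‖ := by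
  simp [complexVelocity]

lemma memLp_complexVelocity {u : Plane → Plane} (hu : MemLp u 2) :
    MemLp (complexVelocity u) 2 := by
  have h1 : MemLp (u ∘ planeEquiv) 2 := hu.comp_measurePreserving measurePreserving_planeEquiv
  have h2 := conjEquiv.toContinuousLinearEquiv.toContinuousLinearMap.comp_memLp' h1
  exact h2

lemma memLp_of_complexVelocity {u : Plane → Plane} (hu : MemLp (complexVelocity u) 2) :
    MemLp u 2 := by
  have h1 : MemLp (complexVelocity u ∘ planeEquiv.symm) 2 :=
    hu.comp_measurePreserving planeEquiv.symm.measurePreserving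
  have h2 := conjEquiv.symm.toContinuousLinearEquiv.toContinuousLinearMap.comp_memLp' h1
  have e : (fun x => conjEquiv.symm (complexVelocity u (planeEquiv.symm x))) = u := by
    ext1 x
    simp [complexVelocity]
  rw [← e]
  exact h2

lemma ae_planeEquiv {p : Plane → Prop} (h : ∀ᵐ z, p (planeEquiv z)) : ∀ᵐ x, p x := by
  have := planeEquiv.symm.measurePreserving.quasiMeasurePreserving.ae h
  simpa using this

lemma inner_plane (x y : Plane) : inner ℝ x y = x 0 * y 0 + x 1 * y 1 := by
  simp [PiLp.inner_apply, Fin.sum_univ_two, mul_comm]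

@[simp] lemma perp_apply_zero (x : Plane) : perp x 0 = -x 1 := rfl

@[simp] lemma perp_apply_one (x : Plane) : perp x 1 = x 0 := rfl

lemma norm_perp (x : Plane) : ‖perp x‖ = ‖x‖ := by
  simp [EuclideanSpace.norm_eq, Fin.sum_univ_two, add_comm]

/-- `perp` as a linear isometry. -/
def perpIsometry : Plane →ₗᵢ[ℝ] Plane where
  toFun := perp
  map_add' x y := by
    ext i
    fin_cases i
    · change -(x + y) 1 = -x 1 + -y 1
      simp; ring
    · rfl
  map_smul' c x := by
    ext i
    fin_cases i
    · change -(c • x) 1 = c * (-x 1)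
      simp
    · rfl
  norm_map' := norm_perp

lemma continuous_perp : Continuous perp := perpIsometry.continuous

lemma gradient_apply_zero {φ : Plane → ℝ} (x : Plane) :
    gradient φ x 0 = fderiv ℝ φ x (planeEquiv 1) := by
  rw [← InnerProductSpace.toDual_symm_apply (𝕜 := ℝ), ← gradient, inner_plane]
  simp

lemma gradient_apply_one {φ : Plane → ℝ} (x : Plane) :
    gradient φ x 1 = fderiv ℝ φ x (planeEquiv I) := by
  rw [← InnerProductSpace.toDual_symm_apply (𝕜 := ℝ), ← gradient, inner_plane]
  simp

lemma dbar_comp_planeEquiv {φ : Plane → ℝ} (hφ : Differentiable ℝ φ) (z : ℂ) :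
    dbar (fun z => ((φ (planeEquiv z) : ℝ) : ℂ)) z =
      gradient φ (planeEquiv z) 0 + I * gradient φ (planeEquiv z) 1 := by
  have h : HasFDerivAt (fun z => ((φ (planeEquiv z) : ℝ) : ℂ)) _ z :=
    Complex.ofRealCLM.hasFDerivAt.comp z ((hφ (planeEquiv z)).hasFDerivAt.comp z
      planeEquiv.toContinuousLinearEquiv.hasFDerivAt)
  rw [dbar, h.fderiv, gradient_apply_zero, gradient_apply_one]
  rfl

/-- Expand `(u₁ - i u₂)(∂₁φ + i∂₂φ)`: the real part tests the divergence and the imaginary part the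
curl. -/
lemma complexVelocity_mul_dbar (u : Plane → Plane) {φ : Plane → ℝ} (hφ : Differentiable ℝ φ)
    (z : ℂ) :
    complexVelocity u z * dbar (fun z => ((φ (planeEquiv z) : ℝ) : ℂ)) z =
      ((inner ℝ (u (planeEquiv z)) (gradient φ (planeEquiv z)) : ℝ) : ℂ) -
        ((inner ℝ (u (planeEquiv z)) (perp (gradient φ (planeEquiv z))) : ℝ) : ℂ) * I := by
  rw [dbar_comp_planeEquiv hφ, complexVelocity, conjEquiv_apply, inner_plane, inner_plane]
  simp only [perp_apply_zero, perp_apply_one]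
  push_cast
  linear_combination (-(u (planeEquiv z) 1 : ℂ) * gradient φ (planeEquiv z) 1) * I_sq

end Bridge

/-! ### Test functions and integrability of pairings -/

section Test

variable {O : Set Plane} {φ : Plane → ℝ}

lemma IsTest.differentiable (h : IsTest O φ) : Differentiable ℝ φ :=
  h.smooth.differentiable (by simp)

lemma IsTest.mono {O' : Set Plane} (h : IsTest O φ) (hO : O ⊆ O') : IsTest O' φ :=
  ⟨h.smooth, h.compact, h.support_subset.trans hO⟩

lemma gradient_of_notMem_tsupport {x : Plane} (h : x ∉ tsupport φ) : gradient φ x = 0 := by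
  rw [gradient, fderiv_of_notMem_tsupport ℝ h, map_zero]

lemma IsTest.continuous_gradient (h : IsTest O φ) : Continuous (gradient φ) :=
  (InnerProductSpace.toDual ℝ Plane).symm.continuous.comp (h.smooth.continuous_fderiv (by simp))

lemma IsTest.hasCompactSupport_gradient (h : IsTest O φ) : HasCompactSupport (gradient φ) :=
  HasCompactSupport.of_support_subset_isCompact h.compact fun x hx => by
    by_contra h'
    exact hx (gradient_of_notMem_tsupport h')

lemma IsTest.hasCompactSupport_perp_gradient (h : IsTest O φ) :
    HasCompactSupport fun x => perp (gradient φ x) :=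
  h.hasCompactSupport_gradient.comp_left (g := perp) perpIsometry.map_zero

lemma IsTest.continuous_perp_gradient (h : IsTest O φ) :
    Continuous fun x => perp (gradient φ x) :=
  continuous_perp.comp h.continuous_gradient

lemma locallyIntegrable_norm {u : Plane → Plane} (hu : LocallyIntegrable u) :
    LocallyIntegrable fun x => ‖u x‖ := fun x => by
  obtain ⟨s, hs, h⟩ := hu x
  exact ⟨s, hs, h.norm⟩

lemma integrable_inner_of_hasCompactSupport {u g : Plane → Plane} (hu : LocallyIntegrable u)
    (hg : Continuous g) (hc : HasCompactSupport g) : Integrable fun x => inner ℝ (u x) (g x) := by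
  have h1 : Integrable (fun x => ‖g x‖ * ‖u x‖) :=
    (locallyIntegrable_norm hu).integrable_smul_left_of_hasCompactSupport hg.norm hc.norm
  refine h1.mono' (hu.aestronglyMeasurable.inner hg.aestronglyMeasurable)
    (Eventually.of_forall fun x => ?_)
  rw [mul_comm]
  exact norm_inner_le_norm _ _

lemma setIntegral_eq_integral_indicator {u g : Plane → Plane} {O : Set Plane}
    (hO : MeasurableSet O) :
    ∫ x in O, inner ℝ (u x) (g x) = ∫ x, inner ℝ (O.indicator u x) (g x) := by
  rw [← integral_indicator hO]
  congr 1
  ext x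
  by_cases h : x ∈ O <;> simp [h]

lemma isOpen_fluid (ε : ℝ) : IsOpen (fluid ε) := Metric.isClosed_closedBall.isOpen_compl

lemma measurableSet_fluid (ε : ℝ) : MeasurableSet (fluid ε) := (isOpen_fluid ε).measurableSet

lemma mem_fluid {ε : ℝ} {x : Plane} : x ∈ fluid ε ↔ ε < ‖x‖ := by
  simp [fluid]

end Test

/-! ### Homogeneous div-curl problem: uniqueness and decay at infinity -/

section PlaneUniqueness

open Complex

lemma integral_complexVelocity_mul_dbar {u : Plane → Plane} (hu : LocallyIntegrable u)
    {O : Set Plane} {φ : Plane → ℝ} (hφ : IsTest O φ) :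
    ∫ z, complexVelocity u z * dbar (fun z => ((φ (planeEquiv z) : ℝ) : ℂ)) z =
      ((∫ x, inner ℝ (u x) (gradient φ x) : ℝ) : ℂ) -
        ((∫ x, inner ℝ (u x) (perp (gradient φ x)) : ℝ) : ℂ) * I := by
  simp_rw [complexVelocity_mul_dbar u hφ.differentiable]
  rw [integral_comp_planeEquiv (fun x => ((inner ℝ (u x) (gradient φ x) : ℝ) : ℂ) -
    ((inner ℝ (u x) (perp (gradient φ x)) : ℝ) : ℂ) * I)]
  have i1 := integrable_inner_of_hasCompactSupport hu hφ.continuous_gradient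
    hφ.hasCompactSupport_gradient
  have i2 := integrable_inner_of_hasCompactSupport hu hφ.continuous_perp_gradient
    hφ.hasCompactSupport_perp_gradient
  have j1 : Integrable fun x => ((inner ℝ (u x) (gradient φ x) : ℝ) : ℂ) := i1.ofReal
  have j2 : Integrable fun x => ((inner ℝ (u x) (perp (gradient φ x)) : ℝ) : ℂ) := i2.ofReal
  rw [integral_sub j1 (j2.mul_const I), integral_mul_const,
    integral_complex_ofReal, integral_complex_ofReal]

lemma isTest_comp_symm {O : Set Plane} {a : ℂ → ℝ}
    (ha : ContDiff ℝ ((⊤ : ℕ∞) : WithTop ℕ∞) a) (hc : HasCompactSupport a)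
    (hO : tsupport a ⊆ planeEquiv ⁻¹' O) : IsTest O fun x => a (planeEquiv.symm x) where
  smooth := ha.comp planeEquiv.symm.contDiff
  compact := hc.comp_homeomorph planeEquiv.symm.toHomeomorph
  support_subset := by
    intro x hx
    have := tsupport_comp_subset_preimage a planeEquiv.symm.continuous hx
    simpa using hO this

/-- The hypotheses concern real test functions; a complex one is split into its real and imaginary
parts, over which `dbar` is linear. -/
lemma weaklyHolomorphic_complexVelocity {O : Set Plane} {u : Plane → Plane}
    (hu : LocallyIntegrable u)
    (hdiv : ∀ φ, IsTest O φ → ∫ x, inner ℝ (u x) (gradient φ x) = 0)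
    (hcurl : ∀ φ, IsTest O φ → ∫ x, inner ℝ (u x) (perp (gradient φ x)) = 0)
    (huc : LocallyIntegrable (complexVelocity u)) :
    WeaklyHolomorphic (planeEquiv ⁻¹' O) (complexVelocity u) := by
  have key : ∀ a : ℂ → ℝ, ContDiff ℝ ((⊤ : ℕ∞) : WithTop ℕ∞) a → HasCompactSupport a →
      tsupport a ⊆ planeEquiv ⁻¹' O →
      Integrable (fun z => complexVelocity u z * dbar (fun z => (a z : ℂ)) z) ∧
      ∫ z, complexVelocity u z * dbar (fun z => (a z : ℂ)) z = 0 := by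
    intro a ha hac haO
    have ht := isTest_comp_symm ha hac haO
    have := integral_complexVelocity_mul_dbar hu ht
    rw [hdiv _ ht, hcurl _ ht] at this
    have ha1 : ContDiff ℝ 1 fun z => (a z : ℂ) :=
      Complex.ofRealCLM.contDiff.comp (ha.of_le (by exact_mod_cast le_top))
    refine ⟨huc.integrable_smul_right_of_hasCompactSupport (continuous_dbar ha1)
      (hasCompactSupport_dbar (hac.comp_left (g := fun x : ℝ => (x : ℂ)) rfl)), ?_⟩
    simpa using this
  intro φ hφ hφc hφO
  have hre : ContDiff ℝ ((⊤ : ℕ∞) : WithTop ℕ∞) fun z => (φ z).re :=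
    Complex.reCLM.contDiff.comp hφ
  have him : ContDiff ℝ ((⊤ : ℕ∞) : WithTop ℕ∞) fun z => (φ z).im :=
    Complex.imCLM.contDiff.comp hφ
  obtain ⟨i1, e1⟩ := key (fun z => (φ z).re) hre (hφc.comp_left (g := Complex.re) rfl)
    ((closure_mono (Function.support_comp_subset (g := Complex.re) rfl φ)).trans hφO)
  obtain ⟨i2, e2⟩ := key (fun z => (φ z).im) him (hφc.comp_left (g := Complex.im) rfl)
    ((closure_mono (Function.support_comp_subset (g := Complex.im) rfl φ)).trans hφO)
  have d1 : Differentiable ℝ fun z => ((φ z).re : ℂ) :=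
    (Complex.ofRealCLM.contDiff.comp hre).differentiable (n := ((⊤ : ℕ∞) : WithTop ℕ∞)) (by simp)
  have d2 : Differentiable ℝ fun z => ((φ z).im : ℂ) :=
    (Complex.ofRealCLM.contDiff.comp him).differentiable (n := ((⊤ : ℕ∞) : WithTop ℕ∞)) (by simp)
  have e : ∀ z, complexVelocity u z * dbar φ z =
      complexVelocity u z * dbar (fun z => ((φ z).re : ℂ)) z +
      I * (complexVelocity u z * dbar (fun z => ((φ z).im : ℂ)) z) := by
    intro z
    have h : φ = fun z => ((φ z).re : ℂ) + I * ((φ z).im : ℂ) := by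
      ext z
      rw [mul_comm, re_add_im]
    have h2 : dbar φ z = dbar (fun z => ((φ z).re : ℂ) + I * ((φ z).im : ℂ)) z := by rw [← h]
    rw [h2, dbar_add (d1 z) ((d2 z).const_mul I), dbar_const_mul (d2 z)]
    ring
  simp_rw [e]
  rw [integral_add i1 (i2.const_mul I), integral_const_mul, e1, e2]
  simp

lemma memLp_indicator_fluid {ε : ℝ} {w : Plane → Plane}
    (hw : MemLp w 2 (volume.restrict (fluid ε))) : MemLp ((fluid ε).indicator w) 2 :=
  (memLp_indicator_iff_restrict (measurableSet_fluid ε)).2 hw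

lemma weaklyHolomorphic_of_fluid {ε : ℝ} {w : Plane → Plane}
    (hw : MemLp w 2 (volume.restrict (fluid ε)))
    (hdiv : ∀ φ, IsTest (fluid ε) φ → ∫ x in fluid ε, inner ℝ (w x) (gradient φ x) = 0)
    (hcurl : ∀ φ, IsTest (fluid ε) φ → ∫ x in fluid ε, inner ℝ (w x) (perp (gradient φ x)) = 0) :
    WeaklyHolomorphic {z | ε < ‖z‖} (complexVelocity ((fluid ε).indicator w)) := by
  have hm := memLp_indicator_fluid hw
  have h := weaklyHolomorphic_complexVelocity (O := fluid ε) (hm.locallyIntegrable (by norm_num))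
    (fun φ hφ => by rw [← hdiv φ hφ, setIntegral_eq_integral_indicator (measurableSet_fluid ε)])
    (fun φ hφ => by rw [← hcurl φ hφ, setIntegral_eq_integral_indicator (measurableSet_fluid ε)])
    ((memLp_complexVelocity hm).locallyIntegrable (by norm_num))
  convert h using 1
  ext z
  simp [mem_fluid]

/-- Uniqueness for the homogeneous div-curl problem in the exterior of a (possibly degenerate)
disk. -/
theorem ae_eq_zero_of_divFree_curlFree {ε : ℝ} (hε : 0 ≤ ε) {w : Plane → Plane}
    (hw : MemLp w 2 (volume.restrict (fluid ε)))
    (hdiv : ∀ φ, IsTest Set.univ φ → ∫ x in fluid ε, inner ℝ (w x) (gradient φ x) = 0)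
    (hcurl : ∀ φ, IsTest (fluid ε) φ → ∫ x in fluid ε, inner ℝ (w x) (perp (gradient φ x)) = 0) :
    w =ᵐ[volume.restrict (fluid ε)] 0 := by
  have hm := memLp_indicator_fluid hw
  have hwh := weaklyHolomorphic_of_fluid hw (fun φ hφ => hdiv φ (hφ.mono (Set.subset_univ _))) hcurl
  have h := ae_eq_zero_of_weaklyHolomorphic hε (memLp_complexVelocity hm) (fun z hz => ?_) hwh
    (fun φ hφ hφc => ?_)
  · rw [EventuallyEq, ae_restrict_iff' (measurableSet_fluid ε)]
    refine ae_planeEquiv (h.mono fun z hz hzf => ?_)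
    have := norm_complexVelocity ((fluid ε).indicator w) z
    rw [hz, Set.indicator_of_mem hzf] at this
    simpa using this.symm
  · have : planeEquiv z ∉ fluid ε := by simpa [mem_fluid] using hz
    simp [complexVelocity, this]
  · have ht := isTest_comp_symm (O := Set.univ) hφ hφc (by simp)
    have := integral_complexVelocity_mul_dbar (hm.locallyIntegrable (by norm_num)) ht
    simp only [LinearIsometryEquiv.symm_apply_apply] at this
    rw [this, ← setIntegral_eq_integral_indicator (measurableSet_fluid ε), hdiv _ ht]
    simp

/-- Square integrable divergence and curl free fields in an exterior domain vanish at infinity. -/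
theorem vanishesAtInfinity_of_divFree_curlFree {ε : ℝ} {w : Plane → Plane}
    (hw : MemLp w 2 (volume.restrict (fluid ε)))
    (hdiv : ∀ φ, IsTest (fluid ε) φ → ∫ x in fluid ε, inner ℝ (w x) (gradient φ x) = 0)
    (hcurl : ∀ φ, IsTest (fluid ε) φ → ∫ x in fluid ε, inner ℝ (w x) (perp (gradient φ x)) = 0) :
    VanishesAtInfinity w := by
  have hm := memLp_complexVelocity (memLp_indicator_fluid hw)
  have hwh := weaklyHolomorphic_of_fluid hw hdiv hcurl
  -- Beyond distance `1` from the disk the field agrees almost everywhere with its unit-scale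
  -- regularization, which tends to zero.
  have hae := hwh.ae_eq_regularize (hm.locallyIntegrable (by norm_num)) one_pos
    (U := {z | ε + 1 < ‖z‖}) (isOpen_lt continuous_const continuous_norm) fun z hz v hv => by
      have hz : ε + 1 < ‖z‖ := hz
      have : dist v z ≤ 1 := hv
      rw [dist_eq_norm, norm_sub_rev] at this
      have h2 := norm_sub_norm_le z v
      change ε < ‖v‖
      linarith
  have hlim := tendsto_regularize_cobounded one_pos hm
  have hsymm : Tendsto planeEquiv.symm (Bornology.cobounded Plane) (Bornology.cobounded ℂ) := by
    rw [← tendsto_norm_atTop_iff_cobounded]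
    simpa using tendsto_norm_cobounded_atTop (E := Plane)
  rw [VanishesAtInfinity, tendsto_zero_iff_norm_tendsto_zero]
  have h1 := ((hlim.comp hsymm).norm).mono_left
    (inf_le_left : Bornology.cobounded Plane ⊓ ae volume ≤ _)
  rw [norm_zero] at h1
  refine h1.congr' ?_
  have hfar : ∀ᶠ x in Bornology.cobounded Plane ⊓ ae volume, max ε (ε + 1) < ‖x‖ :=
    (tendsto_norm_cobounded_atTop.eventually (eventually_gt_atTop _)).filter_mono inf_le_left
  have hae2 : ∀ᶠ x in Bornology.cobounded Plane ⊓ ae volume, planeEquiv.symm x ∈ {z | ε + 1 < ‖z‖} →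
      complexVelocity ((fluid ε).indicator w) (planeEquiv.symm x) =
        regularize 1 (complexVelocity ((fluid ε).indicator w)) (planeEquiv.symm x) :=
    (planeEquiv.symm.measurePreserving.quasiMeasurePreserving.ae hae).filter_mono inf_le_right
  filter_upwards [hfar, hae2] with x hx hx2
  have hx1 : x ∈ fluid ε := mem_fluid.2 ((le_max_left _ _).trans_lt hx)
  have hx3 : planeEquiv.symm x ∈ {z : ℂ | ε + 1 < ‖z‖} := by
    simpa using (le_max_right _ _).trans_lt hx
  simp only [Function.comp_apply]
  rw [← hx2 hx3, norm_complexVelocity]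
  simp [hx1]

end PlaneUniqueness

/-! ### The Cauchy transform of a bounded compactly supported function -/

section Cauchy

open Complex

/-- The convolution of `g` with `1/z`. -/
def cauchyTransform (g : ℂ → ℂ) (z : ℂ) : ℂ := ∫ w, g w * (z - w)⁻¹

/-- `g` is measurable, bounded by `M` and vanishes outside of the ball of radius `R`. -/
structure IsBoundedCompact (M R : ℝ) (g : ℂ → ℂ) : Prop where
  meas : AEStronglyMeasurable g
  nonneg : 0 ≤ M
  one_le : 1 ≤ R
  bound : ∀ᵐ z, ‖g z‖ ≤ M
  vanish : ∀ᵐ z : ℂ, R < ‖z‖ → g z = 0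

/-- The singular part of `1/z`. -/
def invNear : ℂ → ℂ := (Metric.ball (0 : ℂ) 1).indicator fun z => z⁻¹

/-- The bounded part of `1/z`. -/
def invFar : ℂ → ℂ := (Metric.ball (0 : ℂ) 1)ᶜ.indicator fun z => z⁻¹

lemma invNear_add_invFar (z : ℂ) : invNear z + invFar z = z⁻¹ :=
  congrFun (Set.indicator_self_add_compl (Metric.ball (0 : ℂ) 1) fun z => z⁻¹) z

lemma integrable_invNear : Integrable invNear :=
  ((locallyIntegrable_inv.integrableOn_isCompact (isCompact_closedBall (0 : ℂ) 1)).mono_set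
    Metric.ball_subset_closedBall).integrable_indicator measurableSet_ball

lemma measurable_invFar : Measurable invFar :=
  measurable_inv.indicator measurableSet_ball.compl

lemma norm_invFar_le (z : ℂ) : ‖invFar z‖ ≤ 1 := by
  by_cases h : ‖z‖ < 1
  · simp [invFar, h]
  · have h1 : 1 ≤ ‖z‖ := not_lt.1 h
    have : invFar z = z⁻¹ := by simp [invFar, h]
    rw [this, norm_inv]
    exact inv_le_one_of_one_le₀ h1

variable {M R : ℝ} {g : ℂ → ℂ}

lemma IsBoundedCompact.norm_le (hg : IsBoundedCompact M R g) :
    ∀ᵐ z, ‖g z‖ ≤ (Metric.closedBall (0 : ℂ) R).indicator (fun _ => M) z := by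
  filter_upwards [hg.bound, hg.vanish] with z h1 h2
  by_cases h : ‖z‖ ≤ R
  · rw [Set.indicator_of_mem (by simpa using h)]
    exact h1
  · rw [Set.indicator_of_notMem (by simpa using h), h2 (not_le.1 h), norm_zero]

lemma integrable_indicator_closedBall (M R : ℝ) :
    Integrable ((Metric.closedBall (0 : ℂ) R).indicator fun _ => M) :=
  (integrableOn_const measure_closedBall_lt_top.ne).integrable_indicator measurableSet_closedBall

lemma IsBoundedCompact.integrable (hg : IsBoundedCompact M R g) : Integrable g :=
  (integrable_indicator_closedBall M R).mono' hg.meas hg.norm_le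

lemma IsBoundedCompact.integrable_near (hg : IsBoundedCompact M R g) (z : ℂ) :
    Integrable fun w => g w * invNear (z - w) :=
  (integrable_invNear.comp_sub_left z).bdd_mul hg.meas hg.bound

lemma IsBoundedCompact.integrable_far (hg : IsBoundedCompact M R g) (z : ℂ) :
    Integrable fun w => g w * invFar (z - w) :=
  hg.integrable.mul_bdd (c := 1) (measurable_invFar.comp (by fun_prop)).aestronglyMeasurable
    (Eventually.of_forall fun w => norm_invFar_le _)

lemma IsBoundedCompact.integrable_kernel (hg : IsBoundedCompact M R g) (z : ℂ) :
    Integrable fun w => g w * (z - w)⁻¹ := by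
  have := (hg.integrable_near z).add (hg.integrable_far z)
  refine this.congr (Eventually.of_forall fun w => ?_)
  simp only [Pi.add_apply]
  rw [← mul_add, invNear_add_invFar]

/-- The singular part of the kernel is in L¹ and meets the bounded `g`; the far part is bounded by
`1` and meets the integrable `g`. -/
lemma IsBoundedCompact.exists_norm_cauchyTransform_le (hg : IsBoundedCompact M R g) :
    ∃ A, 0 ≤ A ∧ ∀ z, ‖cauchyTransform g z‖ ≤ A := by
  refine ⟨M * (∫ w, ‖invNear w‖) + ∫ w, (Metric.closedBall (0 : ℂ) R).indicator (fun _ => M) w,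
    ?_, fun z => ?_⟩
  · have := hg.nonneg
    have h1 : 0 ≤ ∫ w, ‖invNear w‖ := integral_nonneg fun w => norm_nonneg _
    have h2 : 0 ≤ ∫ w, (Metric.closedBall (0 : ℂ) R).indicator (fun _ => M) w :=
      integral_nonneg fun w => Set.indicator_nonneg (fun _ _ => this) w
    positivity
  · have hN : Integrable fun w => M * ‖invNear (z - w)‖ :=
      (integrable_invNear.comp_sub_left z).norm.const_mul M
    have e : ∫ w, ‖invNear (z - w)‖ = ∫ w, ‖invNear w‖ :=
      integral_sub_left_eq_self (fun w => ‖invNear w‖) volume z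
    rw [← e, ← integral_const_mul, ← integral_add hN (integrable_indicator_closedBall M R)]
    refine norm_integral_le_of_norm_le (hN.add (integrable_indicator_closedBall M R)) ?_
    filter_upwards [hg.bound, hg.norm_le] with w h1 h2
    rw [← invNear_add_invFar, mul_add]
    refine (norm_add_le _ _).trans ?_
    rw [norm_mul, norm_mul]
    gcongr
    calc ‖g w‖ * ‖invFar (z - w)‖ ≤ ‖g w‖ * 1 := by gcongr; exact norm_invFar_le _
      _ ≤ _ := by rw [mul_one]; exact h2

lemma IsBoundedCompact.aestronglyMeasurable_kernel (hg : IsBoundedCompact M R g) :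
    AEStronglyMeasurable (fun p : ℂ × ℂ => g p.2 * (p.1 - p.2)⁻¹) (volume.prod volume) :=
  hg.meas.convolution_integrand (ContinuousLinearMap.mul ℝ ℂ)
    measurable_inv.aestronglyMeasurable

lemma IsBoundedCompact.aestronglyMeasurable_cauchyTransform (hg : IsBoundedCompact M R g) :
    AEStronglyMeasurable (cauchyTransform g) :=
  hg.aestronglyMeasurable_kernel.integral_prod_right'

/-- By the zero mean, `z⁻¹` can be subtracted from the kernel, and `(z - w)⁻¹ - z⁻¹ = w / ((z - w)
z)` is of order `|z|⁻²` for `|w| ≤ R`. Without this gain the decay would be `|z|⁻¹`, not square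
integrable at infinity. -/
lemma IsBoundedCompact.norm_cauchyTransform_le_far (hg : IsBoundedCompact M R g)
    (hmean : ∫ w, g w = 0) {z : ℂ} (hz : 2 * R ≤ ‖z‖) :
    ‖cauchyTransform g z‖ ≤
      (∫ w, (Metric.closedBall (0 : ℂ) R).indicator (fun _ => M) w) * (2 * R) / ‖z‖ ^ 2 := by
  have hR := hg.one_le
  have hz0 : 0 < ‖z‖ := by linarith
  have hz1 : z ≠ 0 := norm_pos_iff.1 hz0
  have e : cauchyTransform g z = ∫ w, g w * ((z - w)⁻¹ - z⁻¹) := by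
    simp_rw [mul_sub]
    rw [integral_sub (hg.integrable_kernel z) (hg.integrable.mul_const _), integral_mul_const,
      hmean, zero_mul, sub_zero, cauchyTransform]
  rw [e, mul_div_assoc, ← integral_mul_const]
  refine norm_integral_le_of_norm_le ((integrable_indicator_closedBall M R).mul_const _) ?_
  filter_upwards [hg.norm_le] with w hw
  by_cases h : ‖w‖ ≤ R
  · rw [norm_mul]
    have h1 : ‖z‖ / 2 ≤ ‖z - w‖ := by
      have := norm_sub_norm_le z w
      linarith
    have hzw : z - w ≠ 0 := norm_pos_iff.1 (by linarith)
    have h2 : ‖(z - w)⁻¹ - z⁻¹‖ ≤ 2 * R / ‖z‖ ^ 2 := by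
      have : (z - w)⁻¹ - z⁻¹ = w / ((z - w) * z) := by
        field_simp
        ring
      rw [this, norm_div, norm_mul]
      calc ‖w‖ / (‖z - w‖ * ‖z‖) ≤ R / (‖z‖ / 2 * ‖z‖) := by gcongr
        _ = _ := by field_simp
    gcongr
    exact (norm_nonneg _).trans hw
  · rw [Set.indicator_of_notMem (by simpa using h)] at hw ⊢
    have : g w = 0 := norm_le_zero_iff.1 hw
    simp [this]

lemma IsBoundedCompact.exists_norm_cauchyTransform_le_pow (hg : IsBoundedCompact M R g)
    (hmean : ∫ w, g w = 0) :
    ∃ B, ∀ z, ‖cauchyTransform g z‖ ≤ B / (1 + ‖z‖) ^ 2 := by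
  obtain ⟨A, hA0, hA⟩ := hg.exists_norm_cauchyTransform_le
  set V := ∫ w, (Metric.closedBall (0 : ℂ) R).indicator (fun _ => M) w with hV
  have hV0 : 0 ≤ V := integral_nonneg fun w => Set.indicator_nonneg (fun _ _ => hg.nonneg) w
  have hR := hg.one_le
  refine ⟨4 * (V * (2 * R)) + A * (1 + 2 * R) ^ 2, fun z => ?_⟩
  rw [le_div_iff₀ (by positivity)]
  rcases le_total (2 * R) ‖z‖ with h | h
  · have h1 := hg.norm_cauchyTransform_le_far hmean h
    have h2 : (1 + ‖z‖) ^ 2 ≤ 4 * ‖z‖ ^ 2 := by nlinarith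
    have hz0 : 0 < ‖z‖ := by linarith
    calc ‖cauchyTransform g z‖ * (1 + ‖z‖) ^ 2
        ≤ V * (2 * R) / ‖z‖ ^ 2 * (4 * ‖z‖ ^ 2) := by gcongr
      _ = 4 * (V * (2 * R)) := by field_simp
      _ ≤ _ := by
        have : 0 ≤ A * (1 + 2 * R) ^ 2 := by positivity
        linarith
  · calc ‖cauchyTransform g z‖ * (1 + ‖z‖) ^ 2 ≤ A * (1 + 2 * R) ^ 2 := by
          gcongr
          exact hA z
      _ ≤ _ := by
        have : 0 ≤ 4 * (V * (2 * R)) := by positivity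
        linarith

lemma IsBoundedCompact.memLp_cauchyTransform (hg : IsBoundedCompact M R g)
    (hmean : ∫ w, g w = 0) : MemLp (cauchyTransform g) 2 := by
  obtain ⟨B, hB⟩ := hg.exists_norm_cauchyTransform_le_pow hmean
  rw [memLp_two_iff_integrable_sq_norm hg.aestronglyMeasurable_cauchyTransform]
  have h1 : Integrable fun z : ℂ => (1 + ‖z‖) ^ (-(4 : ℝ)) := integrable_one_add_norm (by
    rw [Complex.finrank_real_complex]; norm_num)
  refine (h1.const_mul (B ^ 2)).mono' (hg.aestronglyMeasurable_cauchyTransform.norm.pow 2)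
    (Eventually.of_forall fun z => ?_)
  rw [Real.norm_of_nonneg (by positivity), Real.rpow_neg (by positivity)]
  have e : (1 + ‖z‖) ^ (4 : ℝ) = ((1 + ‖z‖) ^ 2) ^ 2 := by
    rw [← pow_mul]
    exact_mod_cast Real.rpow_natCast (1 + ‖z‖) 4
  rw [e, ← div_eq_mul_inv, ← div_pow]
  gcongr
  exact hB z

lemma IsBoundedCompact.tendsto_cauchyTransform (hg : IsBoundedCompact M R g)
    (hmean : ∫ w, g w = 0) : Tendsto (cauchyTransform g) (Bornology.cobounded ℂ) (𝓝 0) := by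
  obtain ⟨B, hB⟩ := hg.exists_norm_cauchyTransform_le_pow hmean
  refine squeeze_zero_norm hB ?_
  have h1 : Tendsto (fun z : ℂ => (1 + ‖z‖) ^ 2) (Bornology.cobounded ℂ) atTop :=
    (tendsto_pow_atTop two_ne_zero).comp
      (tendsto_atTop_add_const_left _ 1 tendsto_norm_cobounded_atTop)
  exact h1.const_div_atTop B

/-- Justifies Fubini in the next lemma: the near part is an L¹ convolution integrand times a bounded
function, the far part an integrable product times a bounded kernel. -/
lemma IsBoundedCompact.integrable_prod (hg : IsBoundedCompact M R g) {ψ : ℂ → ℂ}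
    (hψ : Continuous ψ) (hc : HasCompactSupport ψ) :
    Integrable (fun p : ℂ × ℂ => g p.2 * (p.1 - p.2)⁻¹ * ψ p.1) (volume.prod volume) := by
  obtain ⟨P, hP⟩ := hc.exists_bound_of_continuous hψ
  have h1 : Integrable (fun p : ℂ × ℂ => g p.2 * invNear (p.1 - p.2)) (volume.prod volume) :=
    hg.integrable.convolution_integrand (ContinuousLinearMap.mul ℝ ℂ) integrable_invNear
  have h2 : Integrable (fun p : ℂ × ℂ => g p.2 * invNear (p.1 - p.2) * ψ p.1)
      (volume.prod volume) :=
    h1.mul_bdd (hψ.comp continuous_fst).aestronglyMeasurable (Eventually.of_forall fun p => hP _)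
  have h3 : Integrable (fun p : ℂ × ℂ => ψ p.1 * g p.2 * invFar (p.1 - p.2))
      (volume.prod volume) :=
    ((hψ.integrable_of_hasCompactSupport hc).mul_prod hg.integrable).mul_bdd
      (measurable_invFar.comp (by fun_prop)).aestronglyMeasurable
      (Eventually.of_forall fun p => norm_invFar_le _)
  refine (h2.add h3).congr (Eventually.of_forall fun p => ?_)
  simp only [Pi.add_apply]
  rw [← invNear_add_invFar]
  ring

/-- `dbar (g ⋆ 1/z) = 2π g`, in the sense of distributions. -/
lemma IsBoundedCompact.integral_cauchyTransform_mul_dbar (hg : IsBoundedCompact M R g)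
    {φ : ℂ → ℂ} (hφ : ContDiff ℝ 1 φ) (hc : HasCompactSupport φ) :
    ∫ z, cauchyTransform g z * dbar φ z = -(2 * Real.pi * ∫ w, g w * φ w) := by
  have hd := continuous_dbar hφ
  have hdc := hasCompactSupport_dbar hc
  have e1 : ∀ z, cauchyTransform g z * dbar φ z = ∫ w, g w * (z - w)⁻¹ * dbar φ z := by
    intro z
    rw [cauchyTransform, integral_mul_const]
  simp_rw [e1]
  rw [integral_integral_swap (hg.integrable_prod hd hdc), ← integral_const_mul, ← integral_neg]
  congr 1
  ext w
  have hs : ContDiff ℝ 1 fun z => φ (z + w) := hφ.comp (by fun_prop)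
  have hsc : HasCompactSupport fun z => φ (z + w) :=
    hc.comp_homeomorph (Homeomorph.addRight w)
  have h := integral_inv_mul_dbar hs hsc
    (integrable_inv_mul (continuous_dbar hs) (hasCompactSupport_dbar hsc))
  have e2 : ∀ z, dbar (fun z => φ (z + w)) z = dbar φ (z + w) := by
    intro z
    simp only [dbar, fderiv_comp_add_right]
  simp_rw [e2, zero_add] at h
  have e3 : ∫ z, (z - w)⁻¹ * dbar φ z = ∫ z, z⁻¹ * dbar φ (z + w) := by
    rw [← integral_add_right_eq_self (fun z => (z - w)⁻¹ * dbar φ z) w]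
    simp
  simp_rw [mul_assoc]
  rw [integral_const_mul, e3, h]
  ring

end Cauchy

/-! ### The Biot–Savart field as a Cauchy transform -/

section BiotSavart

open Complex

variable {ω : Plane → ℝ}

/-- The exceptional set is null near each of its points, hence null, the plane being second
countable. -/
lemma ae_eq_zero_of_notMem_essSupport (ω : Plane → ℝ) :
    ∀ᵐ x, x ∉ essSupport ω → ω x = 0 := by
  rw [ae_iff]
  refine measure_null_of_locally_null _ fun x hx => ?_
  have hx : ¬ (x ∉ essSupport ω → ω x = 0) := hx
  push Not at hx
  have h := hx.1
  simp only [essSupport, Set.mem_ofPred_eq] at h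
  push Not at h
  obtain ⟨U, hU, hUz⟩ := h
  obtain ⟨V, hVU, hV, hxV⟩ := mem_nhds_iff.1 hU
  refine ⟨{x | ¬ (x ∉ essSupport ω → ω x = 0)} ∩ V,
    inter_mem_nhdsWithin _ (hV.mem_nhds hxV), ?_⟩
  have hVz : ∀ᵐ y ∂(volume.restrict V), ω y = 0 :=
    ae_restrict_of_ae_restrict_of_subset hVU hUz
  rw [ae_restrict_iff' hV.measurableSet, ae_iff] at hVz
  refine measure_mono_null ?_ hVz
  rintro y ⟨hy, hyV⟩ h
  exact hy fun _ => h hyV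

lemma exists_ae_norm_le (h : MemLp ω ⊤) : ∃ M, 0 ≤ M ∧ ∀ᵐ x, ‖ω x‖ ≤ M := by
  refine ⟨(eLpNormEssSup ω volume).toReal, ENNReal.toReal_nonneg, ?_⟩
  have hlt : eLpNormEssSup ω volume < ⊤ := by
    rw [← eLpNorm_exponent_top]; exact h.2
  filter_upwards [ae_le_eLpNormEssSup (f := ω) (μ := volume)] with x hx
  rw [← toReal_enorm]
  exact ENNReal.toReal_mono hlt.ne hx

/-- The vorticity as a function of a complex variable. -/
def complexVorticity (ω : Plane → ℝ) (z : ℂ) : ℂ := (ω (planeEquiv z) : ℝ)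

lemma IsLinftyC.isBoundedCompact {O : Set Plane} (h : IsLinftyC O ω) :
    ∃ M R, IsBoundedCompact M R (complexVorticity ω) := by
  obtain ⟨M, hM0, hM⟩ := exists_ae_norm_le h.memLp
  obtain ⟨R, hR⟩ := h.isCompact_support.isBounded.subset_closedBall (0 : Plane)
  have hq := measurePreserving_planeEquiv.quasiMeasurePreserving
  refine ⟨M, max R 1, ?_, hM0, le_max_right _ _, ?_, ?_⟩
  · exact Complex.continuous_ofReal.comp_aestronglyMeasurable
      (h.memLp.aestronglyMeasurable.comp_measurePreserving measurePreserving_planeEquiv)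
  · filter_upwards [hq.ae hM] with z hz
    simpa [complexVorticity] using hz
  · filter_upwards [hq.ae (ae_eq_zero_of_notMem_essSupport ω)] with z hz hzR
    have : planeEquiv z ∉ essSupport ω := by
      intro h'
      have := hR h'
      simp at this
      linarith [le_max_left R 1]
    simp [complexVorticity, hz this]

lemma integral_complexVorticity (h : ∫ x, ω x = 0) : ∫ z, complexVorticity ω z = 0 := by
  simp only [complexVorticity]
  rw [integral_complex_ofReal, integral_comp_planeEquiv, h, ofReal_zero]

/-- The complex velocity of `z^⊥` is `-i conj z`, and `conj z / |z|² = 1/z`. -/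
lemma conjEquiv_bsKernel (z : ℂ) :
    conjEquiv (bsKernel (planeEquiv z)) = -I / (2 * Real.pi) * z⁻¹ := by
  rw [bsKernel, map_smul, conjEquiv_apply, planeEquiv.norm_map, Complex.inv_def,
    normSq_eq_norm_sq, real_smul]
  have hpi : (Real.pi : ℂ) ≠ 0 := by exact_mod_cast Real.pi_ne_zero
  simp only [perp_apply_zero, perp_apply_one, planeEquiv_apply_zero, planeEquiv_apply_one]
  have : (starRingEnd ℂ) z = z.re - z.im * I := by
    apply Complex.ext <;> simp
  rw [this]
  push_cast
  rw [mul_inv, mul_inv]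
  field_simp
  linear_combination (-(z.im : ℂ) * (‖z‖ : ℂ)⁻¹ ^ 2) * I_sq

lemma conjEquiv_integrand (ω : Plane → ℝ) (z w : ℂ) :
    conjEquiv (ω (planeEquiv w) • bsKernel (planeEquiv z - planeEquiv w)) =
      -I / (2 * Real.pi) * (complexVorticity ω w * (z - w)⁻¹) := by
  rw [map_smul, ← map_sub, conjEquiv_bsKernel, real_smul, complexVorticity]
  ring

lemma complexVelocity_biotSavart (ω : Plane → ℝ) (z : ℂ) :
    complexVelocity (biotSavart ω) z =
      -I / (2 * Real.pi) * cauchyTransform (complexVorticity ω) z := by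
  rw [complexVelocity, biotSavart, convolution_def,
    ← integral_comp_planeEquiv, cauchyTransform, ← integral_const_mul]
  refine (conjEquiv.toContinuousLinearEquiv.integral_comp_comm _).symm.trans ?_
  congr 1
  ext w
  exact conjEquiv_integrand ω z w

lemma IsLinftyC.convolutionExists {O : Set Plane} (h : IsLinftyC O ω) :
    ConvolutionExists ω bsKernel (ContinuousLinearMap.lsmul ℝ ℝ) volume := by
  obtain ⟨M, R, hb⟩ := h.isBoundedCompact
  intro x
  rw [ConvolutionExistsAt, ← measurePreserving_planeEquiv.integrable_comp_emb
    planeEquiv.toHomeomorph.measurableEmbedding,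
    ← conjEquiv.toContinuousLinearEquiv.integrable_comp_iff]
  have := (hb.integrable_kernel (planeEquiv.symm x)).const_mul (-I / (2 * Real.pi))
  refine this.congr (Eventually.of_forall fun w => ?_)
  have e := conjEquiv_integrand ω (planeEquiv.symm x) w
  rw [planeEquiv.apply_symm_apply] at e
  exact e.symm

lemma IsLinftyC.memLp_biotSavart {O : Set Plane} (h : IsLinftyC O ω) (hmean : ∫ x, ω x = 0) :
    MemLp (biotSavart ω) 2 := by
  obtain ⟨M, R, hb⟩ := h.isBoundedCompact
  apply memLp_of_complexVelocity
  rw [funext (complexVelocity_biotSavart ω)]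
  exact (hb.memLp_cauchyTransform (integral_complexVorticity hmean)).const_mul _

lemma IsLinftyC.tendsto_biotSavart {O : Set Plane} (h : IsLinftyC O ω) (hmean : ∫ x, ω x = 0) :
    Tendsto (biotSavart ω) (Bornology.cobounded Plane) (𝓝 0) := by
  obtain ⟨M, R, hb⟩ := h.isBoundedCompact
  have h1 := (hb.tendsto_cauchyTransform (integral_complexVorticity hmean)).const_mul
    (-I / (2 * Real.pi))
  simp_rw [← complexVelocity_biotSavart, mul_zero] at h1
  have hsymm : Tendsto planeEquiv.symm (Bornology.cobounded Plane) (Bornology.cobounded ℂ) := by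
    rw [← tendsto_norm_atTop_iff_cobounded]
    simpa using tendsto_norm_cobounded_atTop (E := Plane)
  have h2 := (conjEquiv.symm.continuous.tendsto 0).comp (h1.comp hsymm)
  rw [map_zero] at h2
  refine h2.congr fun x => ?_
  simp [complexVelocity]

/-- Both identities are components of the `dbar` equation for the Cauchy transform: its right-hand
side `i ∫ ω φ` is purely imaginary. -/
lemma IsLinftyC.integral_biotSavart {O O' : Set Plane} (h : IsLinftyC O ω) (hmean : ∫ x, ω x = 0)
    {φ : Plane → ℝ} (hφ : IsTest O' φ) :
    ∫ x, inner ℝ (biotSavart ω x) (gradient φ x) = 0 ∧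
      ∫ x, inner ℝ (biotSavart ω x) (perp (gradient φ x)) = - ∫ x, ω x * φ x := by
  obtain ⟨M, R, hb⟩ := h.isBoundedCompact
  have e := integral_complexVelocity_mul_dbar
    ((h.memLp_biotSavart hmean).locallyIntegrable (by norm_num)) hφ
  simp_rw [complexVelocity_biotSavart, mul_assoc] at e
  have hφ1 : ContDiff ℝ 1 fun z => ((φ (planeEquiv z) : ℝ) : ℂ) :=
    Complex.ofRealCLM.contDiff.comp ((hφ.smooth.of_le (by exact_mod_cast le_top)).comp
      planeEquiv.contDiff)
  have hφc : HasCompactSupport fun z => ((φ (planeEquiv z) : ℝ) : ℂ) :=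
    (hφ.compact.comp_homeomorph planeEquiv.toHomeomorph).comp_left (g := fun x : ℝ => (x : ℂ)) rfl
  have e2 : ∫ w, complexVorticity ω w * ((φ (planeEquiv w) : ℝ) : ℂ) =
      ((∫ x, ω x * φ x : ℝ) : ℂ) := by
    rw [← integral_complex_ofReal, ← integral_comp_planeEquiv]
    simp [complexVorticity]
  rw [integral_const_mul, hb.integral_cauchyTransform_mul_dbar hφ1 hφc, e2] at e
  have hpi : (Real.pi : ℂ) ≠ 0 := by exact_mod_cast Real.pi_ne_zero
  have e3 : -I / (2 * Real.pi) * -(2 * Real.pi * ((∫ x, ω x * φ x : ℝ) : ℂ)) =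
      I * ((∫ x, ω x * φ x : ℝ) : ℂ) := by
    field_simp
  rw [e3] at e
  generalize ∫ x, inner ℝ (biotSavart ω x) (gradient φ x) = a at *
  generalize ∫ x, inner ℝ (biotSavart ω x) (perp (gradient φ x)) = b at *
  generalize ∫ x, ω x * φ x = c at *
  have hre := congrArg Complex.re e
  have him := congrArg Complex.im e
  simp at hre him
  exact ⟨hre.symm, by linarith⟩

end BiotSavart

/-! ### L² pairings and orthogonality of gradients and rotated gradients -/

section L2

variable {μ : Measure Plane} {f g : Plane → Plane}

lemma inner_toLp (hf : MemLp f 2 μ) (hg : MemLp g 2 μ) :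
    inner ℝ (hf.toLp f) (hg.toLp g) = ∫ x, inner ℝ (f x) (g x) ∂μ := by
  rw [L2.inner_def]
  refine integral_congr_ae ?_
  filter_upwards [hf.coeFn_toLp, hg.coeFn_toLp] with x h1 h2
  rw [h1, h2]

lemma integrable_inner_of_memLp (hf : MemLp f 2 μ) (hg : MemLp g 2 μ) :
    Integrable (fun x => inner ℝ (f x) (g x)) μ := by
  refine (L2.integrable_inner (𝕜 := ℝ) (hf.toLp f) (hg.toLp g)).congr ?_
  filter_upwards [hf.coeFn_toLp, hg.coeFn_toLp] with x h1 h2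
  rw [h1, h2]

lemma integral_inner_add (f' : Plane → Plane) (hf : MemLp f 2 μ) (hf' : MemLp f' 2 μ)
    (hg : MemLp g 2 μ) : ∫ x, inner ℝ (f x + f' x) (g x) ∂μ =
      ∫ x, inner ℝ (f x) (g x) ∂μ + ∫ x, inner ℝ (f' x) (g x) ∂μ := by
  simp_rw [inner_add_left]
  exact integral_add (integrable_inner_of_memLp hf hg) (integrable_inner_of_memLp hf' hg)

lemma integral_inner_sub (f' : Plane → Plane) (hf : MemLp f 2 μ) (hf' : MemLp f' 2 μ)
    (hg : MemLp g 2 μ) : ∫ x, inner ℝ (f x - f' x) (g x) ∂μ =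
      ∫ x, inner ℝ (f x) (g x) ∂μ - ∫ x, inner ℝ (f' x) (g x) ∂μ := by
  simp_rw [inner_sub_left]
  exact integral_sub (integrable_inner_of_memLp hf hg) (integrable_inner_of_memLp hf' hg)

variable {O : Set Plane} {φ χ : Plane → ℝ}

lemma IsTest.memLp_gradient (h : IsTest O φ) (μ : Measure Plane) [IsFiniteMeasureOnCompacts μ] :
    MemLp (gradient φ) 2 μ :=
  h.continuous_gradient.memLp_of_hasCompactSupport h.hasCompactSupport_gradient

lemma IsTest.memLp_perp_gradient (h : IsTest O φ) (μ : Measure Plane)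
    [IsFiniteMeasureOnCompacts μ] : MemLp (fun x => perp (gradient φ x)) 2 μ :=
  h.continuous_perp_gradient.memLp_of_hasCompactSupport h.hasCompactSupport_perp_gradient

/-- Gradients and rotated gradients are orthogonal. -/
lemma integral_gradient_perp_gradient {O' : Set Plane} (hφ : IsTest O φ) (hχ : IsTest O' χ) :
    ∫ x, inner ℝ (gradient φ x) (perp (gradient χ x)) = 0 := by
  have hφd : Continuous (fderiv ℝ φ) := hφ.smooth.continuous_fderiv (by simp)
  have hχd : Continuous (fderiv ℝ χ) := hχ.smooth.continuous_fderiv (by simp)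
  have hχ1 : ContDiff ℝ ((⊤ : ℕ∞) : WithTop ℕ∞) (fderiv ℝ χ) :=
    hχ.smooth.fderiv_right (by simp)
  have hχ1d : Differentiable ℝ (fderiv ℝ χ) := hχ1.differentiable (by simp)
  have hχ2 : Continuous (fderiv ℝ (fderiv ℝ χ)) := hχ1.continuous_fderiv (by simp)
  have d2 : ∀ v w x, fderiv ℝ (fun x => fderiv ℝ χ x v) x w = fderiv ℝ (fderiv ℝ χ) x w v := by
    intro v w x
    rw [fderiv_clm_apply (hχ1d x) (differentiableAt_const v)]
    simp
  have ibp : ∀ v w : Plane, ∫ x, fderiv ℝ χ x v * fderiv ℝ φ x w =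
      -∫ x, fderiv ℝ (fderiv ℝ χ) x w v * φ x := by
    intro v w
    simp_rw [← d2]
    refine integral_mul_fderiv_eq_neg_fderiv_mul_of_integrable ?_ ?_ ?_ ?_ ?_
    · simp_rw [d2]
      have : Continuous fun x => fderiv ℝ (fderiv ℝ χ) x w v * φ x := by
        have := hφ.smooth.continuous
        fun_prop
      exact this.integrable_of_hasCompactSupport hφ.compact.mul_left
    · have : Continuous fun x => fderiv ℝ χ x v * fderiv ℝ φ x w := by fun_prop
      exact this.integrable_of_hasCompactSupport ((hφ.compact.fderiv (𝕜 := ℝ)).comp_left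
        (g := fun L : Plane →L[ℝ] ℝ => L w) rfl).mul_left
    · have : Continuous fun x => fderiv ℝ χ x v * φ x := by
        have := hφ.smooth.continuous
        fun_prop
      exact this.integrable_of_hasCompactSupport hφ.compact.mul_left
    · exact fun x _ => (hχ1d x).clm_apply (differentiableAt_const v)
    · exact fun x _ => hφ.differentiable x
  have ci : ∀ v w : Plane, Integrable fun x => fderiv ℝ χ x v * fderiv ℝ φ x w := fun v w => by
    have : Continuous fun x => fderiv ℝ χ x v * fderiv ℝ φ x w := by fun_prop
    exact this.integrable_of_hasCompactSupport ((hφ.compact.fderiv (𝕜 := ℝ)).comp_left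
      (g := fun L : Plane →L[ℝ] ℝ => L w) rfl).mul_left
  have e : ∀ x, inner ℝ (gradient φ x) (perp (gradient χ x)) =
      fderiv ℝ χ x (planeEquiv 1) * fderiv ℝ φ x (planeEquiv Complex.I) -
        fderiv ℝ χ x (planeEquiv Complex.I) * fderiv ℝ φ x (planeEquiv 1) := by
    intro x
    rw [inner_plane, perp_apply_zero, perp_apply_one, gradient_apply_zero, gradient_apply_one,
      gradient_apply_zero, gradient_apply_one]
    ring
  simp_rw [e]
  rw [integral_sub (ci _ _) (ci _ _), ibp, ibp]
  -- After integration by parts both terms carry mixed second derivatives of `χ`, which coincide.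
  have hsymm : ∀ x, fderiv ℝ (fderiv ℝ χ) x (planeEquiv Complex.I) (planeEquiv 1) =
      fderiv ℝ (fderiv ℝ χ) x (planeEquiv 1) (planeEquiv Complex.I) := fun x =>
    ((contDiff_infty.1 hχ.smooth 2).contDiffAt.isSymmSndFDerivAt
      (by simp)).eq _ _
  simp_rw [hsymm, sub_self]

lemma integral_eq_setIntegral_fluid {ε : ℝ} {h : Plane → ℝ}
    (hh : ∀ x ∈ Metric.closedBall (0 : Plane) ε, h x = 0) :
    ∫ x in fluid ε, h x = ∫ x, h x := by
  refine setIntegral_eq_integral_of_forall_compl_eq_zero fun x hx => hh x ?_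
  simpa [fluid] using hx

lemma setIntegral_fluid_eq_sub {ε : ℝ} {h : Plane → ℝ} (hi : Integrable h) :
    ∫ x in fluid ε, h x = (∫ x, h x) - ∫ x in Metric.closedBall (0 : Plane) ε, h x := by
  have := integral_add_compl (measurableSet_closedBall (x := (0 : Plane)) (ε := ε)) hi
  rw [fluid]
  linarith

lemma IsTest.gradient_eq_zero_of_fluid {ε : ℝ} (hφ : IsTest (fluid ε) φ) :
    ∀ x ∈ Metric.closedBall (0 : Plane) ε, gradient φ x = 0 := fun _ hx =>
  gradient_of_notMem_tsupport fun h => hφ.support_subset h hx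

lemma IsTest.eq_zero_of_fluid {ε : ℝ} (hφ : IsTest (fluid ε) φ) :
    ∀ x ∈ Metric.closedBall (0 : Plane) ε, φ x = 0 := fun _ hx =>
  image_eq_zero_of_notMem_tsupport fun h => hφ.support_subset h hx

end L2

/-! ### The divergence theorem on the disk in real form -/

section Boundary

open Complex

/-- The divergence theorem on the disk for a constant field. -/
lemma setIntegral_closedBall_inner_gradient {ε : ℝ} (hε : 0 < ε) (ℓ : Plane) {O : Set Plane}
    {φ : Plane → ℝ} (hφ : IsTest O φ) :
    ∫ x in Metric.closedBall (0 : Plane) ε, inner ℝ ℓ (gradient φ x) =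
      -circleInt ε (fun x => inner ℝ ℓ (normal ε x) * φ x) := by
  have hφ1 : ContDiff ℝ 1 fun z => ((φ (planeEquiv z) : ℝ) : ℂ) :=
    Complex.ofRealCLM.contDiff.comp ((hφ.smooth.of_le (by exact_mod_cast le_top)).comp
      planeEquiv.contDiff)
  have h := integral_closedBall_dbar hφ1 hε
  have hpre : planeEquiv ⁻¹' Metric.closedBall (0 : Plane) ε = Metric.closedBall (0 : ℂ) ε := by
    ext z; simp
  -- A constant field has constant complex velocity, so its pairing is the real part of `conjEquiv
  -- ℓ` times the integral of `dbar φ`. The final minus sign arises because `normal` points into the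
  -- disk.
  have e1 : ∫ x in Metric.closedBall (0 : Plane) ε, inner ℝ ℓ (gradient φ x) =
      (∫ z in Metric.closedBall (0 : ℂ) ε,
        conjEquiv ℓ * dbar (fun z => ((φ (planeEquiv z) : ℝ) : ℂ)) z).re := by
    have hi : IntegrableOn (fun z => conjEquiv ℓ * dbar (fun z => ((φ (planeEquiv z) : ℝ) : ℂ)) z)
        (Metric.closedBall (0 : ℂ) ε) :=
      (continuous_const.mul (continuous_dbar hφ1)).continuousOn.integrableOn_compact
        (isCompact_closedBall 0 ε)
    have h2 := Complex.reCLM.integral_comp_comm hi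
    simp only [Complex.reCLM_apply] at h2
    rw [← h2, ← measurePreserving_planeEquiv.setIntegral_preimage_emb
      planeEquiv.toHomeomorph.measurableEmbedding, hpre]
    congr 1
    ext z
    have := complexVelocity_mul_dbar (fun _ => ℓ) hφ.differentiable z
    rw [complexVelocity] at this
    rw [this]
    simp only [sub_re, ofReal_re, mul_re, I_re, I_im, ofReal_im]
    ring
  rw [e1, integral_const_mul, h, ← intervalIntegral.integral_const_mul]
  have hcont : Continuous fun θ : ℝ => conjEquiv ℓ *
      (circleMap 0 ε θ * ((φ (planeEquiv (circleMap 0 ε θ)) : ℝ) : ℂ)) := by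
    have h1 := hφ1.continuous.comp (continuous_circleMap 0 ε)
    have h2 := continuous_circleMap 0 ε
    exact continuous_const.mul (h2.mul h1)
  have h3 := Complex.reCLM.intervalIntegral_comp_comm
    (hcont.intervalIntegrable (μ := volume) 0 (2 * Real.pi))
  simp only [Complex.reCLM_apply] at h3
  rw [← h3, circleInt, ← intervalIntegral.integral_neg]
  congr 1
  ext θ
  have e2 : planeEquiv (circleMap 0 ε θ) = !₂[ε * Real.cos θ, ε * Real.sin θ] := by
    ext i
    fin_cases i <;> simp [circleMap, Complex.exp_mul_I, planeEquiv] <;>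
      simp [← ofReal_cos, ← ofReal_sin]
  have e3 : circleMap 0 ε θ = ((ε * Real.cos θ : ℝ) : ℂ) + ((ε * Real.sin θ : ℝ) : ℂ) * I := by
    simp [circleMap, Complex.exp_mul_I]; ring
  rw [e2, conjEquiv_apply, e3, inner_plane, normal]
  simp
  field_simp
  rw [← ofReal_cos, ← ofReal_sin, ofReal_re, ofReal_re]
  ring

end Boundary

/-! ### A stream function for a constant velocity on a disk -/

section Lift

/-- A smooth compactly supported stream function whose rotated gradient is `ℓ` on a given disk. -/
lemma exists_stream (ℓ : Plane) (R : ℝ) : ∃ η : Plane → ℝ, IsTest Set.univ η ∧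
    ∀ x ∈ Metric.closedBall (0 : Plane) R, perp (gradient η x) = ℓ := by
  -- The plateau reaches beyond radius `R`, so the cutoff is `1` near each point of the closed disk
  -- and contributes no derivative. The linear factor uses `-perp ℓ` because `perp` squares to `-1`.
  obtain ⟨s, hs⟩ := exists_isPlateau ((|R| + 1) ^ 2)
  have hsm : ContDiff ℝ ((⊤ : ℕ∞) : WithTop ℕ∞) fun x : Plane => s (‖x‖ ^ 2) :=
    hs.smooth.comp (contDiff_norm_sq ℝ)
  have hlin : ContDiff ℝ ((⊤ : ℕ∞) : WithTop ℕ∞) fun x : Plane => inner ℝ (-perp ℓ) x :=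
    contDiff_const.inner ℝ contDiff_id
  refine ⟨fun x => inner ℝ (-perp ℓ) x * s (‖x‖ ^ 2), ⟨hlin.mul hsm, ?_, Set.subset_univ _⟩, ?_⟩
  · refine HasCompactSupport.of_support_subset_isCompact
      (isCompact_closedBall (0 : Plane) ((|R| + 1) ^ 2 + 1)) fun x hx => ?_
    by_contra h
    apply hx
    have : (|R| + 1) ^ 2 + 1 < ‖x‖ := by simpa using h
    have h2 : (|R| + 1) ^ 2 + 1 ≤ ‖x‖ ^ 2 := by nlinarith [sq_nonneg (|R| + 1)]
    simp [hs.eq_zero _ h2]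
  · intro x hx
    have hx : ‖x‖ ≤ R := by simpa using hx
    have hx2 : ‖x‖ < |R| + 1 := by linarith [le_abs_self R]
    have hev : (fun x : Plane => inner ℝ (-perp ℓ) x * s (‖x‖ ^ 2)) =ᶠ[𝓝 x]
        fun x => inner ℝ (-perp ℓ) x := by
      filter_upwards [continuous_norm.continuousAt.eventually_lt_const hx2] with y hy
      rw [hs.eq_one _ (by gcongr), mul_one]
    have hg : gradient (fun x : Plane => inner ℝ (-perp ℓ) x * s (‖x‖ ^ 2)) x = -perp ℓ := by
      rw [hev.gradient_eq]
      refine HasGradientAt.gradient ?_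
      rw [hasGradientAt_iff_hasFDerivAt]
      exact (InnerProductSpace.toDual ℝ Plane (-perp ℓ)).hasFDerivAt
    rw [hg]
    ext i
    fin_cases i <;> simp [perp]

end Lift

/-! ### The exterior problem: existence by projection, and uniqueness -/

section Existence

variable {ε : ℝ} {ω : Plane → ℝ} {O : Set Plane}

/-- The orthogonal projection of `v` onto the closure of the gradients in `L²(fluid ε)`. -/
lemma exists_gradient_projection (ε : ℝ) {v : Plane → Plane}
    (hv : MemLp v 2 (volume.restrict (fluid ε))) :
    ∃ p : Plane → Plane, MemLp p 2 (volume.restrict (fluid ε)) ∧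
      eLpNorm p 2 (volume.restrict (fluid ε)) ≤ eLpNorm v 2 (volume.restrict (fluid ε)) ∧
      (∀ φ, IsTest Set.univ φ → ∫ x in fluid ε, inner ℝ (p x) (gradient φ x) =
        ∫ x in fluid ε, inner ℝ (v x) (gradient φ x)) ∧
      ∀ χ, IsTest Set.univ χ →
        (∀ x ∈ Metric.closedBall (0 : Plane) ε, gradient χ x = 0) →
          ∫ x in fluid ε, inner ℝ (p x) (perp (gradient χ x)) = 0 := by
  set μ := volume.restrict (fluid ε)
  -- The potentials are unrestricted at the circle, so orthogonality to `S` encodes zero divergence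
  -- together with zero normal trace.
  let S : Set (Lp Plane 2 μ) :=
    {f | ∃ φ, ∃ h : IsTest Set.univ φ, f = (h.memLp_gradient μ).toLp (gradient φ)}
  let G := (Submodule.span ℝ S).topologicalClosure
  have : CompleteSpace G := Submodule.isClosed_topologicalClosure _ |>.completeSpace_coe
  let q : Lp Plane 2 μ := G.starProjection (hv.toLp v)
  have hq : MemLp q 2 μ := Lp.memLp q
  have hqq : hq.toLp q = q := Lp.toLp_coeFn q hq
  refine ⟨q, hq, ?_, fun φ hφ => ?_, fun χ hχ hχ0 => ?_⟩
  · have h := G.norm_starProjection_apply_le (hv.toLp v)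
    rw [Lp.norm_def, Lp.norm_def, ENNReal.toReal_le_toReal (Lp.eLpNorm_ne_top _)
      (Lp.eLpNorm_ne_top _), eLpNorm_congr_ae hv.coeFn_toLp] at h
    exact h
  · have hg := hφ.memLp_gradient μ
    have hm : hg.toLp (gradient φ) ∈ G :=
      Submodule.le_topologicalClosure _ (Submodule.subset_span ⟨φ, hφ, rfl⟩)
    have h := G.starProjection_inner_eq_zero (hv.toLp v) _ hm
    rw [inner_sub_left, sub_eq_zero] at h
    rw [← inner_toLp hq hg, ← inner_toLp hv hg, hqq, h]
  · have hg := hχ.memLp_perp_gradient μ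
    -- Since `∇χ` vanishes on the disk, the pairing with a gradient is an integral over the whole
    -- plane, hence zero; orthogonality then passes to the closure.
    have hle : G ≤ (Submodule.span ℝ {hg.toLp fun x => perp (gradient χ x)})ᗮ := by
      refine Submodule.topologicalClosure_minimal _ ?_ (Submodule.isClosed_orthogonal _)
      rw [Submodule.span_le]
      rintro _ ⟨φ, hφ, rfl⟩
      rw [SetLike.mem_coe, Submodule.mem_orthogonal_singleton_iff_inner_left,
        inner_toLp (hφ.memLp_gradient μ) hg, integral_eq_setIntegral_fluid,
        integral_gradient_perp_gradient hφ hχ]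
      intro x hx
      rw [hχ0 x hx, show perp 0 = 0 from perpIsometry.map_zero, inner_zero_right]
    have h := hle (G.starProjection_apply_mem (hv.toLp v))
    rw [Submodule.mem_orthogonal_singleton_iff_inner_left] at h
    rw [← inner_toLp hq hg, hqq, h]

lemma IsLinftyC.integrable_mul (h : IsLinftyC O ω) {O' : Set Plane} {φ : Plane → ℝ}
    (hφ : IsTest O' φ) : Integrable fun x => ω x * φ x := by
  have := (h.memLp.locallyIntegrable le_top).integrable_smul_left_of_hasCompactSupport
    hφ.smooth.continuous hφ.compact
  simpa [mul_comm] using this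

/-- The support avoids only the open ball, but the remaining circle is a null set. -/
lemma setIntegral_fluid_mul (hd : Disjoint (essSupport ω) (Metric.ball 0 ε))
    (φ : Plane → ℝ) : ∫ x in fluid ε, ω x * φ x = ∫ x, ω x * φ x := by
  refine setIntegral_eq_integral_of_ae_compl_eq_zero ?_
  have hs : ∀ᵐ x : Plane, x ∉ Metric.sphere (0 : Plane) ε :=
    measure_eq_zero_iff_ae_notMem.1 (Measure.addHaar_sphere _ _ _)
  filter_upwards [hs, ae_eq_zero_of_notMem_essSupport ω] with x h1 h2 h3
  have h4 : ‖x‖ ≤ ε := by simpa [mem_fluid] using h3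
  have h5 : ‖x‖ ≠ ε := by simpa using h1
  rw [h2 fun h => Set.disjoint_left.1 hd h (by simpa using lt_of_le_of_ne h4 h5), zero_mul]

lemma perp_zero : perp 0 = 0 := perpIsometry.map_zero

/-- Existence for the exterior problem, with a bound uniform in the radius of the disk. -/
lemma exists_isExteriorSolution (h : IsLinftyC O ω) (hmean : ∫ x, ω x = 0) (hε : 0 < ε)
    (hd : Disjoint (essSupport ω) (Metric.ball 0 ε)) {ℓ : Plane} {η : Plane → ℝ} {R : ℝ}
    (hη : IsTest Set.univ η) (hℓ : ∀ x ∈ Metric.closedBall (0 : Plane) R, perp (gradient η x) = ℓ)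
    (hR : ε ≤ R) :
    ∃ u, IsExteriorSolution ε ℓ ω u ∧ eLpNorm u 2 (volume.restrict (fluid ε)) ≤
      eLpNorm (biotSavart ω) 2 volume +
        eLpNorm (fun x => perp (gradient η x) - biotSavart ω x) 2 volume := by
  set μ := volume.restrict (fluid ε) with hμ
  set K := biotSavart ω
  have hK := h.memLp_biotSavart hmean
  have hKμ : MemLp K 2 μ := hK.restrict _
  have hL := hη.memLp_perp_gradient volume
  have hLμ := hη.memLp_perp_gradient μ
  have hv : MemLp (fun x => perp (gradient η x) - K x) 2 volume := hL.sub hK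
  obtain ⟨p, hp, hpn, hpg, hpp⟩ := exists_gradient_projection ε (hv.restrict (fluid ε))
  -- Against gradients `p` acts as `∇^⊥η - K`, so `K + p` acts as `∇^⊥η`. The plane integral of the
  -- latter vanishes, leaving minus the integral over the disk, where `∇^⊥η = ℓ`.
  have grad : ∀ φ, IsTest Set.univ φ → ∫ x in fluid ε, inner ℝ (K x + p x) (gradient φ x) =
      circleInt ε (fun x => inner ℝ ℓ (normal ε x) * φ x) := fun φ hφ => by
    have hφμ := hφ.memLp_gradient μ
    have e1 : ∫ x, inner ℝ (perp (gradient η x)) (gradient φ x) = 0 := by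
      simp_rw [real_inner_comm]
      exact integral_gradient_perp_gradient hφ hη
    have e2 : ∫ x in Metric.closedBall (0 : Plane) ε, inner ℝ (perp (gradient η x)) (gradient φ x) =
        ∫ x in Metric.closedBall (0 : Plane) ε, inner ℝ ℓ (gradient φ x) :=
      setIntegral_congr_fun measurableSet_closedBall fun x hx => by
        simp only [hℓ x (Metric.closedBall_subset_closedBall hR hx)]
    rw [integral_inner_add p hKμ hp hφμ, hpg φ hφ, integral_inner_sub K hLμ hKμ hφμ,
      add_sub_cancel, setIntegral_fluid_eq_sub
        (integrable_inner_of_memLp hL (hφ.memLp_gradient volume)), e1, e2,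
      setIntegral_closedBall_inner_gradient hε ℓ hφ]
    ring
  -- Requiring only `∇χ = 0` on the disk covers at once the test functions supported in the fluid
  -- (curl) and those equal to `1` around the disk (circulation).
  have curl : ∀ χ, IsTest Set.univ χ →
      (∀ x ∈ Metric.closedBall (0 : Plane) ε, gradient χ x = 0) →
        ∫ x in fluid ε, inner ℝ (K x + p x) (perp (gradient χ x)) =
          -∫ x in fluid ε, ω x * χ x := fun χ hχ hχ0 => by
    rw [integral_inner_add p hKμ hp (hχ.memLp_perp_gradient μ), hpp χ hχ hχ0, add_zero,
      integral_eq_setIntegral_fluid fun x hx => by rw [hχ0 x hx, perp_zero, inner_zero_right],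
      (h.integral_biotSavart hmean hχ).2, setIntegral_fluid_mul hd]
  have zero : ∀ φ, IsTest (fluid ε) φ →
      circleInt ε (fun x => inner ℝ ℓ (normal ε x) * φ x) = 0 := fun φ hφ => by
    rw [← neg_eq_zero, ← setIntegral_closedBall_inner_gradient hε ℓ hφ]
    refine setIntegral_eq_zero_of_forall_eq_zero fun x hx => ?_
    rw [hφ.gradient_eq_zero_of_fluid x hx, inner_zero_right]
  have hu : MemLp (fun x => K x + p x) 2 μ := hKμ.add hp
  refine ⟨fun x => K x + p x, ⟨hu, fun φ hφ => ?_, fun φ hφ => ?_, ?_, grad, fun φ hφ h1 => ?_⟩, ?_⟩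
  · rw [grad φ (hφ.mono (Set.subset_univ _)), zero φ hφ]
  · exact curl φ (hφ.mono (Set.subset_univ _)) hφ.gradient_eq_zero_of_fluid
  · have h1 : VanishesAtInfinity p := by
      refine vanishesAtInfinity_of_divFree_curlFree hp (fun φ hφ => ?_) fun φ hφ =>
        hpp φ (hφ.mono (Set.subset_univ _)) hφ.gradient_eq_zero_of_fluid
      have := grad φ (hφ.mono (Set.subset_univ _))
      rw [zero φ hφ, integral_inner_add p hKμ hp (hφ.memLp_gradient μ),
        integral_eq_setIntegral_fluid fun x hx => by
          rw [hφ.gradient_eq_zero_of_fluid x hx, inner_zero_right],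
        (h.integral_biotSavart hmean hφ).1, zero_add] at this
      exact this
    have h2 := ((h.tendsto_biotSavart hmean).mono_left inf_le_left).add h1
    rwa [zero_add] at h2
  · have h0 : ∀ x ∈ Metric.closedBall (0 : Plane) ε, gradient φ x = 0 := fun x hx => by
      have hev : φ =ᶠ[𝓝 x] fun _ => (1 : ℝ) := h1.filter_mono (nhds_le_nhdsSet hx)
      rw [hev.gradient_eq]
      simp [gradient]
    rw [integral_add (integrable_inner_of_memLp hu (hφ.memLp_perp_gradient μ))
      (h.integrable_mul hφ).restrict, curl φ hφ h0, neg_add_cancel, neg_zero]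
  · refine (eLpNorm_add_le hKμ.1 hp.1 (by norm_num)).trans ?_
    gcongr
    · exact Measure.restrict_le_self
    · exact hpn.trans (eLpNorm_mono_measure _ Measure.restrict_le_self)

/-- Uniqueness for the exterior problem. -/
lemma IsExteriorSolution.ae_eq (hε : 0 < ε) {ℓ : Plane} {u v : Plane → Plane}
    (hu : IsExteriorSolution ε ℓ ω u) (hv : IsExteriorSolution ε ℓ ω v) :
    v =ᵐ[volume.restrict (fluid ε)] u := by
  have := ae_eq_zero_of_divFree_curlFree hε.le (hv.memLp.sub hu.memLp)
    (fun φ hφ => ?_) (fun φ hφ => ?_)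
  · filter_upwards [this] with x hx
    exact sub_eq_zero.1 hx
  · simp only [Pi.sub_apply]
    rw [integral_inner_sub u hv.memLp hu.memLp (hφ.memLp_gradient _), hu.normalTrace φ hφ,
      hv.normalTrace φ hφ, sub_self]
  · simp only [Pi.sub_apply]
    rw [integral_inner_sub u hv.memLp hu.memLp (hφ.memLp_perp_gradient _), hu.hasCurl φ hφ,
      hv.hasCurl φ hφ, sub_self]

end Existence

/-! ### The problem in the whole plane -/

section WholePlane

variable {ω : Plane → ℝ} {O : Set Plane}

lemma IsLinftyC.isPlaneSolution (h : IsLinftyC O ω) (hmean : ∫ x, ω x = 0) :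
    IsPlaneSolution ω (biotSavart ω) where
  memLp := h.memLp_biotSavart hmean
  divFree φ hφ := by rw [setIntegral_univ, (h.integral_biotSavart hmean hφ).1]
  hasCurl φ hφ := by rw [setIntegral_univ, setIntegral_univ, (h.integral_biotSavart hmean hφ).2]
  vanishes := (h.tendsto_biotSavart hmean).mono_left inf_le_left

lemma fluid_zero : fluid 0 = ({0}ᶜ : Set Plane) := by simp [fluid]

lemma restrict_fluid_zero : (volume : Measure Plane).restrict (fluid 0) = volume := by
  rw [fluid_zero]
  exact Measure.restrict_eq_self_of_ae_mem (Measure.ae_ne volume 0)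

/-- The exterior uniqueness theorem at radius `0`, a point being null. Testing the curl only away
from the origin is what the weak limit needs. -/
lemma ae_eq_zero_of_divFree_curlFree_plane {w : Plane → Plane} (hw : MemLp w 2 volume)
    (hdiv : ∀ φ, IsTest Set.univ φ → ∫ x, inner ℝ (w x) (gradient φ x) = 0)
    (hcurl : ∀ φ, IsTest {0}ᶜ φ → ∫ x, inner ℝ (w x) (perp (gradient φ x)) = 0) :
    w =ᵐ[volume] 0 := by
  have := ae_eq_zero_of_divFree_curlFree (w := w) le_rfl
  rw [restrict_fluid_zero, fluid_zero] at this
  exact this hw hdiv hcurl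

/-- Uniqueness for the problem in the whole plane. -/
lemma IsPlaneSolution.ae_eq {u v : Plane → Plane} (hu : IsPlaneSolution ω u)
    (hv : IsPlaneSolution ω v) : v =ᵐ[volume] u := by
  have hu1 := hu.divFree
  have hu2 := hu.hasCurl
  have hv1 := hv.divFree
  have hv2 := hv.hasCurl
  simp only [DivFree, HasCurl, setIntegral_univ] at hu1 hu2 hv1 hv2
  have := ae_eq_zero_of_divFree_curlFree_plane (hv.memLp.sub hu.memLp)
    (fun φ hφ => ?_) (fun φ hφ => ?_)
  · filter_upwards [this] with x hx
    exact sub_eq_zero.1 hx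
  · simp only [Pi.sub_apply]
    rw [integral_inner_sub u hv.memLp hu.memLp (hφ.memLp_gradient _), hu1 φ hφ, hv1 φ hφ, sub_self]
  · simp only [Pi.sub_apply]
    have hφ' := hφ.mono (Set.subset_univ _)
    rw [integral_inner_sub u hv.memLp hu.memLp (hφ.memLp_perp_gradient _), hu2 φ hφ', hv2 φ hφ',
      sub_self]

end WholePlane

/-! ### Weak convergence as the disk shrinks -/

section WeakConvergence

/-- Weak convergence of a bounded family can be tested on a total set. -/
lemma tendsto_inner_of_total {H ι : Type*} [NormedAddCommGroup H] [InnerProductSpace ℝ H]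
    {l : Filter ι} {x : ι → H} {C : ℝ} (hC : ∀ᶠ i in l, ‖x i‖ ≤ C) {S : Set H}
    (hS : (Submodule.span ℝ S).topologicalClosure = ⊤)
    (h : ∀ s ∈ S, Tendsto (fun i => inner ℝ (x i) s) l (𝓝 0)) (ξ : H) :
    Tendsto (fun i => inner ℝ (x i) ξ) l (𝓝 0) := by
  have hspan : ∀ s ∈ Submodule.span ℝ S, Tendsto (fun i => inner ℝ (x i) s) l (𝓝 0) := by
    intro s hs
    induction hs using Submodule.span_induction with
    | mem s hs => exact h s hs
    | zero => simpa using tendsto_const_nhds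
    | add a b _ _ ha hb => simpa [inner_add_right] using ha.add hb
    | smul c a _ ha => simpa [inner_smul_right] using ha.const_mul c
  rw [Metric.tendsto_nhds]
  intro δ hδ
  have hξ : ξ ∈ closure (Submodule.span ℝ S : Set H) := by
    rw [← Submodule.topologicalClosure_coe, hS]
    trivial
  -- The tolerance makes the error from replacing `ξ` by `s` at most `δ/2`; `|C| + 1` is a positive
  -- bound for the norms.
  obtain ⟨s, hs, hξs⟩ := Metric.mem_closure_iff.1 hξ (δ / (2 * (|C| + 1))) (by positivity)
  filter_upwards [hC, Metric.tendsto_nhds.1 (hspan s hs) (δ / 2) (by positivity)] with i h1 h2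
  rw [Real.dist_0_eq_abs] at h2 ⊢
  have e : inner ℝ (x i) ξ = inner ℝ (x i) (ξ - s) + inner ℝ (x i) s := by
    rw [inner_sub_right]; ring
  have h3 : |inner ℝ (x i) (ξ - s)| ≤ (|C| + 1) * (δ / (2 * (|C| + 1))) := by
    refine (abs_real_inner_le_norm _ _).trans ?_
    rw [dist_eq_norm] at hξs
    gcongr
    linarith [le_abs_self C]
  have h4 : (|C| + 1) * (δ / (2 * (|C| + 1))) = δ / 2 := by field_simp
  rw [e]
  linarith [abs_add_le (inner ℝ (x i) (ξ - s)) (inner ℝ (x i) s)]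

/-- The gradients, together with the rotated gradients of functions supported away from the origin,
are total in `L²(ℝ²)`. -/
lemma topologicalClosure_span_gradients :
    (Submodule.span ℝ {f : Lp Plane 2 volume |
      (∃ φ, ∃ h : IsTest Set.univ φ, f = (h.memLp_gradient volume).toLp (gradient φ)) ∨
      ∃ χ, ∃ h : IsTest {0}ᶜ χ, f = (h.memLp_perp_gradient volume).toLp
        fun x => perp (gradient χ x)}).topologicalClosure = ⊤ := by
  -- A field orthogonal to the whole set is divergence free in the plane and curl free off the
  -- origin, hence zero by uniqueness.
  rw [Submodule.topologicalClosure_eq_top_iff, Submodule.eq_bot_iff]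
  intro w hw
  rw [Submodule.mem_orthogonal'] at hw
  have hwm : MemLp w 2 volume := Lp.memLp w
  have hww : hwm.toLp w = w := Lp.toLp_coeFn w hwm
  have := ae_eq_zero_of_divFree_curlFree_plane hwm (fun φ hφ => ?_) (fun φ hφ => ?_)
  · exact (Lp.eq_zero_iff_ae_eq_zero).2 this
  · rw [← inner_toLp hwm (hφ.memLp_gradient _), hww]
    exact hw _ (Submodule.subset_span (Or.inl ⟨φ, hφ, rfl⟩))
  · rw [← inner_toLp hwm (hφ.memLp_perp_gradient _), hww]
    exact hw _ (Submodule.subset_span (Or.inr ⟨φ, hφ, rfl⟩))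

variable {ε : ℝ} {ℓ : Plane} {r : ℝ} {u : Plane → Plane} {ω : Plane → ℝ} {O : Set Plane}

lemma rigidExtension_eq_add (ε : ℝ) (ℓ : Plane) (r : ℝ) (u : Plane → Plane) :
    rigidExtension ε ℓ r u = (fluid ε).indicator u +
      (Metric.closedBall (0 : Plane) ε).indicator fun x => ℓ + r • perp x := by
  ext1 x
  by_cases h : ‖x‖ ≤ ε
  · simp [rigidExtension, h, mem_fluid]
  · simp [rigidExtension, h, mem_fluid, not_le.1 h]

lemma memLp_rigid (ε : ℝ) (ℓ : Plane) (r : ℝ) :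
    MemLp (fun x => ℓ + r • perp x) 2 (volume.restrict (Metric.closedBall (0 : Plane) ε)) := by
  have : IsFiniteMeasure (volume.restrict (Metric.closedBall (0 : Plane) ε)) :=
    isFiniteMeasure_restrict.2 measure_closedBall_lt_top.ne
  refine MemLp.of_bound
    (continuous_const.add (continuous_perp.const_smul r)).aestronglyMeasurable (‖ℓ‖ + ‖r‖ * ε) ?_
  filter_upwards [ae_restrict_mem measurableSet_closedBall] with x hx
  refine (norm_add_le _ _).trans ?_
  rw [norm_smul, norm_perp]
  gcongr
  simpa using hx

lemma memLp_rigidExtension (hu : MemLp u 2 (volume.restrict (fluid ε))) :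
    MemLp (rigidExtension ε ℓ r u) 2 volume := by
  rw [rigidExtension_eq_add]
  exact (memLp_indicator_fluid hu).add
    ((memLp_indicator_iff_restrict measurableSet_closedBall).2 (memLp_rigid ε ℓ r))

lemma eLpNorm_rigidExtension_le (hu : MemLp u 2 (volume.restrict (fluid ε))) {R : ℝ}
    (hR : ε ≤ R) : eLpNorm (rigidExtension ε ℓ r u) 2 volume ≤
      eLpNorm u 2 (volume.restrict (fluid ε)) + eLpNorm (fun x => ℓ + r • perp x) 2
        (volume.restrict (Metric.closedBall (0 : Plane) R)) := by
  rw [rigidExtension_eq_add]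
  refine (eLpNorm_add_le (memLp_indicator_fluid hu).1
    ((memLp_indicator_iff_restrict measurableSet_closedBall).2 (memLp_rigid ε ℓ r)).1
      (by norm_num)).trans ?_
  rw [eLpNorm_indicator_eq_eLpNorm_restrict (measurableSet_fluid ε),
    eLpNorm_indicator_eq_eLpNorm_restrict measurableSet_closedBall]
  gcongr

lemma integral_rigidExtension (hu : MemLp u 2 (volume.restrict (fluid ε))) {g : Plane → Plane}
    (hg : MemLp g 2 volume) : ∫ x, inner ℝ (rigidExtension ε ℓ r u x) (g x) =
      (∫ x in Metric.closedBall (0 : Plane) ε, inner ℝ (ℓ + r • perp x) (g x)) +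
        ∫ x in fluid ε, inner ℝ (u x) (g x) := by
  rw [← integral_add_compl (measurableSet_closedBall (x := (0 : Plane)) (ε := ε))
    (integrable_inner_of_memLp (memLp_rigidExtension hu) hg)]
  congr 1
  · refine setIntegral_congr_fun measurableSet_closedBall fun x hx => ?_
    have hx : ‖x‖ ≤ ε := by simpa using hx
    simp [rigidExtension, hx]
  · refine setIntegral_congr_fun (measurableSet_fluid ε) fun x hx => ?_
    have hx : ε < ‖x‖ := mem_fluid.1 hx
    simp [rigidExtension, not_le.2 hx]

/-- The boundary term of the fluid region cancels the divergence theorem for `ℓ` on the disk: the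
normal component of the translation is continuous across the circle. -/
lemma IsExteriorSolution.integral_rigidExtension_gradient (hε : 0 < ε)
    (hu : IsExteriorSolution ε ℓ ω u) {φ : Plane → ℝ} (hφ : IsTest Set.univ φ) :
    ∫ x, inner ℝ (rigidExtension ε ℓ r u x) (gradient φ x) =
      ∫ x in Metric.closedBall (0 : Plane) ε, inner ℝ (r • perp x) (gradient φ x) := by
  have hc := continuous_perp.const_smul r
  have hg := hφ.continuous_gradient
  rw [integral_rigidExtension hu.memLp (hφ.memLp_gradient _), hu.normalTrace φ hφ]
  simp_rw [inner_add_left]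
  rw [integral_add
    ((continuous_const.inner hg).continuousOn.integrableOn_compact (isCompact_closedBall 0 ε))
    ((hc.inner hg).continuousOn.integrableOn_compact (isCompact_closedBall 0 ε)),
    setIntegral_closedBall_inner_gradient hε ℓ hφ]
  ring

lemma IsExteriorSolution.integral_rigidExtension_perp_gradient
    (hu : IsExteriorSolution ε ℓ ω u) {φ : Plane → ℝ} (hφ : IsTest (fluid ε) φ) :
    ∫ x, inner ℝ (rigidExtension ε ℓ r u x) (perp (gradient φ x)) = -∫ x, ω x * φ x := by
  rw [integral_rigidExtension hu.memLp (hφ.memLp_perp_gradient _), hu.hasCurl φ hφ,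
    integral_eq_setIntegral_fluid fun x hx => by rw [hφ.eq_zero_of_fluid x hx, mul_zero],
    setIntegral_eq_zero_of_forall_eq_zero fun x hx => ?_, zero_add]
  rw [hφ.gradient_eq_zero_of_fluid x hx, perp_zero, inner_zero_right]

lemma tendsto_setIntegral_closedBall {g : Plane → ℝ} (hg : Integrable g) :
    Tendsto (fun ε => ∫ x in Metric.closedBall (0 : Plane) ε, g x) (𝓝[>] 0) (𝓝 0) := by
  refine hg.tendsto_setIntegral_nhds_zero ?_
  have h : Tendsto (fun ε : ℝ => ENNReal.ofReal (ε ^ Module.finrank ℝ Plane) *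
      volume (Metric.ball (0 : Plane) 1)) (𝓝[>] 0) (𝓝 0) := by
    have h1 : Tendsto (fun ε : ℝ => ε ^ Module.finrank ℝ Plane) (𝓝[>] 0) (𝓝 0) := by
      have : Continuous fun ε : ℝ => ε ^ Module.finrank ℝ Plane := by fun_prop
      simpa using (this.tendsto 0).mono_left nhdsWithin_le_nhds
    have h2 := ENNReal.Tendsto.mul_const (b := volume (Metric.ball (0 : Plane) 1))
      (ENNReal.tendsto_ofReal h1) (Or.inr measure_ball_lt_top.ne)
    simpa using h2
  refine h.congr' ?_
  filter_upwards [self_mem_nhdsWithin] with ε hε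
  exact (Measure.addHaar_closedBall volume _ (le_of_lt hε)).symm

lemma IsTest.eventually_fluid {φ : Plane → ℝ} (hφ : IsTest {0}ᶜ φ) :
    ∀ᶠ ε in 𝓝[>] (0 : ℝ), IsTest (fluid ε) φ := by
  have h0 : (tsupport φ)ᶜ ∈ 𝓝 (0 : Plane) :=
    (isClosed_tsupport φ).isOpen_compl.mem_nhds fun h => hφ.support_subset h rfl
  obtain ⟨δ, hδ, hball⟩ := Metric.nhds_basis_closedBall.mem_iff.1 h0
  filter_upwards [Ioo_mem_nhdsGT hδ] with ε hε
  refine ⟨hφ.smooth, hφ.compact, fun x hx hxε => ?_⟩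
  exact hball (Metric.closedBall_subset_closedBall hε.2.le hxε) hx

lemma IsLinftyC.eventually_disjoint (h : IsLinftyC {0}ᶜ ω) :
    ∀ᶠ ε in 𝓝[>] (0 : ℝ), Disjoint (essSupport ω) (Metric.ball 0 ε) := by
  have h0 : (essSupport ω)ᶜ ∈ 𝓝 (0 : Plane) :=
    h.isCompact_support.isClosed.isOpen_compl.mem_nhds fun h' => h.support_subset h' rfl
  obtain ⟨δ, hδ, hball⟩ := Metric.nhds_basis_ball.mem_iff.1 h0
  filter_upwards [Ioo_mem_nhdsGT hδ] with ε hε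
  refine Set.disjoint_left.2 fun x hx hxε => ?_
  exact hball (Metric.ball_subset_ball hε.2.le hxε) hx

/-- The rigid extensions of the exterior solutions converge weakly to the Biot–Savart field. -/
lemma weakTendstoL2_rigidExtension (h : IsLinftyC {0}ᶜ ω) (hmean : ∫ x, ω x = 0) (ℓ : Plane)
    (r : ℝ) {u : ℝ → Plane → Plane}
    (hu : ∀ᶠ ε in 𝓝[>] (0 : ℝ), IsExteriorSolution ε ℓ ω (u ε)) :
    WeakTendstoL2 (fun ε => rigidExtension ε ℓ r (u ε)) (biotSavart ω) := by
  classical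
  set K := biotSavart ω with hKdef
  have hK : MemLp K 2 volume := h.memLp_biotSavart hmean
  have hmem : ∀ᶠ ε in 𝓝[>] (0 : ℝ), MemLp (rigidExtension ε ℓ r (u ε)) 2 volume :=
    hu.mono fun ε hε => memLp_rigidExtension hε.memLp
  -- The difference between the extension and `K` as an element of L². The value `0` is a default
  -- for those `ε` where the extension is not in L²; eventually it is not used.
  let x : ℝ → Lp Plane 2 (volume : Measure Plane) := fun ε =>
    if hm : MemLp (rigidExtension ε ℓ r (u ε)) 2 volume then hm.toLp _ - hK.toLp K else 0
  have hx : ∀ᶠ ε in 𝓝[>] (0 : ℝ), ∀ g (hg : MemLp g 2 volume), inner ℝ (x ε) (hg.toLp g) =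
      (∫ y, inner ℝ (rigidExtension ε ℓ r (u ε) y) (g y)) - ∫ y, inner ℝ (K y) (g y) := by
    filter_upwards [hmem] with ε hm g hg
    simp only [x, hm, dif_pos, inner_sub_left, inner_toLp]
  obtain ⟨η, hη, hηℓ⟩ := exists_stream ℓ 1
  have hL : MemLp (fun x => perp (gradient η x) - K x) 2 volume :=
    (hη.memLp_perp_gradient volume).sub hK
  have hbound : ∀ᶠ ε in 𝓝[>] (0 : ℝ), ‖x ε‖ ≤ (eLpNorm K 2 volume +
      eLpNorm (fun x => perp (gradient η x) - K x) 2 volume + eLpNorm (fun x => ℓ + r • perp x) 2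
        (volume.restrict (Metric.closedBall (0 : Plane) 1))).toReal + ‖hK.toLp K‖ := by
    filter_upwards [hu, h.eventually_disjoint, hmem, Ioo_mem_nhdsGT one_pos] with ε h1 h2 hm h3
    simp only [x, hm, dif_pos]
    refine (norm_sub_le _ _).trans ?_
    gcongr
    rw [Lp.norm_toLp]
    refine ENNReal.toReal_mono ?_ ?_
    · exact ENNReal.add_ne_top.2 ⟨ENNReal.add_ne_top.2 ⟨hK.2.ne, hL.2.ne⟩, (memLp_rigid 1 ℓ r).2.ne⟩
    -- The constructed solution satisfies the uniform bound, and by uniqueness the given `u ε`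
    -- agrees with it almost everywhere. One stream function, adapted to the unit disk, serves all
    -- `ε < 1`.
    · obtain ⟨w, hw, hwn⟩ := exists_isExteriorSolution h hmean h3.1 h2 hη hηℓ h3.2.le
      refine (eLpNorm_rigidExtension_le h1.memLp h3.2.le).trans ?_
      rw [eLpNorm_congr_ae (hw.ae_eq h3.1 h1)]
      gcongr
  have hlim := tendsto_inner_of_total hbound topologicalClosure_span_gradients ?_
  · refine ⟨hmem, hK, fun φ hφ => ?_⟩
    rw [← tendsto_sub_nhds_zero_iff]
    exact (hlim (hφ.toLp φ)).congr' (hx.mono fun ε hε => hε φ hφ)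
  · rintro s (⟨φ, hφ, rfl⟩ | ⟨φ, hφ, rfl⟩)
    · have hi : Integrable fun x => inner ℝ (r • perp x) (gradient φ x) :=
        integrable_inner_of_hasCompactSupport
          (continuous_perp.const_smul r).locallyIntegrable
          hφ.continuous_gradient hφ.hasCompactSupport_gradient
      refine (tendsto_setIntegral_closedBall hi).congr' ?_
      -- Only the rotation `r x^⊥` on the disk survives, and it tends to zero with the area.
      filter_upwards [hu, hx, self_mem_nhdsWithin] with ε h1 h2 h3
      rw [h2 _ (hφ.memLp_gradient volume), h1.integral_rigidExtension_gradient h3 hφ,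
        (h.integral_biotSavart hmean hφ).1, sub_zero]
    · refine tendsto_const_nhds.congr' ?_
      -- Once the disk misses the support of `φ`, both fields pair to `-∫ ω φ` and the difference is
      -- exactly zero.
      filter_upwards [hu, hx, hφ.eventually_fluid] with ε h1 h2 h3
      rw [h2 _ (hφ.memLp_perp_gradient volume), h1.integral_rigidExtension_perp_gradient h3,
        (h.integral_biotSavart hmean hφ).2, sub_self]

end WeakConvergence

end ExteriorDisk

end

/-! ### Assembly of the three assertions -/

open ExteriorDisk in
theorem mainTheorem8 (ℓ₀ : Plane) (r₀ : ℝ) (ω₀ : Plane → ℝ)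
    (hω₀ : IsLinftyC {0}ᶜ ω₀) (hmean : ∫ x, ω₀ x = 0) :
    -- existence and uniqueness in the exterior domain
    (∀ ε : ℝ, 0 < ε → Disjoint (essSupport ω₀) (Metric.ball 0 ε) →
      ∃ u : Plane → Plane, IsExteriorSolution ε ℓ₀ ω₀ u ∧
        ∀ v : Plane → Plane, IsExteriorSolution ε ℓ₀ ω₀ v →
          v =ᵐ[volume.restrict (fluid ε)] u) ∧
    -- weak convergence of the rigid extensions to the Biot–Savart field
    (∀ u : ℝ → Plane → Plane,
      (∀ᶠ ε in 𝓝[>] (0 : ℝ), IsExteriorSolution ε ℓ₀ ω₀ (u ε)) →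
        WeakTendstoL2 (fun ε => rigidExtension ε ℓ₀ r₀ (u ε)) (biotSavart ω₀)) ∧
    -- the Biot–Savart field is the unique square integrable solution in the whole plane
    (ConvolutionExists ω₀ bsKernel (ContinuousLinearMap.lsmul ℝ ℝ) volume ∧
      IsPlaneSolution ω₀ (biotSavart ω₀) ∧
        ∀ v : Plane → Plane, IsPlaneSolution ω₀ v → v =ᵐ[volume] biotSavart ω₀) := by
  refine ⟨fun ε hε hd => ?_, fun u hu => weakTendstoL2_rigidExtension hω₀ hmean ℓ₀ r₀ hu,
    hω₀.convolutionExists, hω₀.isPlaneSolution hmean,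
    fun v hv => (hω₀.isPlaneSolution hmean).ae_eq hv⟩
  -- At fixed `ε` no uniformity is required, so the stream function need only match `ℓ₀` on the disk
  -- itself.
  obtain ⟨η, hη, hηℓ⟩ := exists_stream ℓ₀ ε
  obtain ⟨u, hu, -⟩ := exists_isExteriorSolution hω₀ hmean hε hd hη hηℓ le_rfl
  exact ⟨u, hu, fun v hv => hu.ae_eq hε hv⟩
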